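/- Let $p$ be a prime, let $B$ be a perfect commutative ring of characteristic $p$, let $n\ge 0$, and let $C:=B[x_1^{p^{-\infty}},\ldots,x_n^{p^{-\infty}}]/(x_1,\ldots,x_n)$, where $B[x_1^{p^{-\infty}},\ldots,x_n^{p^{-\infty}}]$ is the ring of finite sums $\sum_\alpha b_\alpha x^\alpha$ with $b_\alpha\in B$, $\alpha\in(\mathbb{Z}_+[1/p])^n$, and $\mathbb{Z}_+[1/p]:=\{a\in\mathbb{Z}[1/p] : a\ge 0\}$. **Notation.** $C^\flat:=\varprojlim(\cdots\to C\to C\to C)$ (all maps are Frobenius), $\nu_m:C^\flat\to C$ is the map $(c_0,c_1,\ldots)\mapsto c_m$, and $W$ denotes $p$-typical Witt vectors. $A_{\rm cris}(C)$ is the $p$-adic completion of the PD hull (compatible with the divided powers $\gamma_m(p)=p^m/m!$) of the epimorphism $W(C^\flat)\to C$ induced by $\nu_0$. $F:A_{\rm cris}(C)\to A_{\rm cris}(C)$ is induced by the Frobenius of $C$, and $I_{\rm cris}(C):=\ker(A_{\rm cris}(C)\to C)$. For an $\mathbb{F}_p$-algebra $R$ let $W(R)[V^{-1}]:=\varinjlim(W(R)\xrightarrow{V}W(R)\xrightarrow{V}\cdots)$.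 The group $W(C^\flat/\ker\nu_m)[V^{-1}]$ carries operators $F,V$ and the action of $W(C^\flat)$ given by $u\cdot V^{-i}x=V^{-i}((F^{-i}u)x)$. Let $M(C)$ be the preimage of $W(C)\subset W(C)[V^{-1}]$ in $\varprojlim_m W(C^\flat/\ker\nu_m)[V^{-1}]$ (note that $C^\flat/\ker\nu_0=C$). It is a $W(C^\flat)$-module with operators $F,V$, and there is a canonical map $W(C^\flat)\to M(C)$. **Statement.** (a) There is a unique divided power structure $\gamma$ on the ideal $I_{\rm cris}(C)$ which extends the divided powers $\gamma_m(b)$, $b\in\ker(W(C^\flat)\to C)$, in the PD hull. (b) There is a unique $F$-linear map $F':I_{\rm cris}(C)\to A_{\rm cris}(C)$ such that $F'(pb)=F(b)$ for $b\in A_{\rm cris}(C)$, $F'(\gamma_m(b))=\frac{p^{m-1}}{m!}F'(b)^m$ for $b\in I_{\rm cris}(C)$ and $m\ge 1$, and $F'(b)=(p-1)!\,\gamma_p(b)+\frac{F(b)-b^p}{p}$ for $b\in\ker(W(C^\flat)\to C)$ (here $\frac{F(b)-b^p}{p}$ is computed in $W(C^\flat)$, which has no $p$-torsion). (c) There is a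 unique $W(C^\flat)$-linear map $f:M(C)\to A_{\rm cris}(C)$ which commutes with $F$ and has the following property: if $x\in M(C)$ and $m\ge 0$ are such that $V^mx$ is the image of some $w\in W(C^\flat)$, then $(F')^m$ is defined at the image of $w$ in $A_{\rm cris}(C)$, and $f(x)=(F')^m(w)$. (d) The map $f$ is injective, and its image is the set $A''_{\rm cris}(C)$ of all $u\in A_{\rm cris}(C)$ for which there is a sequence $v_0,v_1,\ldots\in A_{\rm cris}(C)$ converging to $0$ in the $p$-adic topology such that $p^mu=F^m(v_m)$ for all $m\ge 0$. In other words, $f$ is an isomorphism $M(C)\to A''_{\rm cris}(C)$. -/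

import Mathlib

noncomputable section

namespace Fontaine

open MvPolynomial

universe u

/-! ### Divided power hulls -/

section PDHull

variable (p : ℕ) {R : Type u} [CommRing R] (I : Ideal R)

/-- The relations which turn the divided power algebra `Γ_R(I)` into the PD hull of `(R, I)`
compatible with the divided powers `γ_m(p) = p ^ m / m!`.
First, `γ_1(x) = x` for `x ∈ I`. Second, `u * γ_m(p) = p ^ (m - v)`, where `m! = u * p ^ v`
with `u` prime to `p`. (The hull is only used for `p ∈ I` and for `R` in which all integers prime
to `p` are invertible; then the second relation says that `γ_m(p) = p ^ m / m!`.) -/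
inductive PDHullRel : DividedPowerAlgebra R I → DividedPowerAlgebra R I → Prop
  | one (x : I) : PDHullRel (DividedPowerAlgebra.dp R 1 x) (algebraMap R _ (x : R))
  | compat (x : I) (hx : (x : R) = (p : R)) (m : ℕ) :
      PDHullRel
        (((m.factorial / p ^ padicValNat p m.factorial : ℕ) : DividedPowerAlgebra R I) *
          DividedPowerAlgebra.dp R m x)
        ((p : DividedPowerAlgebra R I) ^ (m - padicValNat p m.factorial))

/-- The PD hull of `(R, I)`, with the condition `γ_m(p) = p ^ m / m!`:
the quotient of the divided power algebra of the module `I` by the relations above. -/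
def PDHull : Type u := DividedPowerAlgebra R I ⧸ Ideal.ofRel (PDHullRel p I)

instance : CommRing (PDHull p I) :=
  inferInstanceAs (CommRing (DividedPowerAlgebra R I ⧸ Ideal.ofRel (PDHullRel p I)))

instance : Algebra R (PDHull p I) :=
  inferInstanceAs (Algebra R (DividedPowerAlgebra R I ⧸ Ideal.ofRel (PDHullRel p I)))

/-- The quotient map from the divided power algebra to the PD hull. -/
def PDHull.mk : DividedPowerAlgebra R I →ₐ[R] PDHull p I :=
  Ideal.Quotient.mkₐ R (Ideal.ofRel (PDHullRel p I))

/-- The element `γ_n(x)` of the PD hull of `(R, I)`, for `x ∈ I`. -/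
def PDHull.dp (n : ℕ) (x : I) : PDHull p I := PDHull.mk p I (DividedPowerAlgebra.dp R n x)

variable {p I}

theorem PDHull.mk_eq_of_rel {a b : DividedPowerAlgebra R I} (h : PDHullRel p I a b) :
    PDHull.mk p I a = PDHull.mk p I b := by
  refine (Ideal.Quotient.eq).2 ?_
  exact Submodule.subset_span ⟨a, b, h, by simp⟩

/-- A ring homomorphism from the divided power algebra is given by a ring homomorphism `g` from `R`
and by images `d n x` of the elements `γ_n(x)` which satisfy the defining relations. -/
def PDHull.liftAux {S : Type u} [CommRing S] (g : R →+* S) (d : ℕ → I → S)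
    (zero : ∀ x, d 0 x = 1)
    (smul : ∀ (r : R) n x, d n (r • x) = g r ^ n * d n x)
    (mul : ∀ m n x, d m x * d n x = ((m + n).choose m : S) * d (m + n) x)
    (add : ∀ n x y,
      d n (x + y) = ∑ k ∈ Finset.HasAntidiagonal.antidiagonal n, d k.1 x * d k.2 y) :
    DividedPowerAlgebra R I →+* S :=
  RingCon.lift (DividedPowerAlgebra.ringCon R I)
    (MvPolynomial.eval₂Hom g (fun i : ℕ × I => d i.1 i.2)) (by
      refine RingCon.ringConGen_le.2 ?_
      intro a b h
      change (MvPolynomial.eval₂Hom g (fun i : ℕ × I => d i.1 i.2)) a =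
        (MvPolynomial.eval₂Hom g (fun i : ℕ × I => d i.1 i.2)) b
      cases h with
      | rfl_zero => rfl
      | zero => rw [MvPolynomial.eval₂Hom_X', map_one]; exact zero _
      | smul => simp [smul, MvPolynomial.smul_eq_C_mul]
      | mul => simp [mul]
      | add => simp [add])

/-- A ring homomorphism from the PD hull is given by a ring homomorphism `g` from `R` and
by images `d n x` of the elements `γ_n(x)` which satisfy the defining relations. -/
def PDHull.lift {S : Type u} [CommRing S] (g : R →+* S) (d : ℕ → I → S)
    (zero : ∀ x, d 0 x = 1)
    (smul : ∀ (r : R) n x, d n (r • x) = g r ^ n * d n x)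
    (mul : ∀ m n x, d m x * d n x = ((m + n).choose m : S) * d (m + n) x)
    (add : ∀ n x y,
      d n (x + y) = ∑ k ∈ Finset.HasAntidiagonal.antidiagonal n, d k.1 x * d k.2 y)
    (one : ∀ x : I, d 1 x = g x)
    (compat : ∀ x : I, (x : R) = p → ∀ m : ℕ,
      ((m.factorial / p ^ padicValNat p m.factorial : ℕ) : S) * d m x =
        (p : S) ^ (m - padicValNat p m.factorial)) :
    PDHull p I →+* S :=
  Ideal.Quotient.lift (Ideal.ofRel (PDHullRel p I)) (PDHull.liftAux g d zero smul mul add) (by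
    intro a ha
    have hdp : ∀ n (x : I), PDHull.liftAux g d zero smul mul add
        (DividedPowerAlgebra.dp R n x) = d n x := fun n x => by
      change MvPolynomial.eval₂Hom g (fun i : ℕ × I => d i.1 i.2) (X (n, x)) = d n x
      simp
    have halg : ∀ r : R, PDHull.liftAux g d zero smul mul add
        (algebraMap R _ r) = g r := fun r => by
      change MvPolynomial.eval₂Hom g (fun i : ℕ × I => d i.1 i.2) (C r) = g r
      simp
    rw [← RingHom.mem_ker]
    refine (Submodule.span_le (p := RingHom.ker _)).2 ?_ ha
    rintro _ ⟨a, b, h, hab⟩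
    rw [SetLike.mem_coe, RingHom.mem_ker, eq_sub_of_add_eq hab, map_sub, sub_eq_zero]
    cases h with
    | one x => rw [hdp, halg, one]
    | compat x hx m =>
      rw [map_mul, map_natCast, map_pow, map_natCast, hdp]
      exact compat x hx m)

@[simp]
theorem PDHull.lift_dp {S : Type u} [CommRing S] (g : R →+* S) (d : ℕ → I → S)
    (h1 h2 h3 h4 h5 h6) (n : ℕ) (x : I) :
    PDHull.lift (p := p) g d h1 h2 h3 h4 h5 h6 (PDHull.dp p I n x) = d n x := by
  change MvPolynomial.eval₂Hom g (fun i : ℕ × I => d i.1 i.2) (X (n, x)) = d n x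
  simp

@[simp]
theorem PDHull.lift_algebraMap {S : Type u} [CommRing S] (g : R →+* S) (d : ℕ → I → S)
    (h1 h2 h3 h4 h5 h6) (r : R) :
    PDHull.lift (p := p) g d h1 h2 h3 h4 h5 h6 (algebraMap R _ r) = g r := by
  change MvPolynomial.eval₂Hom g (fun i : ℕ × I => d i.1 i.2) (C r) = g r
  simp

/-- Functoriality of the PD hull. -/
def PDHull.map {R' : Type u} [CommRing R'] {I' : Ideal R'} (φ : R →+* R')
    (h : ∀ x ∈ I, φ x ∈ I') : PDHull p I →+* PDHull p I' :=
  PDHull.lift ((algebraMap R' (PDHull p I')).comp φ)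
    (fun n x => PDHull.dp p I' n ⟨φ x, h x x.2⟩)
    (fun x => by simp [PDHull.dp, DividedPowerAlgebra.dp_zero])
    (fun r n x => by
      have : (⟨φ (r • x : I), h _ (r • x).2⟩ : I') = φ r • ⟨φ x, h x x.2⟩ := by
        ext; simp
      rw [this, PDHull.dp, DividedPowerAlgebra.dp_smul, map_smul, Algebra.smul_def]
      simp [PDHull.dp])
    (fun m n x => by
      simp only [PDHull.dp]
      rw [← map_mul, DividedPowerAlgebra.dp_mul, map_nsmul, nsmul_eq_mul])
    (fun n x y => by
      have : (⟨φ (x + y : I), h _ (x + y).2⟩ : I') = ⟨φ x, h x x.2⟩ + ⟨φ y, h y y.2⟩ := by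
        ext; simp
      simp only [PDHull.dp]
      rw [this, DividedPowerAlgebra.dp_add, map_sum]
      simp)
    (fun x => by
      rw [PDHull.dp, PDHull.mk_eq_of_rel (PDHullRel.one _)]
      simp)
    (fun x hx m => by
      have := PDHull.mk_eq_of_rel (PDHullRel.compat (p := p) (I := I') ⟨φ x, h x x.2⟩
        (by simp [hx]) m)
      simpa [PDHull.dp] using this)

/-- For `p` prime, `T` of characteristic `p`, and `g : R →+* T` which vanishes on `I`,
the homomorphism from the PD hull of `(R, I)` to `T` which extends `g` and which is zero on
`γ_n(x)` for all `n ≥ 1` and `x ∈ I`. -/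
def PDHull.augmentation [Fact p.Prime] {T : Type u} [CommRing T] [CharP T p] (g : R →+* T)
    (h : ∀ x ∈ I, g x = 0) : PDHull p I →+* T :=
  PDHull.lift g (fun n _ => if n = 0 then 1 else 0)
    (fun _ => by simp)
    (fun r n x => by by_cases hn : n = 0 <;> simp [hn])
    (fun m n x => by
      by_cases hm : m = 0 <;> by_cases hn : n = 0 <;> simp [hm, hn])
    (fun n x y => by
      by_cases hn : n = 0
      · simp [hn]
      · rw [if_neg hn, Finset.sum_eq_zero]
        intro k hk
        rw [Finset.HasAntidiagonal.mem_antidiagonal] at hk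
        by_cases h1 : k.1 = 0
        · rw [if_neg (show k.2 ≠ 0 by omega), mul_zero]
        · rw [if_neg h1, zero_mul])
    (fun x => by simp [h x x.2])
    (fun x _ m => by
      by_cases hm : m = 0
      · simp [hm]
      · have := padicValNat_factorial_lt_of_ne_zero (p := p) hm
        rw [if_neg hm, CharP.cast_eq_zero T p, zero_pow (by omega), mul_zero])

end PDHull

/-! ### Functoriality of the `p`-adic completion -/

section Completion

variable (p : ℕ) {S T : Type u} [CommRing S] [CommRing T]

theorem padicMap_aux (φ : S →+* T) (n : ℕ) :
    Ideal.span {(p : S)} ^ n ≤ Ideal.comap φ (Ideal.span {(p : T)} ^ n) := by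
  rw [Ideal.span_singleton_pow, Ideal.span_singleton_pow, Ideal.span_singleton_le_iff_mem,
    Ideal.mem_comap, map_pow, map_natCast]
  exact Ideal.mem_span_singleton_self _

theorem padicMap_compat (φ : S →+* T) {m n : ℕ} (hle : m ≤ n) :
    (Ideal.Quotient.factorPow (Ideal.span {(p : T)}) hle).comp
      ((Ideal.quotientMap (Ideal.span {(p : T)} ^ n) φ (padicMap_aux p φ n)).comp
        (AdicCompletion.evalₐ (Ideal.span {(p : S)}) n).toRingHom) =
      (Ideal.quotientMap (Ideal.span {(p : T)} ^ m) φ (padicMap_aux p φ m)).comp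
        (AdicCompletion.evalₐ (Ideal.span {(p : S)}) m).toRingHom := by
  ext x
  obtain ⟨y, rfl⟩ := AdicCompletion.mk_surjective _ _ x
  have h := AdicCompletion.Ideal.mk_eq_mk (Ideal.span {(p : S)}) hle y
  simp only [AlgHom.toRingHom_eq_coe, RingHom.comp_apply, RingHom.coe_coe,
    AdicCompletion.evalₐ_mk, Ideal.quotientMap_mk]
  have h' := congrArg (Ideal.quotientMap (Ideal.span {(p : T)} ^ m) φ (padicMap_aux p φ m)) h
  rwa [Ideal.quotientMap_mk, Ideal.quotientMap_mk] at h'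

/-- The homomorphism of `p`-adic completions induced by a ring homomorphism. -/
def padicMap (φ : S →+* T) :
    AdicCompletion (Ideal.span {(p : S)}) S →+* AdicCompletion (Ideal.span {(p : T)}) T :=
  AdicCompletion.liftRingHom (Ideal.span {(p : T)})
    (fun n => (Ideal.quotientMap (Ideal.span {(p : T)} ^ n) φ (padicMap_aux p φ n)).comp
      (AdicCompletion.evalₐ (Ideal.span {(p : S)}) n).toRingHom)
    (padicMap_compat p φ)

end Completion

/-! ### `C^♭`, `W(C^♭)`, `A_cris(C)` -/

section Acris

variable (p : ℕ) [Fact p.Prime] (C : Type u) [CommRing C] [CharP C p]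

/-- The ring `W(C^♭)`. Here `C^♭ = lim (⋯ → C → C)` (the transition maps are the Frobenius maps)
is `Perfection C p`, and `ν_n : C^♭ → C` is `Perfection.coeff C p n`. -/
abbrev WFlat : Type u := WittVector p (Perfection C p)

/-- The canonical homomorphism `W(C^♭) → C` induced by `ν_0 : C^♭ → C`. -/
def theta : WFlat p C →+* C := (Perfection.coeff C p 0).comp WittVector.constantCoeff

/-- The ideal `Ker (W(C^♭) → C)`. -/
abbrev kerTheta : Ideal (WFlat p C) := RingHom.ker (theta p C)

/-- The PD hull of `W(C^♭) → C`. -/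
abbrev AcrisHull : Type u := PDHull p (kerTheta p C)

/-- `A_cris(C)`: the `p`-adic completion of the PD hull of `W(C^♭) → C`. -/
abbrev Acris : Type u := AdicCompletion (Ideal.span {(p : AcrisHull p C)}) (AcrisHull p C)

/-- The canonical homomorphism from the PD hull to its `p`-adic completion `A_cris(C)`. -/
def toAcris : AcrisHull p C →+* Acris p C := algebraMap (AcrisHull p C) (Acris p C)

/-- The canonical homomorphism from the PD hull to `C`. -/
def hullToC : AcrisHull p C →+* C :=
  PDHull.augmentation (theta p C) (fun _ h => h)

/-- The canonical homomorphism `A_cris(C) → C`. -/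
def acrisToC : Acris p C →+* C :=
  (Ideal.Quotient.lift (Ideal.span {(p : AcrisHull p C)}) (hullToC p C) (by
    intro a ha
    obtain ⟨b, rfl⟩ := Ideal.mem_span_singleton'.1 ha
    simp)).comp
    (AdicCompletion.evalOneₐ (Ideal.span {(p : AcrisHull p C)})).toRingHom

/-- The ideal `I_cris(C) = Ker (A_cris(C) → C)`. -/
abbrev Icris : Ideal (Acris p C) := RingHom.ker (acrisToC p C)

theorem theta_frobenius (x : WFlat p C) :
    theta p C (WittVector.frobenius x) = theta p C x ^ p := by
  rw [theta, RingHom.comp_apply, RingHom.comp_apply, ← map_pow]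
  congr 1
  change (WittVector.frobenius x).coeff 0 = x.coeff 0 ^ p
  exact WittVector.coeff_frobenius_charP p x 0

/-- The endomorphism of the PD hull induced by the Frobenius endomorphism of `C`; on `W(C^♭)` this
is the Witt vector Frobenius. -/
def hullFrobenius : AcrisHull p C →+* AcrisHull p C :=
  PDHull.map (WittVector.frobenius (R := Perfection C p)) (fun x hx => by
    rw [RingHom.mem_ker] at hx ⊢
    rw [theta_frobenius, hx, zero_pow (Fact.out : p.Prime).ne_zero])

/-- The endomorphism `F` of `A_cris(C)` induced by the Frobenius endomorphism of `C`. -/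
def acrisFrobenius : Acris p C →+* Acris p C := padicMap p (hullFrobenius p C)

end Acris

/-! ### The divided powers on `I_cris(C)` and the map `F'` -/

section FPrime

variable (p : ℕ) [Fact p.Prime] (C : Type u) [CommRing C] [CharP C p]

/-- `γ` is the canonical divided power structure on `I_cris(C)`, i.e., it extends the divided
powers of the elements of `Ker (W(C^♭) → C)` in the PD hull. -/
def IsCanonicalDividedPowers (γ : DividedPowers (Icris p C)) : Prop :=
  ∀ (n : ℕ) (b : kerTheta p C),
    γ.dpow n (algebraMap (WFlat p C) (Acris p C) b) = toAcris p C (PDHull.dp p (kerTheta p C) n b)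

/-- The three conditions which characterize the `F`-linear map `F' : I_cris(C) → A_cris(C)`.
In `dpow` the equality `F'(γ_n(b)) = (p ^ (n - 1) / n!) * F'(b) ^ n` is multiplied by the
prime-to-`p` part of `n!`, which is invertible in `A_cris(C)`.
In `theta` the element `d` is `δ(b) = (F(b) - b ^ p) / p` (recall that `W(C^♭)` has no
`p`-torsion). -/
structure IsFPrime (γ : DividedPowers (Icris p C))
    (F' : Icris p C →ₛₗ[acrisFrobenius p C] Acris p C) : Prop where
  mul_p : ∀ (b : Acris p C) (c : Icris p C), (c : Acris p C) = p * b → F' c = acrisFrobenius p C b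
  dpow : ∀ (n : ℕ), 1 ≤ n → ∀ b c : Icris p C, (c : Acris p C) = γ.dpow n b →
    ((n.factorial / p ^ padicValNat p n.factorial : ℕ) : Acris p C) * F' c =
      (p : Acris p C) ^ (n - 1 - padicValNat p n.factorial) * F' b ^ n
  theta : ∀ (b d : WFlat p C) (c : Icris p C), b ∈ kerTheta p C →
    (p : WFlat p C) * d = WittVector.frobenius b - b ^ p →
    (c : Acris p C) = algebraMap (WFlat p C) (Acris p C) b →
    F' c = ((p - 1).factorial : Acris p C) * γ.dpow p (c : Acris p C) +
      algebraMap (WFlat p C) (Acris p C) d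

variable {p C}

/-- `IteratesTo F' n a b` says that `(F') ^ n` is defined at `a` and that its value is `b`. -/
def IteratesTo (F' : Icris p C → Acris p C) : ℕ → Acris p C → Acris p C → Prop
  | 0, a, b => a = b
  | n + 1, a, b => ∃ h : a ∈ Icris p C, IteratesTo F' n (F' ⟨a, h⟩) b

variable (p C)

/-- `A''_cris(C)`: the set of all `u` such that `p ^ n * u = F ^ n (v_n)` for some sequence `v_n`
which converges to `0` in the `p`-adic topology of `A_cris(C)`. -/
def AcrisDoublePrime : Set (Acris p C) :=
  {u | ∃ v : ℕ → Acris p C,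
    (∀ k : ℕ, ∀ᶠ n in Filter.atTop, v n ∈ Ideal.span {(p : Acris p C)} ^ k) ∧
    ∀ n : ℕ, (p : Acris p C) ^ n * u = (acrisFrobenius p C)^[n] (v n)}

end FPrime

/-! ### `W(R)[V⁻¹]` -/

section WittVInv

variable (p : ℕ) [Fact p.Prime] (R : Type u) [CommRing R]

/-- The transition maps `V ^ (j - i)` of the inductive system `W(R) → W(R) → ⋯` -/
def verschiebungPow (i j : ℕ) (_ : i ≤ j) : WittVector p R →+ WittVector p R where
  toFun := WittVector.verschiebung^[j - i]
  map_zero' := iterate_map_zero _ _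
  map_add' := iterate_map_add _ _

variable {R} in
theorem verschiebungPow_apply (i j : ℕ) (h : i ≤ j) (x : WittVector p R) :
    verschiebungPow p R i j h x = WittVector.verschiebung^[j - i] x := rfl

variable {p R} in
theorem map_frobenius {S : Type u} [CommRing S] (φ : R →+* S) (x : WittVector p R) :
    WittVector.map φ (WittVector.frobenius x) = WittVector.frobenius (WittVector.map φ x) :=
  (WittVector.frobenius_isPoly p).map φ x

instance : DirectedSystem (fun _ : ℕ => WittVector p R) (fun i j h => verschiebungPow p R i j h) where
  map_self i x := by simp [verschiebungPow_apply]
  map_map i j k hij hjk x := by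
    simp only [verschiebungPow_apply, ← Function.iterate_add_apply]
    congr 1; omega

/-- `W(R)[V⁻¹]`, the inductive limit of `W(R) → W(R) → ⋯`, where all maps are equal to `V`. -/
def WittVInv : Type u :=
  AddCommGroup.DirectLimit (fun _ : ℕ => WittVector p R) (verschiebungPow p R)

instance : AddCommGroup (WittVInv p R) :=
  inferInstanceAs (AddCommGroup
    (AddCommGroup.DirectLimit (fun _ : ℕ => WittVector p R) (verschiebungPow p R)))

namespace WittVInv

variable {R}

/-- The element `V ^ (-n) x` of `W(R)[V⁻¹]`, for `x ∈ W(R)`. -/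
def of (n : ℕ) : WittVector p R →+ WittVInv p R :=
  AddCommGroup.DirectLimit.of (fun _ : ℕ => WittVector p R) (verschiebungPow p R) n

variable {p}

theorem exists_of (z : WittVInv p R) : ∃ (n : ℕ) (x : WittVector p R), z = of p n x :=
  AddCommGroup.DirectLimit.induction_on
    (C := fun z : WittVInv p R => ∃ (n : ℕ) (x : WittVector p R), z = of p n x) z
    fun n x => ⟨n, x, rfl⟩

variable (p)

/-- The additive map `W(R)[V⁻¹] → W(S)[V⁻¹]` given by `V ^ (-n) x ↦ V ^ (-n) (g_n x)`. -/
def mapAux {S : Type u} [CommRing S] (g : ℕ → WittVector p R →+ WittVector p S)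
    (hg : ∀ n x, g (n + 1) (WittVector.verschiebung x) = WittVector.verschiebung (g n x)) :
    WittVInv p R →+ WittVInv p S :=
  AddCommGroup.DirectLimit.map g (by
    intro i j h
    ext1 x
    obtain ⟨k, rfl⟩ := Nat.exists_eq_add_of_le h
    simp only [AddMonoidHom.comp_apply, verschiebungPow_apply, Nat.add_sub_cancel_left]
    clear h
    induction k with
    | zero => rfl
    | succ k ih =>
      rw [Function.iterate_succ_apply', Function.iterate_succ_apply', ← ih, ← hg]
      rfl)

@[simp]
theorem mapAux_of {S : Type u} [CommRing S] (g : ℕ → WittVector p R →+ WittVector p S) (hg)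
    (n : ℕ) (x : WittVector p R) : mapAux p g hg (of p n x) = of p n (g n x) :=
  AddCommGroup.DirectLimit.map_apply_of _ _ _

/-- Functoriality of `W(R)[V⁻¹]`: `V ^ (-n) x ↦ V ^ (-n) (W(φ) x)`. -/
def map {S : Type u} [CommRing S] (φ : R →+* S) : WittVInv p R →+ WittVInv p S :=
  mapAux p (fun _ => (WittVector.map φ).toAddMonoidHom)
    (fun _ x => WittVector.map_verschiebung φ x)

variable (R)

/-- The operator `V` on `W(R)[V⁻¹]`: `V ^ (-n) x ↦ V ^ (-n) (V x)`. -/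
def V : WittVInv p R →+ WittVInv p R :=
  mapAux p (fun _ => WittVector.verschiebung) (fun _ _ => rfl)

/-- The operator `F` on `W(R)[V⁻¹]`: `V ^ (-n) x ↦ V ^ (-n) (F x)`. -/
def F [CharP R p] : WittVInv p R →+ WittVInv p R :=
  mapAux p (fun _ => (WittVector.frobenius (R := R)).toAddMonoidHom)
    (fun _ x => (WittVector.verschiebung_frobenius_comm x).symm)

variable {R} {P : Type u} [CommRing P] [CharP P p] [PerfectRing P p] [Algebra P R]

/-- The action of `u ∈ W(P)` on `W(R)[V⁻¹]`, where `R` is an algebra over the perfect ring `P`: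
`u • V ^ (-n) x = V ^ (-n) ((F ^ (-n) u) * x)`. -/
def smulHom (u : WittVector p P) : WittVInv p R →+ WittVInv p R :=
  mapAux p (fun n => AddMonoidHom.mulLeft
      (WittVector.map (algebraMap P R) ((WittVector.frobeniusEquiv p P).symm^[n] u)))
    (fun n x => by
      simp only [AddMonoidHom.coe_mulLeft]
      conv_rhs => rw [← (WittVector.frobeniusEquiv p P).apply_symm_apply
        ((WittVector.frobeniusEquiv p P).symm^[n] u), WittVector.frobeniusEquiv_apply,
        map_frobenius, mul_comm, WittVector.verschiebung_mul_frobenius, mul_comm]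
      rw [Function.iterate_succ_apply'])

instance : SMul (WittVector p P) (WittVInv p R) := ⟨fun u => smulHom p u⟩

theorem smul_of (u : WittVector p P) (n : ℕ) (x : WittVector p R) :
    u • of p n x = of p n
      (WittVector.map (algebraMap P R) ((WittVector.frobeniusEquiv p P).symm^[n] u) * x) :=
  mapAux_of p _ _ n x

instance : Module (WittVector p P) (WittVInv p R) where
  one_smul z := by
    obtain ⟨n, x, rfl⟩ := exists_of z
    rw [smul_of, iterate_map_one, map_one, one_mul]
  mul_smul u v z := by
    obtain ⟨n, x, rfl⟩ := exists_of z
    rw [smul_of, smul_of, smul_of, iterate_map_mul, map_mul (WittVector.map (algebraMap P R)), mul_assoc]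
  smul_zero u := map_zero (smulHom p u)
  smul_add u := map_add (smulHom p u)
  add_smul u v z := by
    obtain ⟨n, x, rfl⟩ := exists_of z
    rw [smul_of, smul_of, smul_of, iterate_map_add, map_add (WittVector.map (algebraMap P R)), add_mul,
      map_add]
  zero_smul z := by
    obtain ⟨n, x, rfl⟩ := exists_of z
    rw [smul_of, iterate_map_zero, map_zero, zero_mul, map_zero]

end WittVInv

end WittVInv

/-! ### The module `M(C)` -/

section ModuleM

variable (p : ℕ) [Fact p.Prime] (C : Type u) [CommRing C] [CharP C p]

/-- The ideal `Ker ν_n` of `C^♭`. -/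
abbrev kerNu (n : ℕ) : Ideal (Perfection C p) := RingHom.ker (Perfection.coeff C p n)

/-- The ring `C^♭ / Ker ν_n`. -/
abbrev FlatQuot (n : ℕ) : Type u := Perfection C p ⧸ kerNu p C n

instance (n : ℕ) : CharP (FlatQuot p C n) p :=
  RingHom.charP _ (RingHom.kerLift_injective (Perfection.coeff C p n)) p

theorem kerNu_le (n : ℕ) : kerNu p C (n + 1) ≤ kerNu p C n := by
  intro x hx
  rw [RingHom.mem_ker] at hx ⊢
  rw [← Perfection.coeff_pow_p' x n, hx, zero_pow (Fact.out : p.Prime).ne_zero]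

/-- The map `W(C^♭ / Ker ν_(n + 1))[V⁻¹] → W(C^♭ / Ker ν_n)[V⁻¹]`. -/
def transition (n : ℕ) : WittVInv p (FlatQuot p C (n + 1)) →+ WittVInv p (FlatQuot p C n) :=
  WittVInv.map p (Ideal.Quotient.factor (kerNu_le p C n))

/-- The `W(C^♭)`-module `M(C)`: the preimage of
`W(C) ⊆ W(C)[V⁻¹]` in the projective limit of the modules `W(C^♭ / Ker ν_n)[V⁻¹]`.
(If `C` is semiperfect then `C^♭ / Ker ν_0 = C`.) -/
def M : Submodule (WFlat p C) (∀ n : ℕ, WittVInv p (FlatQuot p C n)) where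
  carrier := {x | (∀ n, transition p C n (x (n + 1)) = x n) ∧
    ∃ y : WittVector p (FlatQuot p C 0), x 0 = WittVInv.of p 0 y}
  add_mem' := by
    rintro x y ⟨hx, a, ha⟩ ⟨hy, b, hb⟩
    exact ⟨fun n => by simp [hx, hy], a + b, by simp [ha, hb]⟩
  zero_mem' := ⟨fun n => by simp, 0, by simp⟩
  smul_mem' := by
    rintro u x ⟨hx, a, ha⟩
    refine ⟨fun n => ?_, _, by rw [Pi.smul_apply, ha, WittVInv.smul_of]⟩
    rw [Pi.smul_apply, Pi.smul_apply, ← hx n]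
    obtain ⟨m, z, hz⟩ := WittVInv.exists_of (x (n + 1))
    rw [hz]
    rw [WittVInv.smul_of, transition, WittVInv.map, WittVInv.mapAux_of, WittVInv.mapAux_of,
      WittVInv.smul_of]
    congr 1
    change WittVector.map _ (_ * _) = _ * WittVector.map _ _
    rw [map_mul]
    congr 1

variable {p C} in
/-- The operator `F : M(C) → M(C)`. -/
def M.F (x : M p C) : M p C :=
  ⟨fun n => WittVInv.F p _ (x.1 n), by
    obtain ⟨x, hx, a, ha⟩ := x
    refine ⟨fun n => ?_, WittVector.frobenius a, by simp only [ha]; exact WittVInv.mapAux_of p _ _ _ _⟩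
    simp only
    rw [← hx n]
    obtain ⟨m, z, hz⟩ := WittVInv.exists_of (x (n + 1))
    rw [hz]
    rw [transition, WittVInv.map, WittVInv.F, WittVInv.F, WittVInv.mapAux_of, WittVInv.mapAux_of,
      WittVInv.mapAux_of, WittVInv.mapAux_of]
    congr 1
    exact map_frobenius _ _⟩

variable {p C} in
/-- The operator `V : M(C) → M(C)`. -/
def M.V (x : M p C) : M p C :=
  ⟨fun n => WittVInv.V p _ (x.1 n), by
    obtain ⟨x, hx, a, ha⟩ := x
    refine ⟨fun n => ?_, WittVector.verschiebung a, by simp only [ha]; exact WittVInv.mapAux_of p _ _ _ _⟩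
    simp only
    rw [← hx n]
    obtain ⟨m, z, hz⟩ := WittVInv.exists_of (x (n + 1))
    rw [hz]
    rw [transition, WittVInv.map, WittVInv.V, WittVInv.V, WittVInv.mapAux_of, WittVInv.mapAux_of,
      WittVInv.mapAux_of, WittVInv.mapAux_of]
    congr 1
    exact WittVector.map_verschiebung _ _⟩

/-- The canonical map `W(C^♭) → M(C)`. -/
def toM (w : WFlat p C) : M p C :=
  ⟨fun n => WittVInv.of p 0 (WittVector.map (Ideal.Quotient.mk (kerNu p C n)) w), fun n => by
    rw [transition, WittVInv.map, WittVInv.mapAux_of]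
    congr 1, _, rfl⟩

variable {p C}

/-- `f : M(C) → A_cris(C)` is the canonical `W(C^♭)[F]`-linear map: it commutes with `F`, and on the
submodule `M_0(C)` of all `x` such that `V ^ n x = w ∈ W(C^♭)` for some `n`, one has
`f(x) = (F') ^ n (V ^ n x)`. -/
structure IsCanonicalMap (F' : Icris p C → Acris p C) (f : M p C →ₗ[WFlat p C] Acris p C) :
    Prop where
  map_F : ∀ x : M p C, f (M.F x) = acrisFrobenius p C (f x)
  map_M₀ : ∀ (x : M p C) (n : ℕ) (w : WFlat p C), M.V^[n] x = toM p C w →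
    IteratesTo F' n (algebraMap (WFlat p C) (Acris p C) w) (f x)

end ModuleM

/-! ### The ring `B[x_1 ^ (p ^ (-∞)), …, x_n ^ (p ^ (-∞))] / (x_1, …, x_n)` -/

section KeyExample

variable (p : ℕ) [Fact p.Prime]

/-- The additive monoid `ℤ_+[1/p]` of all nonnegative elements of `ℤ[1/p]`. -/
def Exponent : AddSubmonoid ℚ where
  carrier := {α | ∃ m k : ℕ, α = m / (p : ℚ) ^ k}
  add_mem' := by
    rintro _ _ ⟨m, k, rfl⟩ ⟨m', k', rfl⟩
    have hp : (p : ℚ) ≠ 0 := by exact_mod_cast (Fact.out : p.Prime).ne_zero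
    refine ⟨m * p ^ k' + p ^ k * m', k + k', ?_⟩
    rw [div_add_div _ _ (pow_ne_zero _ hp) (pow_ne_zero _ hp), pow_add]
    push_cast
    rfl
  zero_mem' := ⟨0, 0, by simp⟩

theorem Exponent.nonneg (α : Exponent p) : (0 : ℚ) ≤ α := by
  obtain ⟨_, m, k, rfl⟩ := α
  positivity

variable (B : Type u) [CommRing B] (n : ℕ)

/-- The ring `B[x_1 ^ (p ^ (-∞)), …, x_n ^ (p ^ (-∞))]` of finite sums `∑ b_α x ^ α`, where
`b_α ∈ B` and `α ∈ (ℤ_+[1/p]) ^ n`. -/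
abbrev PerfectPolynomial : Type u := AddMonoidAlgebra B (Fin n → Exponent p)

/-- The element `x_i`. -/
def PerfectPolynomial.x (i : Fin n) : PerfectPolynomial p B n :=
  AddMonoidAlgebra.single (Pi.single i ⟨1, 1, 0, by simp⟩) 1

/-- The ring `C = B[x_1 ^ (p ^ (-∞)), …, x_n ^ (p ^ (-∞))] / (x_1, …, x_n)`. -/
abbrev KeyRing : Type u :=
  PerfectPolynomial p B n ⧸ Ideal.span (Set.range (PerfectPolynomial.x p B n))

open Classical in
/-- The retraction `C → B` which kills `x ^ α` for all `α ≠ 0`. -/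
def KeyRing.retraction : KeyRing p B n →+* B :=
  Ideal.Quotient.lift _
    (AddMonoidAlgebra.lift B B (Fin n → Exponent p)
      { toFun := fun α => if α.toAdd = 0 then 1 else 0
        map_one' := by simp
        map_mul' := fun α β => by
          have : α.toAdd + β.toAdd = 0 ↔ α.toAdd = 0 ∧ β.toAdd = 0 := by
            refine ⟨fun h => ?_, fun h => by simp [h]⟩
            have h' : ∀ i, (α.toAdd i : ℚ) + β.toAdd i = 0 := fun i => by
              simpa using congrArg (fun γ => ((γ i : Exponent p) : ℚ)) h
            constructor <;> ext i
            · have := Exponent.nonneg p (α.toAdd i)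
              have := Exponent.nonneg p (β.toAdd i)
              have := h' i
              change (α.toAdd i : ℚ) = 0
              linarith
            · have := Exponent.nonneg p (α.toAdd i)
              have := Exponent.nonneg p (β.toAdd i)
              have := h' i
              change (β.toAdd i : ℚ) = 0
              linarith
          rw [toAdd_mul]
          by_cases h1 : α.toAdd = 0 <;> by_cases h2 : β.toAdd = 0 <;> simp [this, h1, h2] }).toRingHom
    (by
      intro a ha
      rw [← RingHom.mem_ker]
      refine (Ideal.span_le (I := RingHom.ker _)).2 ?_ ha
      rintro _ ⟨i, rfl⟩
      rw [SetLike.mem_coe, RingHom.mem_ker]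
      have : (Pi.single i ⟨1, 1, 0, by simp⟩ : Fin n → Exponent p) ≠ 0 := by
        intro h
        have := congrArg (fun γ => ((γ i : Exponent p) : ℚ)) h
        simp at this
      simp [PerfectPolynomial.x, this])

instance [CharP B p] : CharP (KeyRing p B n) p :=
  charP_of_injective_ringHom (f := algebraMap B (KeyRing p B n))
    (Function.LeftInverse.injective (g := KeyRing.retraction p B n) (fun b => by
      change KeyRing.retraction p B n (Ideal.Quotient.mk _ (algebraMap B _ b)) = b
      rw [KeyRing.retraction, Ideal.Quotient.lift_mk]
      simp)) p

end KeyExample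

end Fontaine

/-!
Suppose that `ν_0` is surjective and that `A = A_cris(C)` has three properties: it is torsion-free,
its Frobenius `F` is injective, and `F a ∈ p A` implies `a ∈ I_cris(C)`.

Torsion-freeness forces `γ_m(b) = b ^ m / m!` and `F' = F / p`; the divisions are possible on
`I_cris(C)` because they are possible on the generators. Write an element `x` of `M(C)` as the
system of its components `V^{-N_m} w_m`, with `w_m ∈ W(C^♭)` determined modulo `W(Ker ν_m)`. Then
`F^{N_m}(w_m) / p^{N_m}` makes sense modulo `p ^ m A`, and `f x` is the `p`-adic limit.

If `f x = 0`, then `x` is divisible by all powers of `V`, so its component of degree `0` vanishes;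
the same argument for `F^{-j} x`, which makes sense after multiplication by a power of `V`, gives
the component of degree `j`. If `p^m u = F^m(v_m)` with `v_m → 0`, then `F(v_{m+1}) = p v_m`.
Subtracting a Teichmüller representative from `v_0` and applying `F'`, again and again, approximates
`v_0` by an element of `W(C^♭)` up to elements on which `F'` can be iterated indefinitely; doing
this for the sequences `v_{N+m} / p^r`, where `N` depends on `r`, yields the components of an
element of `M(C)` with image `u`.

For the ring `C` at hand, `A / p^k A` is generated over `W(B)` by the divided power monomials
`x^α / ∏ᵢ ⌊αᵢ⌋!`, and it is free over `W(B) / p^k`: independence is seen by mapping to divided power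
polynomials over `W(B)`. On the monomials `F` replaces `α` by `p α` and multiplies by
`∏ᵢ ⌊p αᵢ⌋! / ⌊αᵢ⌋!`, which is nonzero, and prime to `p` if all `αᵢ < 1`; this gives the last two
properties.
-/

namespace Fontaine

universe u

/-! ### Divided powers on ideals of torsion-free rings -/

section TorsionFree

variable {R : Type*} [CommRing R] [IsAddTorsionFree R]

theorem natCast_mul_left_cancel {m : ℕ} (hm : m ≠ 0) {a b : R} (h : (m : R) * a = m * b) :
    a = b :=
  nsmul_right_injective hm (by simpa only [nsmul_eq_mul] using h)

theorem pow_mul_left_cancel {p : ℕ} [Fact p.Prime] (k : ℕ) {a b : R}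
    (h : (p : R) ^ k * a = (p : R) ^ k * b) : a = b :=
  natCast_mul_left_cancel (pow_ne_zero k (Fact.out : p.Prime).ne_zero) (by exact_mod_cast h)

theorem mul_left_cancel_prime {p : ℕ} [Fact p.Prime] {a b : R} (h : (p : R) * a = p * b) : a = b :=
  natCast_mul_left_cancel (Fact.out : p.Prime).ne_zero h

theorem pow_dvd_of_pow_add_dvd {p : ℕ} [Fact p.Prime] {k l : ℕ} {a : R}
    (h : (p : R) ^ (k + l) ∣ (p : R) ^ k * a) : (p : R) ^ l ∣ a := by
  obtain ⟨c, hc⟩ := h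
  exact ⟨c, pow_mul_left_cancel k (by rw [hc, pow_add, mul_assoc])⟩

theorem exists_dividedPowers_of_isAddTorsionFree {I : Ideal R}
    (h : ∀ x ∈ I, ∀ n ≠ 0, ∃ y ∈ I, (n.factorial : R) * y = x ^ n) :
    Nonempty (DividedPowers I) := by
  classical
  have : Module.Flat ℤ R := inferInstance
  let ι : R →+* TensorProduct ℤ ℚ R := Algebra.TensorProduct.includeRight.toRingHom
  have hι : Function.Injective ι :=
    Algebra.TensorProduct.includeRight_injective (RingHom.injective_int (algebraMap ℤ ℚ))
  let γ := DividedPowers.RatAlgebra.dividedPowers (I.map ι)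
  refine ⟨DividedPowers.ofInjective I (I.map ι) ι hι γ rfl fun n x hx => ?_⟩
  rcases eq_or_ne n 0 with rfl | hn
  · exact ⟨1, fun h0 => absurd rfl h0, by rw [map_one, γ.dpow_zero (Ideal.mem_map_of_mem ι hx)]⟩
  obtain ⟨y, hy, hxy⟩ := h x hx n hn
  refine ⟨y, fun _ => hy, ?_⟩
  have : IsAddTorsionFree (TensorProduct ℤ ℚ R) := .of_module_rat _
  refine natCast_mul_left_cancel n.factorial_ne_zero ?_
  rw [γ.factorial_mul_dpow_eq_pow (Ideal.mem_map_of_mem ι hx), ← map_pow, ← hxy, map_mul,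
    map_natCast]

end TorsionFree

/-- The ideal of all `y` such that `y ^ m` is divisible by `m!` for all `m`, with a quotient in
`K` if `m ≠ 0`. If `R` is torsion-free, this is the largest ideal whose elements have divided
powers, those of positive degree lying in `K`. -/
def factorialIdeal {R : Type*} [CommRing R] (K : Ideal R) : Ideal R where
  carrier := {y | ∀ m : ℕ, ∃ c : R, (m ≠ 0 → c ∈ K) ∧ (m.factorial : R) * c = y ^ m}
  add_mem' {x y} hx hy m := by
    choose a ha ha' using hx
    choose b hb hb' using hy
    refine ⟨∑ k ∈ Finset.range (m + 1), a k * b (m - k), fun hm => Ideal.sum_mem _ fun k hk => ?_,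
      ?_⟩
    · rcases eq_or_ne k 0 with rfl | hk0
      · exact K.mul_mem_left _ (hb _ (by omega))
      · exact K.mul_mem_right _ (ha _ hk0)
    · rw [add_pow, Finset.mul_sum]
      refine Finset.sum_congr rfl fun k hk => ?_
      have hkm : k ≤ m := Nat.lt_succ_iff.1 (Finset.mem_range.1 hk)
      rw [← ha', ← hb', ← Nat.choose_mul_factorial_mul_factorial hkm]
      push_cast
      ring
  zero_mem' m := by
    rcases m with _ | m
    · exact ⟨1, by simp⟩
    · exact ⟨0, by simp⟩
  smul_mem' r x hx m := by
    obtain ⟨c, hc, hc'⟩ := hx m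
    exact ⟨r ^ m * c, fun hm => K.mul_mem_left _ (hc hm), by
      rw [smul_eq_mul, mul_pow, ← hc']; ring⟩

theorem mem_factorialIdeal {R : Type*} [CommRing R] {K : Ideal R} {y : R} :
    y ∈ factorialIdeal K ↔
      ∀ m : ℕ, ∃ c : R, (m ≠ 0 → c ∈ K) ∧ (m.factorial : R) * c = y ^ m :=
  Iff.rfl

theorem mem_factorialIdeal_of_factorial_mul_eq_pow {R : Type*} [CommRing R] [IsAddTorsionFree R]
    {K : Ideal R} {x c : R} {n : ℕ} (hn : n ≠ 0) (hx : x ∈ factorialIdeal K)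
    (hc : (n.factorial : R) * c = x ^ n) : c ∈ factorialIdeal K := by
  intro m
  obtain ⟨e, he, he'⟩ := hx (m * n)
  refine ⟨m.uniformBell n * e, fun hm => K.mul_mem_left _ (he (mul_ne_zero hm hn)),
    natCast_mul_left_cancel (pow_ne_zero m n.factorial_ne_zero) ?_⟩
  push_cast
  rw [← mul_pow, hc, ← pow_mul, mul_comm n m, ← he', ← Nat.uniformBell_mul_eq m hn]
  push_cast
  ring

/-! ### `p`-adically complete rings -/

theorem factorial_eq_mul_pow_padicValNat (p n : ℕ) :
    n.factorial = (n.factorial / p ^ padicValNat p n.factorial) * p ^ padicValNat p n.factorial :=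
  (Nat.div_mul_cancel pow_padicValNat_dvd).symm

theorem not_dvd_factorial_div_pow_padicValNat (p : ℕ) [Fact p.Prime] (n : ℕ) :
    ¬ p ∣ n.factorial / p ^ padicValNat p n.factorial := fun h => by
  have hdvd := Nat.mul_dvd_of_dvd_div pow_padicValNat_dvd h
  rw [← pow_succ] at hdvd
  exact pow_succ_padicValNat_not_dvd n.factorial_ne_zero hdvd

section AdicallyComplete

variable {R : Type*} [CommRing R]

theorem eq_zero_of_forall_pow_dvd {a : R} [IsHausdorff (Ideal.span {a}) R] {x : R}
    (h : ∀ k : ℕ, a ^ k ∣ x) : x = 0 := by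
  refine IsHausdorff.haus ‹_› x fun k => ?_
  rw [SModEq.zero, smul_eq_mul, Ideal.mul_top, Ideal.span_singleton_pow, Ideal.mem_span_singleton]
  exact h k

theorem exists_forall_pow_dvd_sub {a : R} [IsPrecomplete (Ideal.span {a}) R] (f : ℕ → R)
    (h : ∀ k : ℕ, a ^ k ∣ f (k + 1) - f k) : ∃ L : R, ∀ k : ℕ, a ^ k ∣ L - f k := by
  have dvd_sub_add (m d : ℕ) : a ^ m ∣ f m - f (m + d) := by
    induction d with
    | zero => simp
    | succ d ih =>
      have hstep := (pow_dvd_pow a (Nat.le_add_right m d)).trans (h (m + d))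
      have hsum := dvd_sub ih hstep
      rwa [sub_sub, add_sub_cancel] at hsum
  have mem_iff (k : ℕ) (x : R) : x ∈ (Ideal.span {a} ^ k • ⊤ : Ideal R) ↔ a ^ k ∣ x := by
    rw [smul_eq_mul, Ideal.mul_top, Ideal.span_singleton_pow, Ideal.mem_span_singleton]
  obtain ⟨L, hL⟩ := IsPrecomplete.prec ‹_› (f := f) fun {m n} hmn => by
    obtain ⟨d, rfl⟩ := Nat.exists_eq_add_of_le hmn
    exact SModEq.sub_mem.2 ((mem_iff _ _).2 (dvd_sub_add m d))
  exact ⟨L, fun k => dvd_sub_comm.1 ((mem_iff _ _).1 (SModEq.sub_mem.1 (hL k)))⟩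

variable {p : ℕ} [Fact p.Prime] [IsAdicComplete (Ideal.span {(p : R)}) R]

theorem isUnit_natCast_of_not_dvd {m : ℕ} (hm : ¬ p ∣ m) : IsUnit (m : R) := by
  obtain ⟨a, b, hab⟩ : IsCoprime (m : ℤ) p :=
    Nat.isCoprime_iff_coprime.2 (((Fact.out : p.Prime).coprime_iff_not_dvd).2 hm).symm
  have hunit : IsUnit ((p : R) * (-b : R) + 1) :=
    Ideal.mem_jacobson_bot.1 (IsAdicComplete.le_jacobson_bot (Ideal.span {(p : R)})
      (Ideal.mem_span_singleton_self (p : R))) (-b)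
  have habR : (a : R) * m = p * (-b : R) + 1 := by
    have := congrArg (Int.cast : ℤ → R) hab
    push_cast at this
    linear_combination this
  exact isUnit_of_mul_isUnit_right (habR ▸ hunit)

theorem isAddTorsionFree_of_isAdicComplete (p : ℕ) [Fact p.Prime]
    [IsAdicComplete (Ideal.span {(p : R)}) R] (h : ∀ a : R, (p : R) * a = 0 → a = 0) :
    IsAddTorsionFree R where
  nsmul_right_injective m hm a b hab := by
    have hpow (k : ℕ) : IsLeftRegular ((p : R) ^ k) :=
      (isLeftRegular_iff_right_eq_zero_of_mul.2 h).pow k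
    obtain ⟨k, u, hu, rfl⟩ := Nat.exists_eq_pow_mul_and_not_dvd hm p (Fact.out : p.Prime).ne_one
    simp only [nsmul_eq_mul, Nat.cast_mul, Nat.cast_pow, mul_assoc] at hab
    exact (isUnit_natCast_of_not_dvd hu).mul_left_cancel (hpow k hab)

variable (p) in
theorem exists_factorial_mul_mul_eq_pow {n : ℕ} (hn : n ≠ 0) :
    ∃ c : R, (n.factorial : R) * (p * c) = (p : R) ^ n := by
  obtain ⟨c, hc⟩ := (isUnit_natCast_of_not_dvd (R := R)
    (not_dvd_factorial_div_pow_padicValNat p n)).exists_right_inv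
  have hv := padicValNat_factorial_lt_of_ne_zero p hn
  refine ⟨c * p ^ (n - 1 - padicValNat p n.factorial), ?_⟩
  have hfact := congrArg (Nat.cast (R := R)) (factorial_eq_mul_pow_padicValNat p n)
  generalize padicValNat p n.factorial = v at *
  obtain ⟨d, rfl⟩ := Nat.exists_eq_add_of_lt hv
  rw [show v + d + 1 - 1 - v = d by omega, hfact]
  push_cast
  linear_combination (p : R) ^ v * p * p ^ d * hc

variable (p) in
theorem natCast_mem_factorialIdeal {K : Ideal R} (hp : (p : R) ∈ K) :
    (p : R) ∈ factorialIdeal K := by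
  intro m
  rcases eq_or_ne m 0 with rfl | hm
  · exact ⟨1, by simp⟩
  · obtain ⟨c, hc⟩ := exists_factorial_mul_mul_eq_pow (R := R) p hm
    exact ⟨_, fun _ => K.mul_mem_right _ hp, hc⟩

end AdicallyComplete

/-! ### `p`-adic completions -/

section PadicCompletion

variable (p : ℕ) (S : Type u) [CommRing S]

local notation "Ŝ" => AdicCompletion (Ideal.span {(p : S)}) S

instance isAdicComplete_adicCompletion_span_natCast :
    IsAdicComplete (Ideal.span {(p : Ŝ)}) Ŝ := by
  have h := (IsAdicComplete.map_algebraMap_iff (S := Ŝ) (Ideal.span {(p : S)}) Ŝ).2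
    (AdicCompletion.isAdicComplete (Submodule.fg_span_singleton _))
  rwa [Ideal.map_span, Set.image_singleton, map_natCast] at h

variable {S}

theorem evalₐ_eq_zero_iff_pow_dvd (k : ℕ) (x : Ŝ) :
    AdicCompletion.evalₐ (Ideal.span {(p : S)}) k x = 0 ↔ (p : Ŝ) ^ k ∣ x := by
  have mem_iff : x ∈ (Ideal.span {(p : S)} ^ k • ⊤ : Submodule S Ŝ) ↔ (p : Ŝ) ^ k ∣ x := by
    rw [Ideal.span_singleton_pow, Submodule.ideal_span_singleton_smul]
    simp only [Submodule.mem_smul_pointwise_iff_exists, Submodule.mem_top, true_and,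
      Algebra.smul_def, map_pow, map_natCast]
    exact exists_congr fun b => eq_comm
  rw [← mem_iff, AdicCompletion.pow_smul_top_eq_ker_eval (Submodule.fg_span_singleton (p : S)),
    LinearMap.mem_ker]
  have hle : Ideal.span {(p : S)} ^ k ≤ Ideal.span {(p : S)} ^ k • (⊤ : Ideal S) := by simp
  refine ⟨fun h => ?_, fun h => ?_⟩
  · rw [← AdicCompletion.factor_evalₐ_eq_eval _ x hle, h, map_zero]
  · rw [← AdicCompletion.factor_eval_eq_evalₐ _ _ (by simp), h, map_zero]

theorem pow_dvd_algebraMap_adicCompletion_iff (k : ℕ) (s : S) :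
    (p : Ŝ) ^ k ∣ algebraMap S Ŝ s ↔ (p : S) ^ k ∣ s := by
  rw [← evalₐ_eq_zero_iff_pow_dvd, AlgHom.commutes, Ideal.Quotient.algebraMap_eq,
    Ideal.Quotient.eq_zero_iff_mem, Ideal.span_singleton_pow, Ideal.mem_span_singleton]

theorem exists_eq_algebraMap_add_pow_mul (k : ℕ) (x : Ŝ) :
    ∃ (s : S) (y : Ŝ), x = algebraMap S Ŝ s + (p : Ŝ) ^ k * y := by
  obtain ⟨s, hs⟩ := Ideal.Quotient.mk_surjective
    (AdicCompletion.evalₐ (Ideal.span {(p : S)}) k x)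
  obtain ⟨y, hy⟩ : (p : Ŝ) ^ k ∣ x - algebraMap S Ŝ s := by
    rw [← evalₐ_eq_zero_iff_pow_dvd, map_sub, AlgHom.commutes, Ideal.Quotient.algebraMap_eq, hs,
      sub_self]
  exact ⟨s, y, by rw [← hy]; ring⟩

theorem isAddTorsionFree_adicCompletion [Fact p.Prime] (h : ∀ a : S, (p : S) * a = 0 → a = 0) :
    IsAddTorsionFree Ŝ := by
  refine isAddTorsionFree_of_isAdicComplete p fun x hx =>
    eq_zero_of_forall_pow_dvd (a := (p : Ŝ)) fun k => ?_
  obtain ⟨s, y, rfl⟩ := exists_eq_algebraMap_add_pow_mul p k x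
  refine dvd_add ((pow_dvd_algebraMap_adicCompletion_iff p k s).2 ?_) (dvd_mul_right _ _)
  obtain ⟨c, hc⟩ : (p : S) ^ (k + 1) ∣ p * s := by
    rw [← pow_dvd_algebraMap_adicCompletion_iff, map_mul, map_natCast]
    exact ⟨-y, by linear_combination hx⟩
  exact ⟨c, sub_eq_zero.1 (h _ (by rw [mul_sub, hc]; ring))⟩

theorem padicMap_algebraMap {T : Type u} [CommRing T] (φ : S →+* T) (s : S) :
    padicMap p φ (algebraMap S Ŝ s) = algebraMap T _ (φ s) := by
  refine AdicCompletion.ext_evalₐ (H := fun k => ?_)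
  rw [padicMap, AdicCompletion.evalₐ_liftRingHom, AlgHom.commutes, RingHom.comp_apply]
  simp

end PadicCompletion

/-! ### Divided powers and Frobenius on `A_cris(C)` -/

section Hull

variable {p : ℕ} {R : Type u} [CommRing R] {I : Ideal R}

theorem PDHull.factorial_mul_dp (n : ℕ) (x : I) :
    (n.factorial : PDHull p I) * PDHull.dp p I n x = algebraMap R _ (x : R) ^ n := by
  have dp_one : PDHull.dp p I 1 x = algebraMap R _ (x : R) := by
    rw [PDHull.dp, PDHull.mk_eq_of_rel (PDHullRel.one x)]
    exact AlgHom.commutes _ _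
  rw [← dp_one, PDHull.dp, PDHull.dp, ← map_pow, ← map_natCast (PDHull.mk p I), ← map_mul]
  congr 1
  rw [DividedPowerAlgebra.natFactorial_mul_dp_eq]

theorem PDHull.dp_one (x : I) : PDHull.dp p I 1 x = algebraMap R _ (x : R) := by
  simpa using PDHull.factorial_mul_dp (p := p) 1 x

theorem PDHull.dp_zero (x : I) : PDHull.dp p I 0 x = 1 := by
  simpa using PDHull.factorial_mul_dp (p := p) 0 x

theorem PDHull.dp_smul (r : R) (n : ℕ) (x : I) :
    PDHull.dp p I n (r • x) = algebraMap R _ r ^ n * PDHull.dp p I n x := by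
  rw [PDHull.dp, DividedPowerAlgebra.dp_smul, map_smul, Algebra.smul_def, map_pow]
  rfl

theorem PDHull.dp_mul (m n : ℕ) (x : I) :
    PDHull.dp p I m x * PDHull.dp p I n x =
      ((m + n).choose m : PDHull p I) * PDHull.dp p I (m + n) x := by
  simp only [PDHull.dp]
  rw [← map_mul, DividedPowerAlgebra.dp_mul, map_nsmul, nsmul_eq_mul]

theorem PDHull.dp_add (n : ℕ) (x y : I) :
    PDHull.dp p I n (x + y) = ∑ k ∈ Finset.HasAntidiagonal.antidiagonal n,
      PDHull.dp p I k.1 x * PDHull.dp p I k.2 y := by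
  simp only [PDHull.dp, DividedPowerAlgebra.dp_add, map_sum, map_mul]

theorem PDHull.induction_on {P : PDHull p I → Prop} (h : PDHull p I)
    (halg : ∀ r, P (algebraMap R _ r)) (hdp : ∀ n x, P (PDHull.dp p I n x))
    (hadd : ∀ a b, P a → P b → P (a + b)) (hmul : ∀ a b, P a → P b → P (a * b)) : P h := by
  obtain ⟨h, rfl⟩ := Ideal.Quotient.mkₐ_surjective R (Ideal.ofRel (PDHullRel p I)) h
  change P (PDHull.mk p I h)
  induction h using DividedPowerAlgebra.induction_on' with
  | h_C a => exact halg a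
  | h_add f g hf hg => rw [map_add]; exact hadd _ _ hf hg
  | h_dp f n m hf => rw [map_mul]; exact hmul _ _ hf (hdp n m)

end Hull

section Acris

variable {p : ℕ} [Fact p.Prime] {C : Type u} [CommRing C] [CharP C p]

theorem algebraMap_acris_eq_toAcris (w : WFlat p C) :
    algebraMap (WFlat p C) (Acris p C) w = toAcris p C (algebraMap (WFlat p C) _ w) := rfl

theorem acrisToC_toAcris (h : AcrisHull p C) : acrisToC p C (toAcris p C h) = hullToC p C h := rfl

theorem hullToC_algebraMap (w : WFlat p C) :
    hullToC p C (algebraMap (WFlat p C) _ w) = theta p C w := by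
  unfold hullToC PDHull.augmentation
  rw [PDHull.lift_algebraMap]

theorem acrisToC_algebraMap (w : WFlat p C) :
    acrisToC p C (algebraMap (WFlat p C) _ w) = theta p C w := by
  rw [algebraMap_acris_eq_toAcris, acrisToC_toAcris, hullToC_algebraMap]

theorem hullToC_dp {n : ℕ} (hn : n ≠ 0) (b : kerTheta p C) :
    hullToC p C (PDHull.dp p _ n b) = 0 := by
  unfold hullToC PDHull.augmentation
  rw [PDHull.lift_dp, if_neg hn]

theorem factorial_mul_toAcris_dp (n : ℕ) (b : kerTheta p C) :
    (n.factorial : Acris p C) * toAcris p C (PDHull.dp p _ n b) =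
      algebraMap (WFlat p C) (Acris p C) b ^ n := by
  rw [algebraMap_acris_eq_toAcris, ← map_pow, ← PDHull.factorial_mul_dp, map_mul, map_natCast]

theorem natCast_mem_Icris : (p : Acris p C) ∈ Icris p C := by
  rw [RingHom.mem_ker, map_natCast, CharP.cast_eq_zero]

theorem algebraMap_mem_Icris_iff {b : WFlat p C} :
    algebraMap (WFlat p C) (Acris p C) b ∈ Icris p C ↔ b ∈ kerTheta p C := by
  rw [RingHom.mem_ker, RingHom.mem_ker, acrisToC_algebraMap]

theorem toAcris_dp_mem_Icris {n : ℕ} (hn : n ≠ 0) (b : kerTheta p C) :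
    toAcris p C (PDHull.dp p _ n b) ∈ Icris p C := by
  rw [RingHom.mem_ker, acrisToC_toAcris, hullToC_dp hn]

theorem exists_toAcris_sub_algebraMap_mem {K : Ideal (Acris p C)}
    (hdp : ∀ (n : ℕ) (b : kerTheta p C), n ≠ 0 → toAcris p C (PDHull.dp p _ n b) ∈ K)
    (h : AcrisHull p C) :
    ∃ w : WFlat p C, toAcris p C h - algebraMap (WFlat p C) (Acris p C) w ∈ K := by
  induction h using PDHull.induction_on with
  | halg w => exact ⟨w, by rw [algebraMap_acris_eq_toAcris, sub_self]; exact zero_mem _⟩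
  | hdp n b =>
    rcases eq_or_ne n 0 with rfl | hn
    · exact ⟨1, by rw [PDHull.dp_zero, map_one, map_one, sub_self]; exact zero_mem _⟩
    · exact ⟨0, by rw [map_zero, sub_zero]; exact hdp n b hn⟩
  | hadd a b ha hb =>
    obtain ⟨v, hv⟩ := ha
    obtain ⟨w, hw⟩ := hb
    exact ⟨v + w, by rw [map_add, map_add, add_sub_add_comm]; exact add_mem hv hw⟩
  | hmul a b ha hb =>
    obtain ⟨v, hv⟩ := ha
    obtain ⟨w, hw⟩ := hb
    exact ⟨v * w, by rw [map_mul, map_mul]; exact K.mul_sub_mul_mem hv hw⟩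

theorem Icris_le {K : Ideal (Acris p C)} (hp : (p : Acris p C) ∈ K)
    (hdp : ∀ (n : ℕ) (b : kerTheta p C), n ≠ 0 → toAcris p C (PDHull.dp p _ n b) ∈ K) :
    Icris p C ≤ K := by
  intro u hu
  obtain ⟨h, y, hy⟩ := exists_eq_algebraMap_add_pow_mul p 1 u
  obtain ⟨w, hw⟩ := exists_toAcris_sub_algebraMap_mem (K := K ⊓ Icris p C)
    (fun n b hn => ⟨hdp n b hn, toAcris_dp_mem_Icris hn b⟩) h
  have huw : u - algebraMap (WFlat p C) (Acris p C) w ∈ K ⊓ Icris p C := by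
    rw [hy, pow_one, add_sub_right_comm]
    exact add_mem hw (Ideal.mul_mem_right _ _ ⟨hp, natCast_mem_Icris⟩)
  have hwθ : w ∈ kerTheta p C :=
    algebraMap_mem_Icris_iff.1 (((Icris p C).sub_mem_iff_right hu).1 huw.2)
  have hwK := hdp 1 ⟨w, hwθ⟩ one_ne_zero
  rw [PDHull.dp_one, ← algebraMap_acris_eq_toAcris] at hwK
  exact (K.sub_mem_iff_left hwK).1 huw.1

theorem acrisFrobenius_toAcris (h : AcrisHull p C) :
    acrisFrobenius p C (toAcris p C h) = toAcris p C (hullFrobenius p C h) :=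
  padicMap_algebraMap p _ h

theorem hullFrobenius_algebraMap (w : WFlat p C) :
    hullFrobenius p C (algebraMap (WFlat p C) _ w) =
      algebraMap (WFlat p C) _ (WittVector.frobenius w) := by
  rw [hullFrobenius, PDHull.map, PDHull.lift_algebraMap, RingHom.comp_apply]

theorem acrisFrobenius_algebraMap (w : WFlat p C) :
    acrisFrobenius p C (algebraMap (WFlat p C) _ w) =
      algebraMap (WFlat p C) _ (WittVector.frobenius w) := by
  rw [algebraMap_acris_eq_toAcris, acrisFrobenius_toAcris, hullFrobenius_algebraMap]
  rfl

theorem acrisFrobenius_iterate_algebraMap (n : ℕ) (w : WFlat p C) :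
    (acrisFrobenius p C)^[n] (algebraMap (WFlat p C) _ w) =
      algebraMap (WFlat p C) _ (WittVector.frobenius^[n] w) :=
  (Function.Semiconj.iterate_right (f := algebraMap (WFlat p C) (Acris p C))
    (fun w => (acrisFrobenius_algebraMap w).symm) n w).symm

theorem natCast_dvd_iff_coeff_zero_eq_zero {R : Type*} [CommRing R] [CharP R p] [PerfectRing R p]
    (w : WittVector p R) : (p : WittVector p R) ∣ w ↔ w.coeff 0 = 0 := by
  rw [← Ideal.mem_span_singleton, WittVector.mem_span_p_iff_coeff_zero_eq_zero]

theorem natCast_dvd_frobenius_sub_pow {R : Type*} [CommRing R] [CharP R p] [PerfectRing R p]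
    (b : WittVector p R) : (p : WittVector p R) ∣ WittVector.frobenius b - b ^ p := by
  rw [natCast_dvd_iff_coeff_zero_eq_zero]
  change WittVector.constantCoeff (WittVector.frobenius b - b ^ p) = 0
  rw [map_sub, map_pow, sub_eq_zero]
  exact WittVector.coeff_frobenius_charP p b 0

theorem natCast_dvd_acrisFrobenius_algebraMap {b : WFlat p C} (hb : b ∈ kerTheta p C) :
    (p : Acris p C) ∣ acrisFrobenius p C (algebraMap (WFlat p C) _ b) := by
  obtain ⟨d, hd⟩ := natCast_dvd_frobenius_sub_pow b
  rw [acrisFrobenius_algebraMap, sub_eq_iff_eq_add.1 hd, map_add, map_mul, map_natCast, map_pow,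
    ← factorial_mul_toAcris_dp p ⟨b, hb⟩]
  exact dvd_add (dvd_mul_right _ _)
    ((Nat.cast_dvd_cast (Nat.dvd_factorial (Fact.out : p.Prime).pos le_rfl)).mul_right _)

variable [IsAddTorsionFree (Acris p C)]

theorem Icris_le_factorialIdeal : Icris p C ≤ factorialIdeal (Icris p C) :=
  Icris_le (natCast_mem_factorialIdeal p natCast_mem_Icris) fun n b hn =>
    mem_factorialIdeal_of_factorial_mul_eq_pow hn
      (fun m => ⟨_, fun hm => toAcris_dp_mem_Icris hm b, factorial_mul_toAcris_dp m b⟩)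
      (factorial_mul_toAcris_dp n b)

theorem natCast_dvd_acrisFrobenius {c : Acris p C} (hc : c ∈ Icris p C) :
    (p : Acris p C) ∣ acrisFrobenius p C c := by
  suffices h : Icris p C ≤ (Ideal.span {(p : Acris p C)}).comap (acrisFrobenius p C) from
    Ideal.mem_span_singleton.1 (h hc)
  refine Icris_le ?_ fun n b hn => ?_
  · rw [Ideal.mem_comap, map_natCast]
    exact Ideal.mem_span_singleton_self _
  · rw [Ideal.mem_comap, Ideal.mem_span_singleton]
    obtain ⟨y, hy⟩ := natCast_dvd_acrisFrobenius_algebraMap b.2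
    obtain ⟨c, hc⟩ := exists_factorial_mul_mul_eq_pow (R := Acris p C) p hn
    refine ⟨c * y ^ n, natCast_mul_left_cancel n.factorial_ne_zero ?_⟩
    rw [← map_natCast (acrisFrobenius p C), ← map_mul, factorial_mul_toAcris_dp, map_pow, hy,
      mul_pow, ← hc, map_natCast]
    ring

theorem existsUnique_isCanonicalDividedPowers :
    ∃! γ : DividedPowers (Icris p C), IsCanonicalDividedPowers p C γ := by
  obtain ⟨γ⟩ := exists_dividedPowers_of_isAddTorsionFree (I := Icris p C) fun x hx n hn =>
    let ⟨c, hcI, hc⟩ := Icris_le_factorialIdeal hx n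
    ⟨c, hcI hn, hc⟩
  refine ⟨γ, fun n b => natCast_mul_left_cancel n.factorial_ne_zero ?_, fun γ' _ =>
    DividedPowers.ext _ _ fun {n x} hx => natCast_mul_left_cancel n.factorial_ne_zero ?_⟩
  · rw [factorial_mul_toAcris_dp, γ.factorial_mul_dpow_eq_pow (algebraMap_mem_Icris_iff.2 b.2)]
  · rw [γ.factorial_mul_dpow_eq_pow hx, γ'.factorial_mul_dpow_eq_pow hx]

theorem exists_natCast_mul_eq_acrisFrobenius : ∃ F' : Icris p C →ₛₗ[acrisFrobenius p C] Acris p C,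
    ∀ c, (p : Acris p C) * F' c = acrisFrobenius p C c := by
  choose g hg using fun c : Icris p C => natCast_dvd_acrisFrobenius c.2
  refine ⟨{ toFun := g, map_add' := fun a b => mul_left_cancel_prime (p := p) ?_,
            map_smul' := fun r a => mul_left_cancel_prime (p := p) ?_ }, fun c => (hg c).symm⟩
  · rw [← hg, mul_add, ← hg, ← hg, Submodule.coe_add, map_add]
  · rw [← hg, smul_eq_mul, mul_left_comm, ← hg, Submodule.coe_smul, smul_eq_mul, map_mul]

variable {γ : DividedPowers (Icris p C)}

omit [IsAddTorsionFree (Acris p C)] in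
theorem IsFPrime.natCast_mul {F' : Icris p C →ₛₗ[acrisFrobenius p C] Acris p C}
    (h : IsFPrime p C γ F') (c : Icris p C) :
    (p : Acris p C) * F' c = acrisFrobenius p C c := by
  rw [← h.mul_p c ((p : Acris p C) • c) rfl, map_smulₛₗ, map_natCast, smul_eq_mul]

theorem isFPrime_of_natCast_mul {F' : Icris p C →ₛₗ[acrisFrobenius p C] Acris p C}
    (h : ∀ c, (p : Acris p C) * F' c = acrisFrobenius p C c) : IsFPrime p C γ F' where
  mul_p b c hc := mul_left_cancel_prime (p := p) (by rw [h, hc, map_mul, map_natCast])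
  dpow n hn b c hc := by
    have hpow : (n.factorial : Acris p C) * (p * F' c) = (p * F' b) ^ n := by
      rw [h, h, hc, ← map_pow, ← γ.factorial_mul_dpow_eq_pow b.2 (n := n), map_mul, map_natCast]
    have hv := padicValNat_factorial_lt_of_ne_zero p (n := n) (by omega)
    rw [factorial_eq_mul_pow_padicValNat p n] at hpow
    generalize n.factorial / p ^ padicValNat p n.factorial = u at *
    generalize padicValNat p n.factorial = v at *
    obtain ⟨d, rfl⟩ := Nat.exists_eq_add_of_lt hv
    rw [show v + d + 1 - 1 - v = d by omega]
    refine pow_mul_left_cancel (p := p) (v + 1) ?_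
    push_cast at hpow
    linear_combination hpow
  theta b d c _ hd hc := by
    refine mul_left_cancel_prime (p := p) ?_
    rw [h, mul_add, ← mul_assoc, ← Nat.cast_mul,
      Nat.mul_factorial_pred (Fact.out : p.Prime).ne_zero, γ.factorial_mul_dpow_eq_pow c.2, hc,
      acrisFrobenius_algebraMap,
      ← map_natCast (algebraMap (WFlat p C) (Acris p C)), ← map_mul, hd, map_sub, map_pow]
    ring

theorem existsUnique_isFPrime : ∃! F' : Icris p C →ₛₗ[acrisFrobenius p C] Acris p C,
    IsFPrime p C γ F' := by
  obtain ⟨F', hF'⟩ := exists_natCast_mul_eq_acrisFrobenius (p := p) (C := C)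
  exact ⟨F', isFPrime_of_natCast_mul hF', fun G hG => LinearMap.ext fun c =>
    mul_left_cancel_prime (p := p) (by rw [hG.natCast_mul, hF'])⟩

end Acris

/-! ### The ideals `W(Ker ν_m)` of `W(C^♭)` -/

section WittVector

variable {p : ℕ} [Fact p.Prime] {R : Type*} [CommRing R]

theorem eq_teichmuller_add_verschiebung_shift (w : WittVector p R) :
    w = WittVector.teichmuller p (w.coeff 0) + WittVector.verschiebung (w.shift 1) := by
  ext i
  rw [WittVector.coeff_add_of_disjoint]
  · rcases i with _ | i
    · rw [WittVector.teichmuller_coeff_zero, WittVector.verschiebung_coeff_zero, add_zero]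
    · rw [WittVector.teichmuller_coeff_pos p _ _ i.succ_pos, WittVector.verschiebung_coeff_succ,
        WittVector.shift_coeff, zero_add, add_comm]
  · rintro (_ | i)
    · exact Or.inr (WittVector.verschiebung_coeff_zero _)
    · exact Or.inl (WittVector.teichmuller_coeff_pos p _ _ i.succ_pos)

theorem natCast_mul_eq_verschiebung_frobenius [CharP R p] (w : WittVector p R) :
    (p : WittVector p R) * w = WittVector.verschiebung (WittVector.frobenius w) := by
  rw [WittVector.verschiebung_frobenius, mul_comm]

theorem frobenius_verschiebung_eq_natCast_mul (w : WittVector p R) :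
    WittVector.frobenius (WittVector.verschiebung w) = (p : WittVector p R) * w := by
  rw [WittVector.frobenius_verschiebung, mul_comm]

theorem frobenius_teichmuller [CharP R p] (r : R) :
    WittVector.frobenius (WittVector.teichmuller p r) = WittVector.teichmuller p r ^ p := by
  rw [WittVector.frobenius_eq_map_frobenius, WittVector.map_teichmuller, ← map_pow]
  rfl

theorem frobenius_iterate_teichmuller [CharP R p] (n : ℕ) (r : R) :
    WittVector.frobenius^[n] (WittVector.teichmuller p r) =
      WittVector.teichmuller p r ^ p ^ n := by
  induction n with
  | zero => rw [Function.iterate_zero_apply, pow_zero, pow_one]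
  | succ n ih =>
    rw [Function.iterate_succ_apply', ih, map_pow, frobenius_teichmuller, ← pow_mul, ← pow_succ']

theorem frobenius_iterate_natCast_mul (n k : ℕ) (w : WittVector p R) :
    WittVector.frobenius^[n] ((k : WittVector p R) * w) = k * WittVector.frobenius^[n] w := by
  rw [iterate_map_mul, Function.iterate_fixed (map_natCast _ k)]

theorem frobenius_iterate_verschiebung_iterate (n : ℕ) (w : WittVector p R) :
    WittVector.frobenius^[n] (WittVector.verschiebung^[n] w) = (p : WittVector p R) ^ n * w := by
  induction n generalizing w with
  | zero => rw [pow_zero, one_mul]; rfl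
  | succ n ih =>
    rw [Function.iterate_succ_apply', Function.iterate_succ_apply, ih, map_mul, map_pow,
      map_natCast, frobenius_verschiebung_eq_natCast_mul, pow_succ, mul_assoc]

theorem map_verschiebung_iterate {S : Type*} [CommRing S] (φ : R →+* S) (n : ℕ)
    (w : WittVector p R) :
    WittVector.map φ (WittVector.verschiebung^[n] w) =
      WittVector.verschiebung^[n] (WittVector.map φ w) :=
  Function.Semiconj.iterate_right (f := WittVector.map φ) (WittVector.map_verschiebung φ) n w

end WittVector

section WittKer

variable (p : ℕ) [Fact p.Prime] (C : Type u) [CommRing C] [CharP C p]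

/-- The ideal `W(Ker ν_m)` of `W(C^♭)`, i.e., the kernel of `W(C^♭) → W(C^♭ / Ker ν_m)`. -/
def wittKer (m : ℕ) : Ideal (WFlat p C) :=
  RingHom.ker (WittVector.map (p := p) (Ideal.Quotient.mk (kerNu p C m)))

variable {p C}

theorem mem_wittKer {m : ℕ} {w : WFlat p C} :
    w ∈ wittKer p C m ↔ ∀ i, w.coeff i ∈ kerNu p C m := by
  rw [wittKer, RingHom.mem_ker, WittVector.map_eq_zero_iff]
  simp only [Ideal.Quotient.eq_zero_iff_mem]

theorem map_mk_eq_iff_sub_mem_wittKer {m : ℕ} {v w : WFlat p C} :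
    WittVector.map (p := p) (Ideal.Quotient.mk (kerNu p C m)) v =
      WittVector.map (Ideal.Quotient.mk (kerNu p C m)) w ↔ v - w ∈ wittKer p C m := by
  rw [wittKer, RingHom.mem_ker, map_sub, sub_eq_zero]

theorem teichmuller_mem_wittKer {m : ℕ} {z : Perfection C p} (hz : z ∈ kerNu p C m) :
    WittVector.teichmuller p z ∈ wittKer p C m := by
  rw [wittKer, RingHom.mem_ker, WittVector.map_teichmuller, Ideal.Quotient.eq_zero_iff_mem.2 hz,
    WittVector.teichmuller_zero]

theorem verschiebung_mem_wittKer_iff {m : ℕ} {w : WFlat p C} :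
    WittVector.verschiebung w ∈ wittKer p C m ↔ w ∈ wittKer p C m := by
  rw [wittKer, RingHom.mem_ker, RingHom.mem_ker, WittVector.map_verschiebung,
    map_eq_zero_iff _ (WittVector.verschiebung_injective p _)]

theorem exists_eq_teichmuller_add_verschiebung_of_mem_wittKer {m : ℕ} {w : WFlat p C}
    (hw : w ∈ wittKer p C m) : ∃ z ∈ kerNu p C m, ∃ v ∈ wittKer p C m,
      w = WittVector.teichmuller p z + WittVector.verschiebung v :=
  ⟨_, mem_wittKer.1 hw 0, _, mem_wittKer.2 fun i => mem_wittKer.1 hw (1 + i),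
    eq_teichmuller_add_verschiebung_shift w⟩

theorem frobenius_mem_wittKer_succ_iff {m : ℕ} {w : WFlat p C} :
    WittVector.frobenius w ∈ wittKer p C (m + 1) ↔ w ∈ wittKer p C m := by
  simp only [mem_wittKer, RingHom.mem_ker, WittVector.coeff_frobenius_charP,
    Perfection.coeff_pow_p]

theorem frobenius_iterate_mem_wittKer {m : ℕ} {w : WFlat p C} (hw : w ∈ wittKer p C m) (N : ℕ) :
    WittVector.frobenius^[N] w ∈ wittKer p C (m + N) := by
  induction N with
  | zero => exact hw
  | succ N ih =>
    rw [Function.iterate_succ_apply', ← add_assoc, frobenius_mem_wittKer_succ_iff]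
    exact ih

theorem pow_mul_mem_wittKer {m : ℕ} {w : WFlat p C} (hw : w ∈ wittKer p C m) (r : ℕ) :
    (p : WFlat p C) ^ r * w ∈ wittKer p C (m + r) := by
  induction r with
  | zero => rwa [pow_zero, one_mul]
  | succ r ih =>
    rw [pow_succ', mul_assoc, natCast_mul_eq_verschiebung_frobenius, verschiebung_mem_wittKer_iff,
      ← add_assoc, frobenius_mem_wittKer_succ_iff]
    exact ih

theorem theta_apply (w : WFlat p C) : theta p C w = Perfection.coeff C p 0 (w.coeff 0) := rfl

theorem theta_teichmuller (z : Perfection C p) :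
    theta p C (WittVector.teichmuller p z) = Perfection.coeff C p 0 z := by
  rw [theta_apply, WittVector.teichmuller_coeff_zero]

theorem theta_verschiebung (w : WFlat p C) : theta p C (WittVector.verschiebung w) = 0 := by
  rw [theta_apply, WittVector.verschiebung_coeff_zero, map_zero]

theorem wittKer_zero_le_kerTheta : wittKer p C 0 ≤ kerTheta p C := fun _ hw => mem_wittKer.1 hw 0

theorem exists_factorial_mul_eq_teichmuller_pow {z : Perfection C p} (hz : z ∈ kerNu p C 0)
    {k : ℕ} (hk : k ≠ 0) : ∃ a ∈ Icris p C, (k.factorial : Acris p C) * a =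
      algebraMap (WFlat p C) (Acris p C) (WittVector.teichmuller p z ^ k) :=
  ⟨_, toAcris_dp_mem_Icris hk ⟨_, wittKer_zero_le_kerTheta (teichmuller_mem_wittKer hz)⟩,
    by rw [factorial_mul_toAcris_dp, map_pow]⟩

theorem exists_pow_mul_eq_teichmuller_pow {z : Perfection C p} (hz : z ∈ kerNu p C 0) (k : ℕ) :
    ∃ a ∈ Icris p C, (p : Acris p C) ^ k * a =
      algebraMap (WFlat p C) (Acris p C) (WittVector.teichmuller p z ^ p ^ k) := by
  have hpk : 0 < p ^ k := pow_pos (Fact.out : p.Prime).pos k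
  obtain ⟨a, ha, hza⟩ := exists_factorial_mul_eq_teichmuller_pow hz hpk.ne'
  obtain ⟨c, hc⟩ := Nat.dvd_factorial hpk le_rfl
  exact ⟨c * a, Ideal.mul_mem_left _ _ ha, by rw [← hza, hc]; push_cast; ring⟩

theorem exists_mem_kerNu_zero_pow_eq {m : ℕ} {y : Perfection C p} (hy : y ∈ kerNu p C m) :
    ∃ z ∈ kerNu p C 0, z ^ p ^ m = y := by
  refine ⟨(frobeniusEquiv (Perfection C p) p).symm^[m] y, ?_, ?_⟩
  · rw [RingHom.mem_ker, Perfection.coeff_iterate_symm_frobeniusEquiv, zero_add]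
    exact hy
  · rw [← iterate_frobenius]
    exact Function.RightInverse.iterate
      (frobeniusEquiv (Perfection C p) p).apply_symm_apply m y

theorem pow_dvd_algebraMap_of_mem_wittKer {m : ℕ} {w : WFlat p C} (hw : w ∈ wittKer p C m) :
    (p : Acris p C) ^ m ∣ algebraMap (WFlat p C) (Acris p C) w := by
  induction m generalizing w with
  | zero => rw [pow_zero]; exact one_dvd _
  | succ m ih =>
    obtain ⟨y, hy, v, hv, rfl⟩ := exists_eq_teichmuller_add_verschiebung_of_mem_wittKer hw
    rw [map_add]
    refine dvd_add ?_ ?_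
    · obtain ⟨z, hz, rfl⟩ := exists_mem_kerNu_zero_pow_eq hy
      obtain ⟨a, -, ha⟩ := exists_pow_mul_eq_teichmuller_pow hz (m + 1)
      rw [map_pow, ← ha]
      exact dvd_mul_right _ _
    · obtain ⟨u, rfl⟩ := (WittVector.frobenius_bijective p (Perfection C p)).surjective v
      rw [← natCast_mul_eq_verschiebung_frobenius, map_mul, map_natCast, pow_succ']
      exact mul_dvd_mul_left _ (ih (frobenius_mem_wittKer_succ_iff.1 hv))

theorem pow_dvd_algebraMap_frobenius_iterate {m : ℕ} (N : ℕ) {w : WFlat p C}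
    (hw : w ∈ wittKer p C m) : (p : Acris p C) ^ (N + m) ∣
      algebraMap (WFlat p C) (Acris p C) (WittVector.frobenius^[N] w) :=
  add_comm m N ▸ pow_dvd_algebraMap_of_mem_wittKer (frobenius_iterate_mem_wittKer hw N)

theorem exists_pow_mul_eq_of_mem_wittKer (N : ℕ) {w : WFlat p C} (hw : w ∈ wittKer p C 0) :
    ∃ a ∈ Icris p C, (p : Acris p C) ^ N * a =
      algebraMap (WFlat p C) (Acris p C) (WittVector.frobenius^[N] w) := by
  induction N generalizing w with
  | zero =>
    exact ⟨_, algebraMap_mem_Icris_iff.2 (wittKer_zero_le_kerTheta hw),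
      by rw [pow_zero, one_mul]; rfl⟩
  | succ N ih =>
    obtain ⟨z, hz, v, hv, rfl⟩ := exists_eq_teichmuller_add_verschiebung_of_mem_wittKer hw
    obtain ⟨a, ha, hza⟩ := exists_pow_mul_eq_teichmuller_pow hz (N + 1)
    obtain ⟨b, hb, hvb⟩ := ih hv
    refine ⟨a + b, add_mem ha hb, ?_⟩
    rw [iterate_map_add, map_add, frobenius_iterate_teichmuller, ← hza,
      Function.iterate_succ_apply, frobenius_verschiebung_eq_natCast_mul,
      frobenius_iterate_natCast_mul, map_mul, map_natCast, ← hvb]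
    ring

theorem exists_pow_mul_eq_of_sub_mem_wittKer {n j : ℕ} (hj : j < n) {w v : WFlat p C}
    (hw : w - WittVector.verschiebung^[n] v ∈ wittKer p C 0) :
    ∃ a ∈ Icris p C, (p : Acris p C) ^ j * a =
      algebraMap (WFlat p C) (Acris p C) (WittVector.frobenius^[j] w) := by
  obtain ⟨a, ha, haw⟩ := exists_pow_mul_eq_of_mem_wittKer j hw
  obtain ⟨d, rfl⟩ := Nat.exists_eq_add_of_lt hj
  refine ⟨a + algebraMap _ _ (WittVector.verschiebung^[d + 1] v), add_mem ha ?_, ?_⟩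
  · rw [algebraMap_mem_Icris_iff, RingHom.mem_ker, Function.iterate_succ_apply',
      theta_verschiebung]
  · rw [mul_add, haw, ← map_natCast (algebraMap (WFlat p C) (Acris p C)), ← map_pow, ← map_mul,
      ← frobenius_iterate_verschiebung_iterate, ← map_add, ← iterate_map_add,
      ← Function.iterate_add_apply, ← add_assoc, sub_add_cancel]

end WittKer

/-! ### Representatives of the elements of `M(C)` -/

namespace WittVInv

variable {p : ℕ} [Fact p.Prime] {R : Type u} [CommRing R]

theorem of_add_verschiebung_iterate (n d : ℕ) (x : WittVector p R) :
    of p (n + d) (WittVector.verschiebung^[d] x) = of p n x := by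
  have h := AddCommGroup.DirectLimit.of_f (G := fun _ : ℕ => WittVector p R)
    (f := verschiebungPow p R) (hij := Nat.le_add_right n d) (x := x)
  rwa [verschiebungPow_apply, Nat.add_sub_cancel_left] at h

theorem of_succ_verschiebung (n : ℕ) (x : WittVector p R) :
    of p (n + 1) (WittVector.verschiebung x) = of p n x :=
  of_add_verschiebung_iterate n 1 x

theorem of_injective (n : ℕ) : Function.Injective (of p n : WittVector p R →+ WittVInv p R) := by
  refine (injective_iff_map_eq_zero _).2 fun x hx => ?_
  obtain ⟨j, _, hj⟩ := AddCommGroup.DirectLimit.of.zero_exact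
    (f := verschiebungPow p R) n x hx
  rw [verschiebungPow_apply] at hj
  exact (WittVector.verschiebung_injective p R).iterate (j - n)
    (hj.trans (iterate_map_zero WittVector.verschiebung _).symm)

theorem V_of (n : ℕ) (x : WittVector p R) :
    V p R (of p n x) = of p n (WittVector.verschiebung x) :=
  mapAux_of p _ _ _ _

theorem V_of_succ (n : ℕ) (x : WittVector p R) : V p R (of p (n + 1) x) = of p n x := by
  rw [V_of, of_succ_verschiebung]

theorem F_of [CharP R p] (n : ℕ) (x : WittVector p R) :
    F p R (of p n x) = of p n (WittVector.frobenius x) :=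
  mapAux_of p _ _ _ _

theorem map_of {S : Type u} [CommRing S] (φ : R →+* S) (n : ℕ) (x : WittVector p R) :
    map p φ (of p n x) = of p n (WittVector.map φ x) :=
  mapAux_of p _ _ _ _

theorem V_injective : Function.Injective (V p R) := by
  refine (injective_iff_map_eq_zero _).2 fun z hz => ?_
  obtain ⟨n, x, rfl⟩ := exists_of z
  rw [← of_succ_verschiebung, V_of_succ] at hz
  rw [← of_succ_verschiebung, of_injective n (hz.trans (map_zero _).symm), map_zero]

end WittVInv

section Representatives

variable {p : ℕ} [Fact p.Prime] {C : Type u} [CommRing C] [CharP C p]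

/-- The component of `x` in `W(C^♭ / Ker ν_m)[V⁻¹]` is the image of `V ^ (-N) w`. -/
def M.IsRep (x : M p C) (m N : ℕ) (w : WFlat p C) : Prop :=
  x.1 m = WittVInv.of p N (WittVector.map (Ideal.Quotient.mk (kerNu p C m)) w)

namespace M

theorem exists_isRep (x : M p C) (m : ℕ) : ∃ N w, M.IsRep x m N w := by
  obtain ⟨N, y, hy⟩ := WittVInv.exists_of (x.1 m)
  obtain ⟨w, rfl⟩ := WittVector.map_surjective _ Ideal.Quotient.mk_surjective y
  exact ⟨N, w, hy⟩

theorem exists_isRep_zero_zero (x : M p C) : ∃ w, M.IsRep x 0 0 w := by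
  obtain ⟨y, hy⟩ := x.2.2
  obtain ⟨w, rfl⟩ := WittVector.map_surjective _ Ideal.Quotient.mk_surjective y
  exact ⟨w, hy⟩

theorem IsRep.add_right {x : M p C} {m N : ℕ} {w : WFlat p C} (h : M.IsRep x m N w) (d : ℕ) :
    M.IsRep x m (N + d) (WittVector.verschiebung^[d] w) := by
  rw [IsRep, map_verschiebung_iterate, WittVInv.of_add_verschiebung_iterate]
  exact h

theorem IsRep.of_succ {x : M p C} {m N : ℕ} {w : WFlat p C} (h : M.IsRep x (m + 1) N w) :
    M.IsRep x m N w := by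
  rw [IsRep, ← x.2.1 m, h, transition, WittVInv.map_of]
  rfl

theorem IsRep.zero {x : M p C} {m N : ℕ} {w : WFlat p C} (h : M.IsRep x m N w) :
    M.IsRep x 0 N w := by
  induction m with
  | zero => exact h
  | succ m ih => exact ih h.of_succ

theorem IsRep.iff_sub_mem_wittKer {x : M p C} {m N : ℕ} {w v : WFlat p C}
    (h : M.IsRep x m N w) : M.IsRep x m N v ↔ v - w ∈ wittKer p C m := by
  rw [IsRep, h, (WittVInv.of_injective N).eq_iff, eq_comm, map_mk_eq_iff_sub_mem_wittKer]

theorem IsRep.add {x y : M p C} {m N : ℕ} {v w : WFlat p C} (hx : M.IsRep x m N v)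
    (hy : M.IsRep y m N w) : M.IsRep (x + y) m N (v + w) := by
  rw [IsRep, map_add, map_add, ← hx, ← hy]
  rfl

theorem IsRep.smul {x : M p C} {m N : ℕ} {w : WFlat p C} (h : M.IsRep x m N w)
    (u : WFlat p C) :
    M.IsRep (u • x) m N ((WittVector.frobeniusEquiv p (Perfection C p)).symm^[N] u * w) := by
  change u • x.1 m = _
  rw [h, WittVInv.smul_of, map_mul (WittVector.map _)]
  rfl

theorem IsRep.F {x : M p C} {m N : ℕ} {w : WFlat p C} (h : M.IsRep x m N w) :
    M.IsRep (M.F x) m N (WittVector.frobenius w) := by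
  change WittVInv.F p _ (x.1 m) = _
  rw [h, WittVInv.F_of, map_frobenius]

theorem IsRep.V {x : M p C} {m N : ℕ} {w : WFlat p C} (h : M.IsRep x m N w) :
    M.IsRep (M.V x) m N (WittVector.verschiebung w) := by
  change WittVInv.V p _ (x.1 m) = _
  rw [h, WittVInv.V_of, WittVector.map_verschiebung]

theorem IsRep.V_iterate {x : M p C} {m N : ℕ} {w : WFlat p C} (h : M.IsRep x m N w) (n : ℕ) :
    M.IsRep (M.V^[n] x) m N (WittVector.verschiebung^[n] w) := by
  induction n with
  | zero => exact h
  | succ n ih =>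
    rw [Function.iterate_succ_apply', Function.iterate_succ_apply']
    exact ih.V

theorem IsRep.of_V {x : M p C} {m N : ℕ} {w : WFlat p C} (h : M.IsRep (M.V x) m N w) :
    M.IsRep x m (N + 1) w :=
  WittVInv.V_injective (p := p) ((h : WittVInv.V p _ (x.1 m) = _).trans
    (WittVInv.V_of_succ N _).symm)

theorem IsRep.of_V_iterate {x : M p C} {m N n : ℕ} {w : WFlat p C}
    (h : M.IsRep (M.V^[n] x) m N w) : M.IsRep x m (N + n) w := by
  induction n generalizing N with
  | zero => exact h
  | succ n ih =>
    rw [Function.iterate_succ_apply'] at h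
    rw [← add_assoc, add_right_comm]
    exact ih h.of_V

theorem isRep_toM (w : WFlat p C) (m : ℕ) : M.IsRep (toM p C w) m 0 w := rfl

theorem exists_forall_isRep (N : ℕ → ℕ) (w : ℕ → WFlat p C) (hN : N 0 = 0)
    (h : ∀ m, ∃ d, N (m + 1) = N m + d ∧
      w (m + 1) - WittVector.verschiebung^[d] (w m) ∈ wittKer p C m) :
    ∃ x : M p C, ∀ m, M.IsRep x m (N m) (w m) := by
  refine ⟨⟨fun m => WittVInv.of p (N m)
    (WittVector.map (Ideal.Quotient.mk (kerNu p C m)) (w m)), fun m => ?_, _,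
      by simp only [hN]; rfl⟩, fun m => rfl⟩
  obtain ⟨d, hd, hw⟩ := h m
  calc transition p C m (WittVInv.of p (N (m + 1))
        (WittVector.map (Ideal.Quotient.mk (kerNu p C (m + 1))) (w (m + 1))))
      = WittVInv.of p (N (m + 1)) (WittVector.map (Ideal.Quotient.mk (kerNu p C m))
          (w (m + 1))) := WittVInv.map_of ..
    _ = WittVInv.of p (N m) (WittVector.map (Ideal.Quotient.mk (kerNu p C m)) (w m)) := by
        rw [map_mk_eq_iff_sub_mem_wittKer.2 hw, hd, map_verschiebung_iterate,
          WittVInv.of_add_verschiebung_iterate]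

end M

end Representatives

/-! ### The map `M(C) → A_cris(C)` -/

section CanonicalMap

variable {p : ℕ} [Fact p.Prime] {C : Type u} [CommRing C] [CharP C p]

/-- `a` is congruent to `p ^ (-N) F ^ N (w)` modulo `p ^ m`. -/
def IsApprox (a : Acris p C) (m N : ℕ) (w : WFlat p C) : Prop :=
  (p : Acris p C) ^ (N + m) ∣ (p : Acris p C) ^ N * a -
    algebraMap (WFlat p C) (Acris p C) (WittVector.frobenius^[N] w)

/-- `a ∈ A_cris(C)` is the value at `x = (V ^ (-N_m) w_m)_m ∈ M(C)` of the canonical map, i.e.,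
`a` is the limit of the elements `p ^ (-N_m) F ^ (N_m) (w_m)`. -/
def M.HasValue (x : M p C) (a : Acris p C) : Prop :=
  ∀ m N w, M.IsRep x m N w → IsApprox a m N w

theorem isApprox_congr {a : Acris p C} {m N : ℕ} {v w : WFlat p C} (h : v - w ∈ wittKer p C m) :
    IsApprox a m N v ↔ IsApprox a m N w := by
  have hdvd := pow_dvd_algebraMap_frobenius_iterate N h
  rw [iterate_map_sub, map_sub, dvd_sub_comm] at hdvd
  refine dvd_iff_dvd_of_dvd_sub ?_
  rwa [sub_sub_sub_cancel_left]

theorem IsApprox.add {a b : Acris p C} {m N : ℕ} {v w : WFlat p C} (ha : IsApprox a m N v)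
    (hb : IsApprox b m N w) : IsApprox (a + b) m N (v + w) := by
  rw [IsApprox, iterate_map_add, map_add, mul_add, add_sub_add_comm]
  exact dvd_add ha hb

theorem IsApprox.smul {a : Acris p C} {m N : ℕ} {w : WFlat p C} (ha : IsApprox a m N w)
    (u : WFlat p C) :
    IsApprox (u • a) m N ((WittVector.frobeniusEquiv p (Perfection C p)).symm^[N] u * w) := by
  have frobenius_symm : WittVector.frobenius^[N]
      ((WittVector.frobeniusEquiv p (Perfection C p)).symm^[N] u) = u :=
    Function.RightInverse.iterate
      (WittVector.frobeniusEquiv p (Perfection C p)).apply_symm_apply N u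
  rw [IsApprox, iterate_map_mul, frobenius_symm, map_mul, Algebra.smul_def, mul_left_comm,
    ← mul_sub]
  exact ha.mul_left _

variable [IsAddTorsionFree (Acris p C)]

theorem isApprox_add_right_iff {a : Acris p C} {m N : ℕ} (d : ℕ) {w : WFlat p C} :
    IsApprox a m (N + d) (WittVector.verschiebung^[d] w) ↔ IsApprox a m N w := by
  have factor_out : (p : Acris p C) ^ (N + d) * a - algebraMap (WFlat p C) (Acris p C)
      (WittVector.frobenius^[N + d] (WittVector.verschiebung^[d] w)) =
      (p : Acris p C) ^ d * ((p : Acris p C) ^ N * a -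
        algebraMap (WFlat p C) (Acris p C) (WittVector.frobenius^[N] w)) := by
    rw [Function.iterate_add_apply, frobenius_iterate_verschiebung_iterate,
      ← Nat.cast_pow (α := WFlat p C), frobenius_iterate_natCast_mul, map_mul, map_natCast]
    push_cast
    ring
  rw [IsApprox, IsApprox, factor_out, add_comm N d, add_assoc]
  exact ⟨pow_dvd_of_pow_add_dvd, fun h => pow_add (p : Acris p C) .. ▸ mul_dvd_mul_left _ h⟩

theorem IsApprox.of_isRep {x : M p C} {a : Acris p C} {m N N' : ℕ} {w w' : WFlat p C}
    (ha : IsApprox a m N w) (h : M.IsRep x m N w) (h' : M.IsRep x m N' w') :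
    IsApprox a m N' w' := by
  rw [← isApprox_add_right_iff N]
  rw [← isApprox_add_right_iff N', add_comm] at ha
  exact (isApprox_congr ((add_comm N N' ▸ h.add_right N').iff_sub_mem_wittKer.1
    (h'.add_right N))).2 ha

theorem IsApprox.pow_dvd_sub {a b : Acris p C} {m N : ℕ} {w : WFlat p C} (ha : IsApprox a m N w)
    (hb : IsApprox b m N w) : (p : Acris p C) ^ m ∣ a - b := by
  have hdvd := dvd_sub ha hb
  rw [sub_sub_sub_cancel_right, ← mul_sub] at hdvd
  exact pow_dvd_of_pow_add_dvd hdvd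

theorem M.HasValue.unique {x : M p C} {a b : Acris p C} (ha : M.HasValue x a)
    (hb : M.HasValue x b) : a = b := by
  refine sub_eq_zero.1 (eq_zero_of_forall_pow_dvd (a := (p : Acris p C)) fun m => ?_)
  obtain ⟨N, w, h⟩ := M.exists_isRep x m
  exact (ha m N w h).pow_dvd_sub (hb m N w h)

theorem M.hasValue_of_forall_exists {x : M p C} {a : Acris p C}
    (h : ∀ m, ∃ N w, M.IsRep x m N w ∧ IsApprox a m N w) : M.HasValue x a := fun m _ _ hx =>
  let ⟨_, _, hx', ha⟩ := h m
  ha.of_isRep hx' hx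

theorem M.exists_isApprox (x : M p C) (m : ℕ) :
    ∃ a : Acris p C, ∀ N w, M.IsRep x m N w → IsApprox a m N w := by
  obtain ⟨N, w, h⟩ := M.exists_isRep x m
  obtain ⟨w₀, h₀⟩ := M.exists_isRep_zero_zero x
  have happrox₀ : IsApprox (algebraMap (WFlat p C) (Acris p C) w₀) 0 0 w₀ := by simp [IsApprox]
  obtain ⟨a, ha⟩ : (p : Acris p C) ^ N ∣ algebraMap (WFlat p C) (Acris p C)
      (WittVector.frobenius^[N] w) :=
    (dvd_sub_right (dvd_mul_right _ _)).1 (happrox₀.of_isRep h₀ h.zero)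
  have happrox : IsApprox a m N w := by rw [IsApprox, ha, sub_self]; exact dvd_zero _
  exact ⟨a, fun N' w' h' => happrox.of_isRep h h'⟩

theorem M.exists_hasValue (x : M p C) : ∃ a : Acris p C, M.HasValue x a := by
  choose a ha using M.exists_isApprox x
  obtain ⟨L, hL⟩ := exists_forall_pow_dvd_sub (a := (p : Acris p C)) a fun m => by
    obtain ⟨N, w, h⟩ := M.exists_isRep x (m + 1)
    have hsucc : IsApprox (a (m + 1)) m N w :=
      (pow_dvd_pow _ (by omega)).trans (ha (m + 1) N w h)
    exact hsucc.pow_dvd_sub (ha m N w h.of_succ)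
  refine ⟨L, fun m N w h => ?_⟩
  have hdvd := dvd_add (mul_dvd_mul_left ((p : Acris p C) ^ N) (hL m))
    ((pow_add (p : Acris p C) N m).symm.dvd.trans (ha m N w h))
  rw [IsApprox, pow_add]
  convert hdvd using 1
  ring

theorem exists_linearMap_hasValue : ∃ f : M p C →ₗ[WFlat p C] Acris p C,
    ∀ x, M.HasValue x (f x) := by
  choose g hg using M.exists_hasValue (p := p) (C := C)
  refine ⟨{ toFun := g, map_add' := fun x y => ?_, map_smul' := fun u x => ?_ }, hg⟩
  · refine (hg _).unique (M.hasValue_of_forall_exists fun m => ?_)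
    obtain ⟨N₁, v₁, h₁⟩ := M.exists_isRep x m
    obtain ⟨N₂, v₂, h₂⟩ := M.exists_isRep y m
    have hx := h₁.add_right N₂
    have hy := add_comm N₂ N₁ ▸ h₂.add_right N₁
    exact ⟨_, _, hx.add hy, (hg _ _ _ _ hx).add (hg _ _ _ _ hy)⟩
  · refine (hg _).unique (M.hasValue_of_forall_exists fun m => ?_)
    obtain ⟨N, v, h⟩ := M.exists_isRep x m
    exact ⟨_, _, h.smul u, (hg _ _ _ _ h).smul u⟩

end CanonicalMap

/-! ### Existence and uniqueness of the canonical map -/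

namespace WittVInv

variable {p : ℕ} [Fact p.Prime] {R S T : Type u} [CommRing R] [CommRing S] [CommRing T]

theorem V_iterate_of (n : ℕ) (x : WittVector p R) : (V p R)^[n] (of p n x) = of p 0 x := by
  induction n with
  | zero => rfl
  | succ n ih => rw [Function.iterate_succ_apply, V_of_succ, ih]

theorem V_surjective : Function.Surjective (V p R) := fun z => by
  obtain ⟨n, x, rfl⟩ := exists_of z
  exact ⟨of p (n + 1) x, V_of_succ n x⟩

theorem map_V (φ : R →+* S) (z : WittVInv p R) : map p φ (V p R z) = V p S (map p φ z) := by
  obtain ⟨n, x, rfl⟩ := exists_of z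
  rw [V_of, map_of, map_of, V_of, WittVector.map_verschiebung]

theorem F_V [CharP R p] (z : WittVInv p R) : F p R (V p R z) = p • z := by
  obtain ⟨n, x, rfl⟩ := exists_of z
  rw [V_of, F_of, frobenius_verschiebung_eq_natCast_mul, ← map_nsmul, nsmul_eq_mul]

theorem map_map (φ : R →+* S) (ψ : S →+* T) (z : WittVInv p R) :
    map p ψ (map p φ z) = map p (ψ.comp φ) z := by
  obtain ⟨n, x, rfl⟩ := exists_of z
  rw [map_of, map_of, map_of, WittVector.map, WittVector.map]
  rfl

theorem map_injective {φ : R →+* S} (hφ : Function.Injective φ) :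
    Function.Injective (map p φ) := by
  refine (injective_iff_map_eq_zero _).2 fun z hz => ?_
  obtain ⟨n, x, rfl⟩ := exists_of z
  rw [map_of] at hz
  have hmap : WittVector.map φ x = 0 := of_injective n (hz.trans (map_zero _).symm)
  rw [WittVector.map_injective φ hφ (hmap.trans (map_zero _).symm), map_zero]

theorem F_eq_map [CharP R p] (z : WittVInv p R) : F p R z = map p (frobenius R p) z := by
  obtain ⟨n, x, rfl⟩ := exists_of z
  rw [F_of, map_of, WittVector.frobenius_eq_map_frobenius]

end WittVInv

section ModuleM

variable {p : ℕ} [Fact p.Prime] {C : Type u} [CommRing C] [CharP C p]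

variable (p C) in
/-- The homomorphism `C^♭ / Ker ν_(m + 1) → C^♭ / Ker ν_m` induced by the inverse of the
Frobenius of `C^♭`. -/
def rootQuot (m : ℕ) : FlatQuot p C (m + 1) →+* FlatQuot p C m :=
  Ideal.quotientMap (kerNu p C m) (frobeniusEquiv (Perfection C p) p).symm.toRingHom fun c hc =>
    (Perfection.coeff_symm_frobeniusEquiv c m).trans hc

theorem rootQuot_mk (m : ℕ) (c : Perfection C p) :
    rootQuot p C m (Ideal.Quotient.mk _ c) =
      Ideal.Quotient.mk _ ((frobeniusEquiv (Perfection C p) p).symm c) := rfl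

theorem rootQuot_injective (m : ℕ) : Function.Injective (rootQuot p C m) := by
  refine (injective_iff_map_eq_zero _).2 fun c hc => ?_
  obtain ⟨c, rfl⟩ := Ideal.Quotient.mk_surjective c
  rw [rootQuot_mk, Ideal.Quotient.eq_zero_iff_mem] at hc
  exact Ideal.Quotient.eq_zero_iff_mem.2
    ((Perfection.coeff_symm_frobeniusEquiv c m).symm.trans hc)

theorem frobenius_comp_rootQuot (m : ℕ) :
    (frobenius (FlatQuot p C m) p).comp (rootQuot p C m) =
      Ideal.Quotient.factor (kerNu_le p C m) := by
  refine RingHom.ext fun c => ?_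
  obtain ⟨c, rfl⟩ := Ideal.Quotient.mk_surjective c
  rw [RingHom.comp_apply, rootQuot_mk, frobenius_def, ← map_pow, Ideal.Quotient.factor_mk]
  exact congrArg _ ((frobeniusEquiv (Perfection C p) p).apply_symm_apply c)

namespace M

/-- The components of `F⁻¹ x ∈ lim W(C^♭ / Ker ν_m)[V⁻¹]`; as `F⁻¹ x` need not belong to `M(C)`,
they are not bundled. -/
def rootF (x : M p C) (m : ℕ) : WittVInv p (FlatQuot p C m) :=
  WittVInv.map p (rootQuot p C m) (x.1 (m + 1))

theorem transition_rootF (x : M p C) (m : ℕ) :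
    transition p C m (rootF x (m + 1)) = rootF x m := by
  rw [rootF, rootF, ← x.2.1 (m + 1), transition, WittVInv.map_map, transition, WittVInv.map_map]
  congr 2
  exact RingHom.ext fun c => by
    obtain ⟨c, rfl⟩ := Ideal.Quotient.mk_surjective c
    rfl

theorem F_rootF (x : M p C) (m : ℕ) : WittVInv.F p _ (rootF x m) = x.1 m := by
  rw [rootF, WittVInv.F_eq_map, WittVInv.map_map, frobenius_comp_rootQuot]
  exact x.2.1 m

theorem apply_succ_eq_zero_of_rootF_eq_zero {x : M p C} {m : ℕ} (h : rootF x m = 0) :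
    x.1 (m + 1) = 0 :=
  WittVInv.map_injective (rootQuot_injective m) (h.trans (map_zero _).symm)

theorem exists_apply_eq_V_iterate_rootF (x : M p C) : ∃ (N : ℕ) (z : M p C),
    ∀ m, z.1 m = (WittVInv.V p _)^[N] (rootF x m) := by
  obtain ⟨N, y, hy⟩ := WittVInv.exists_of (rootF x 0)
  refine ⟨N, ⟨fun m => (WittVInv.V p _)^[N] (rootF x m), fun m => ?_, y, ?_⟩, fun m => rfl⟩
  · beta_reduce
    rw [← transition_rootF x m]
    exact Function.Semiconj.iterate_right (f := transition p C m)
      (fun z => WittVInv.map_V _ z) N _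
  · rw [← WittVInv.V_iterate_of N y, ← hy]

theorem natCast_smul_apply (x : M p C) (m : ℕ) :
    ((p : WFlat p C) • x).1 m = WittVInv.F p _ (WittVInv.V p _ (x.1 m)) := by
  rw [Nat.cast_smul_eq_nsmul, WittVInv.F_V]
  rfl

theorem F_V (x : M p C) : M.F (M.V x) = (p : WFlat p C) • x :=
  Subtype.ext (funext fun m => (natCast_smul_apply x m).symm)

-- The quotient of `x` by `p` is `V⁻¹ F⁻¹ x`; the vanishing of `x` in degree `m + 1` ensures that
-- its component of degree `0` vanishes, so that it belongs to `M(C)`.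
theorem exists_eq_natCast_smul_of_apply_succ_eq_zero {x : M p C} {m : ℕ} (h : x.1 (m + 1) = 0) :
    ∃ z : M p C, z.1 m = 0 ∧ x = (p : WFlat p C) • z := by
  choose z hz using fun m => WittVInv.V_surjective (rootF x m)
  have transition_z (m : ℕ) : transition p C m (z (m + 1)) = z m := by
    refine WittVInv.V_injective ?_
    rw [transition, ← WittVInv.map_V, hz, hz, ← transition]
    exact transition_rootF x m
  have z_eq_zero : z m = 0 := WittVInv.V_injective (by rw [hz, rootF, h, map_zero, map_zero])
  have z_zero_eq_zero : z 0 = 0 := by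
    clear h
    induction m with
    | zero => exact z_eq_zero
    | succ m ih => exact ih (by rw [← transition_z, z_eq_zero, map_zero])
  refine ⟨⟨z, transition_z, 0, by rw [z_zero_eq_zero, map_zero]⟩, z_eq_zero,
    Subtype.ext (funext fun m => ?_)⟩
  rw [natCast_smul_apply, hz, F_rootF]

theorem exists_eq_pow_smul_of_apply_eq_zero {x : M p C} {m : ℕ} (h : x.1 m = 0) :
    ∃ z : M p C, x = ((p : WFlat p C) ^ m) • z := by
  induction m generalizing x with
  | zero => exact ⟨x, by rw [pow_zero, one_smul]⟩
  | succ m ih =>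
    obtain ⟨y, hy, rfl⟩ := exists_eq_natCast_smul_of_apply_succ_eq_zero h
    obtain ⟨z, rfl⟩ := ih hy
    exact ⟨z, by rw [smul_smul, pow_succ']⟩

theorem V_iterate_apply (n : ℕ) (x : M p C) (m : ℕ) :
    (M.V^[n] x).1 m = (WittVInv.V p _)^[n] (x.1 m) :=
  Function.Semiconj.iterate_right (f := fun x : M p C => x.1 m) (fun _ => rfl) n x

theorem exists_V_iterate_eq_toM {x : M p C} {N : ℕ} {w : WFlat p C} (h : M.IsRep x 0 N w) :
    ∃ y : M p C, M.V^[N] y = toM p C w ∧ ∀ m, M.IsRep y m N w := by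
  refine ⟨⟨fun m => WittVInv.of p N (WittVector.map (Ideal.Quotient.mk (kerNu p C m)) w),
    fun m => ?_, ?_⟩, Subtype.ext (funext fun m => ?_), fun m => rfl⟩
  · rw [transition, WittVInv.map_of]
    rfl
  · obtain ⟨y, hy⟩ := x.2.2
    exact ⟨y, h.symm.trans hy⟩
  · rw [V_iterate_apply, WittVInv.V_iterate_of]
    rfl

theorem exists_V_iterate_eq_toM_add_pow_smul (x : M p C) (m : ℕ) :
    ∃ (N : ℕ) (w : WFlat p C) (y z : M p C),
      M.V^[N] y = toM p C w ∧ x = y + ((p : WFlat p C) ^ m) • z := by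
  obtain ⟨N, w, h⟩ := M.exists_isRep x m
  obtain ⟨y, hV, hy⟩ := exists_V_iterate_eq_toM h.zero
  have apply_eq_zero : (x - y).1 m = 0 := by
    change x.1 m - y.1 m = 0
    rw [h, hy m, sub_self]
  obtain ⟨z, hz⟩ := exists_eq_pow_smul_of_apply_eq_zero apply_eq_zero
  exact ⟨N, w, y, z, hV, sub_eq_iff_eq_add'.1 hz⟩

end M

theorem IteratesTo.unique {F' : Icris p C → Acris p C} {n : ℕ} {c a b : Acris p C}
    (ha : IteratesTo F' n c a) (hb : IteratesTo F' n c b) : a = b := by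
  induction n generalizing c with
  | zero => exact ha.symm.trans hb
  | succ n ih => exact ih ha.2 hb.2

theorem IsCanonicalMap.unique {F' : Icris p C → Acris p C} {f g : M p C →ₗ[WFlat p C] Acris p C}
    (hf : IsCanonicalMap F' f) (hg : IsCanonicalMap F' g) : f = g := by
  refine LinearMap.ext fun x =>
    sub_eq_zero.1 (eq_zero_of_forall_pow_dvd (a := (p : Acris p C)) fun m => ?_)
  obtain ⟨N, w, y, z, hy, rfl⟩ := M.exists_V_iterate_eq_toM_add_pow_smul x m
  rw [map_add, map_add, (hf.map_M₀ y N w hy).unique (hg.map_M₀ y N w hy),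
    add_sub_add_left_eq_sub, map_smul, map_smul, ← smul_sub, Algebra.smul_def, map_pow,
    map_natCast]
  exact dvd_mul_right _ _

theorem acrisFrobenius_iterate_natCast_mul (n k : ℕ) (c : Acris p C) :
    (acrisFrobenius p C)^[n] (k * c) = k * (acrisFrobenius p C)^[n] c := by
  rw [iterate_map_mul, Function.iterate_fixed (map_natCast (acrisFrobenius p C) k)]

variable [IsAddTorsionFree (Acris p C)]

theorem iteratesTo_of_pow_mul {F' : Icris p C → Acris p C}
    (hF : ∀ c, (p : Acris p C) * F' c = acrisFrobenius p C c) {n : ℕ} {c a : Acris p C}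
    (h : ∀ j < n, ∃ b ∈ Icris p C, (p : Acris p C) ^ j * b = (acrisFrobenius p C)^[j] c)
    (ha : (p : Acris p C) ^ n * a = (acrisFrobenius p C)^[n] c) : IteratesTo F' n c a := by
  induction n generalizing c with
  | zero =>
    rw [pow_zero, one_mul] at ha
    exact ha.symm
  | succ n ih =>
    obtain ⟨b, hb, hbc⟩ := h 0 (Nat.succ_pos n)
    have hc : c ∈ Icris p C := by
      rw [pow_zero, one_mul, Function.iterate_zero_apply] at hbc
      exact hbc ▸ hb
    have iterate_succ (j : ℕ) : (acrisFrobenius p C)^[j + 1] c =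
        p * (acrisFrobenius p C)^[j] (F' ⟨c, hc⟩) := by
      rw [Function.iterate_succ_apply, ← hF ⟨c, hc⟩, acrisFrobenius_iterate_natCast_mul]
    refine ⟨hc, ih (fun j hj => ?_) (mul_left_cancel_prime (p := p) ?_)⟩
    · obtain ⟨b, hb, hbj⟩ := h (j + 1) (by omega)
      refine ⟨b, hb, mul_left_cancel_prime (p := p) ?_⟩
      rw [← iterate_succ, ← hbj, pow_succ', mul_assoc]
    · rw [← iterate_succ, ← ha, pow_succ', mul_assoc]

theorem M.HasValue.acrisFrobenius {x : M p C} {a : Acris p C} (ha : M.HasValue x a) :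
    M.HasValue (M.F x) (acrisFrobenius p C a) := by
  refine M.hasValue_of_forall_exists fun m => ?_
  obtain ⟨N, w, h⟩ := M.exists_isRep x m
  refine ⟨N, _, h.F, ?_⟩
  have hdvd := map_dvd (Fontaine.acrisFrobenius p C) (ha m N w h)
  rwa [map_pow, map_sub, map_mul, map_pow, map_natCast, acrisFrobenius_algebraMap,
    ← Function.iterate_succ_apply' WittVector.frobenius, Function.iterate_succ_apply] at hdvd

theorem M.HasValue.iteratesTo {F' : Icris p C → Acris p C}
    (hF : ∀ c, (p : Acris p C) * F' c = Fontaine.acrisFrobenius p C c) {x : M p C}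
    {a : Acris p C} (ha : M.HasValue x a) {n : ℕ} {w : WFlat p C} (hx : M.V^[n] x = toM p C w) :
    IteratesTo F' n (algebraMap (WFlat p C) (Acris p C) w) a := by
  have isRep (m : ℕ) : M.IsRep x m n w :=
    zero_add n ▸ M.IsRep.of_V_iterate (hx ▸ M.isRep_toM w m)
  obtain ⟨w₀, h₀⟩ := M.exists_isRep_zero_zero x
  have sub_mem := h₀.V_iterate n
  rw [hx, (M.isRep_toM w 0).iff_sub_mem_wittKer, ← neg_mem_iff, neg_sub] at sub_mem
  refine iteratesTo_of_pow_mul hF (fun j hj => ?_) ?_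
  · rw [acrisFrobenius_iterate_algebraMap]
    exact exists_pow_mul_eq_of_sub_mem_wittKer hj sub_mem
  · rw [acrisFrobenius_iterate_algebraMap]
    exact sub_eq_zero.1 (eq_zero_of_forall_pow_dvd (a := (p : Acris p C)) fun m =>
      (pow_dvd_pow _ (by omega)).trans (ha m n w (isRep m)))

variable {F' : Icris p C → Acris p C}
  (hF : ∀ c, (p : Acris p C) * F' c = acrisFrobenius p C c)
  {f : M p C →ₗ[WFlat p C] Acris p C}

include hF

theorem isCanonicalMap_of_hasValue (hf : ∀ x, M.HasValue x (f x)) : IsCanonicalMap F' f where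
  map_F x := (hf (M.F x)).unique (hf x).acrisFrobenius
  map_M₀ x _ _ hx := (hf x).iteratesTo hF hx

theorem existsUnique_isCanonicalMap :
    ∃! f : M p C →ₗ[WFlat p C] Acris p C, IsCanonicalMap F' f := by
  obtain ⟨f, hf⟩ := exists_linearMap_hasValue (p := p) (C := C)
  have hcan := isCanonicalMap_of_hasValue hF hf
  exact ⟨f, hcan, fun g hg => hg.unique hcan⟩

theorem IsCanonicalMap.hasValue (h : IsCanonicalMap F' f) (x : M p C) : M.HasValue x (f x) := by
  obtain ⟨g, hg⟩ := exists_linearMap_hasValue (p := p) (C := C)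
  rw [h.unique (isCanonicalMap_of_hasValue hF hg)]
  exact hg x

end ModuleM

/-! ### The image of the canonical map -/

section Image

variable {p : ℕ} [Fact p.Prime] {C : Type u} [CommRing C] [CharP C p]

theorem natCast_pow_dvd_verschiebung_iterate (n : ℕ) (w : WFlat p C) :
    (p : WFlat p C) ^ n ∣ WittVector.verschiebung^[n] w := by
  induction n generalizing w with
  | zero => rw [pow_zero]; exact one_dvd _
  | succ n ih =>
    obtain ⟨v, rfl⟩ := (WittVector.frobenius_bijective p (Perfection C p)).surjective w
    rw [Function.iterate_succ_apply, ← natCast_mul_eq_verschiebung_frobenius, ← nsmul_eq_mul,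
      iterate_map_nsmul, nsmul_eq_mul, pow_succ']
    exact mul_dvd_mul_left _ (ih v)

theorem natCast_pow_dvd_algebraMap_verschiebung_iterate (n : ℕ) (w : WFlat p C) :
    (p : Acris p C) ^ n ∣ algebraMap (WFlat p C) (Acris p C) (WittVector.verschiebung^[n] w) := by
  simpa only [map_pow, map_natCast] using
    map_dvd (algebraMap (WFlat p C) (Acris p C)) (natCast_pow_dvd_verschiebung_iterate n w)

theorem algebraMap_verschiebung_mem_Icris (v : WFlat p C) :
    algebraMap (WFlat p C) (Acris p C) (WittVector.verschiebung v) ∈ Icris p C :=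
  algebraMap_mem_Icris_iff.2 (theta_verschiebung v)

variable (p C) in
/-- The elements of `A_cris(C)` to which `F'` can be applied infinitely many times: `F ^ j (a)` is
divisible by `p ^ j` in `I_cris(C)` for all `j`. -/
def AcrisInfty : AddSubgroup (Acris p C) where
  carrier := {a | ∀ j : ℕ, ∃ b ∈ Icris p C, (p : Acris p C) ^ j * b = (acrisFrobenius p C)^[j] a}
  zero_mem' j := ⟨0, zero_mem _, by rw [mul_zero, iterate_map_zero]⟩
  add_mem' {x y} hx hy j := by
    obtain ⟨b, hb, hxb⟩ := hx j
    obtain ⟨c, hc, hyc⟩ := hy j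
    exact ⟨b + c, add_mem hb hc, by rw [mul_add, hxb, hyc, iterate_map_add]⟩
  neg_mem' {x} hx j := by
    obtain ⟨b, hb, hxb⟩ := hx j
    exact ⟨-b, neg_mem hb, by rw [mul_neg, hxb, iterate_map_neg]⟩

theorem mem_Icris_of_mem_acrisInfty {a : Acris p C} (ha : a ∈ AcrisInfty p C) :
    a ∈ Icris p C := by
  obtain ⟨b, hb, hab⟩ := ha 0
  rw [pow_zero, one_mul, Function.iterate_zero_apply] at hab
  exact hab ▸ hb

theorem algebraMap_mem_acrisInfty {w : WFlat p C} (hw : w ∈ wittKer p C 0) :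
    algebraMap (WFlat p C) (Acris p C) w ∈ AcrisInfty p C := fun j => by
  rw [acrisFrobenius_iterate_algebraMap]
  exact exists_pow_mul_eq_of_mem_wittKer j hw

theorem mem_acrisInfty_of_acrisFrobenius_eq {y z : Acris p C} (hy : y ∈ Icris p C)
    (hyz : acrisFrobenius p C y = p * z) (hz : z ∈ AcrisInfty p C) : y ∈ AcrisInfty p C
  | 0 => ⟨y, hy, by rw [pow_zero, one_mul, Function.iterate_zero_apply]⟩
  | j + 1 => by
    obtain ⟨b, hb, hzb⟩ := hz j
    exact ⟨b, hb, by rw [Function.iterate_succ_apply, hyz, acrisFrobenius_iterate_natCast_mul,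
      ← hzb, pow_succ', mul_assoc]⟩

section Flat

variable [IsAddTorsionFree (Acris p C)]

theorem mem_acrisInfty_of_natCast_mul_eq {y z : Acris p C} (hy : y ∈ AcrisInfty p C)
    (hyz : acrisFrobenius p C y = p * z) : z ∈ AcrisInfty p C := fun j => by
  obtain ⟨b, hb, hyb⟩ := hy (j + 1)
  refine ⟨b, hb, mul_left_cancel_prime (p := p) ?_⟩
  rw [← mul_assoc, ← pow_succ', hyb, Function.iterate_succ_apply, hyz,
    acrisFrobenius_iterate_natCast_mul]

theorem mem_wittKer_of_algebraMap_mem_acrisInfty {w : WFlat p C}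
    (hw : algebraMap (WFlat p C) (Acris p C) w ∈ AcrisInfty p C) : w ∈ wittKer p C 0 := by
  refine mem_wittKer.2 fun i => ?_
  induction i generalizing w with
  | zero => exact algebraMap_mem_Icris_iff.1 (mem_Icris_of_mem_acrisInfty hw)
  | succ i ih =>
    have hw₀ : w.coeff 0 ∈ kerNu p C 0 :=
      algebraMap_mem_Icris_iff.1 (mem_Icris_of_mem_acrisInfty hw)
    have verschiebung_mem : algebraMap (WFlat p C) (Acris p C)
        (WittVector.verschiebung (w.shift 1)) ∈ AcrisInfty p C := by
      rw [← sub_eq_of_eq_add' (eq_teichmuller_add_verschiebung_shift w), map_sub]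
      exact sub_mem hw (algebraMap_mem_acrisInfty (teichmuller_mem_wittKer hw₀))
    have shift_mem := mem_acrisInfty_of_natCast_mul_eq verschiebung_mem
      (z := algebraMap (WFlat p C) (Acris p C) (w.shift 1)) (by
        rw [acrisFrobenius_algebraMap, frobenius_verschiebung_eq_natCast_mul, map_mul,
          map_natCast])
    exact add_comm 1 i ▸ ih shift_mem

end Flat

/-- A `p`-adically null sequence in `A_cris(C)` with `F (v_(n + 1)) = p v_n`. In `M(C)`, where
`F V = p`, the model is `v_n = V ^ n x`. -/
structure IsVSequence (v : ℕ → Acris p C) : Prop where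
  acrisFrobenius_succ (n : ℕ) : acrisFrobenius p C (v (n + 1)) = p * v n
  eventually_pow_dvd (k : ℕ) : ∀ᶠ n in Filter.atTop, (p : Acris p C) ^ k ∣ v n

namespace IsVSequence

theorem acrisFrobenius_iterate {v : ℕ → Acris p C} (hv : IsVSequence v) (n : ℕ) :
    (acrisFrobenius p C)^[n] (v n) = (p : Acris p C) ^ n * v 0 := by
  induction n with
  | zero => rw [pow_zero, one_mul, Function.iterate_zero_apply]
  | succ n ih =>
    rw [Function.iterate_succ_apply, hv.acrisFrobenius_succ, acrisFrobenius_iterate_natCast_mul,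
      ih, pow_succ', mul_assoc]

theorem mem_acrisDoublePrime {v : ℕ → Acris p C} (hv : IsVSequence v) :
    v 0 ∈ AcrisDoublePrime p C := by
  refine ⟨v, fun k => ?_, fun n => (hv.acrisFrobenius_iterate n).symm⟩
  simpa only [Ideal.span_singleton_pow, Ideal.mem_span_singleton] using hv.eventually_pow_dvd k

theorem sub {v v' : ℕ → Acris p C} (hv : IsVSequence v) (hv' : IsVSequence v') :
    IsVSequence fun n => v n - v' n where
  acrisFrobenius_succ n := by
    rw [map_sub, hv.acrisFrobenius_succ, hv'.acrisFrobenius_succ, mul_sub]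
  eventually_pow_dvd k := by
    filter_upwards [hv.eventually_pow_dvd k, hv'.eventually_pow_dvd k] with n using dvd_sub

theorem algebraMap_verschiebung_iterate (w : WFlat p C) :
    IsVSequence fun n => algebraMap (WFlat p C) (Acris p C) (WittVector.verschiebung^[n] w) where
  acrisFrobenius_succ n := by
    rw [acrisFrobenius_algebraMap, Function.iterate_succ_apply',
      frobenius_verschiebung_eq_natCast_mul, map_mul, map_natCast]
  eventually_pow_dvd k := by
    filter_upwards [Filter.eventually_ge_atTop k] with n hn
    exact (pow_dvd_pow _ hn).trans (natCast_pow_dvd_algebraMap_verschiebung_iterate n w)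

theorem exists_of_natCast_mul_eq {v : ℕ → Acris p C} (hv : IsVSequence v) {b : Acris p C}
    (hb : (p : Acris p C) * b = acrisFrobenius p C (v 0)) :
    ∃ v' : ℕ → Acris p C, IsVSequence v' ∧ v' 0 = b := by
  refine ⟨fun n => n.casesOn b v, ⟨fun n => ?_, fun k => ?_⟩, rfl⟩
  · cases n with
    | zero => exact hb.symm
    | succ n => exact hv.acrisFrobenius_succ n
  · rw [← Filter.map_add_atTop_eq_nat 1]
    exact hv.eventually_pow_dvd k

end IsVSequence

theorem exists_isVSequence (hFI : Function.Injective (acrisFrobenius p C)) {u : Acris p C}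
    (hu : u ∈ AcrisDoublePrime p C) : ∃ v, IsVSequence v ∧ v 0 = u := by
  obtain ⟨v, hv, huv⟩ := hu
  refine ⟨v, ⟨fun n => hFI.iterate n ?_, fun k => ?_⟩, ?_⟩
  · rw [← Function.iterate_succ_apply, ← huv, acrisFrobenius_iterate_natCast_mul, ← huv, pow_succ',
      mul_assoc]
  · simpa only [Ideal.span_singleton_pow, Ideal.mem_span_singleton] using hv k
  · simpa only [pow_zero, one_mul, Function.iterate_zero_apply] using (huv 0).symm

end Image

section Image

variable {p : ℕ} [Fact p.Prime]

theorem verschiebung_iterate_natCast_mul {R : Type u} [CommRing R] (n k : ℕ)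
    (w : WittVector p R) :
    WittVector.verschiebung^[n] ((k : WittVector p R) * w) =
      k * WittVector.verschiebung^[n] w := by
  rw [← nsmul_eq_mul, ← nsmul_eq_mul, iterate_map_nsmul]

theorem WittVInv.commute_F_V {R : Type u} [CommRing R] [CharP R p] :
    Function.Commute (WittVInv.F p R) (WittVInv.V p R) := fun z => by
  obtain ⟨n, x, rfl⟩ := WittVInv.exists_of z
  rw [WittVInv.V_of, WittVInv.F_of, WittVInv.F_of, WittVInv.V_of,
    WittVector.verschiebung_frobenius_comm x]

variable {C : Type u} [CommRing C] [CharP C p]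

namespace M

theorem IsRep.V_iterate_zero {x : M p C} {m N : ℕ} {w : WFlat p C} (h : M.IsRep x m N w) :
    M.IsRep (M.V^[N] x) m 0 w := by
  rw [M.IsRep, M.V_iterate_apply, h, WittVInv.V_iterate_of]

theorem exists_V_eq {x : M p C} {v : WFlat p C}
    (h : M.IsRep x 0 0 (WittVector.verschiebung v)) : ∃ y, M.V y = x := by
  choose y hy using fun m => WittVInv.V_surjective (x.1 m)
  refine ⟨⟨y, fun m => WittVInv.V_injective ?_, WittVector.map (Ideal.Quotient.mk _) v,
    WittVInv.V_injective ?_⟩, Subtype.ext (funext hy)⟩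
  · rw [transition, ← WittVInv.map_V, hy, hy]
    exact x.2.1 m
  · rw [hy, h, WittVInv.V_of, WittVector.map_verschiebung]

theorem apply_zero_eq_zero_of_forall_exists_V_iterate_eq {x : M p C}
    (h : ∀ n, ∃ y, M.V^[n] y = x) : x.1 0 = 0 := by
  obtain ⟨w, hw⟩ := exists_isRep_zero_zero x
  suffices hmem : w ∈ wittKer p C 0 by rw [hw, RingHom.mem_ker.1 hmem, map_zero]
  refine mem_wittKer.2 fun i => ?_
  obtain ⟨y, rfl⟩ := h (i + 1)
  obtain ⟨v, hv⟩ := exists_isRep_zero_zero y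
  have hwv := map_mk_eq_iff_sub_mem_wittKer.2
    ((hv.V_iterate (i + 1)).iff_sub_mem_wittKer.1 hw)
  have coeff_eq := congrArg (fun z => z.coeff i) hwv
  simp only [WittVector.map_coeff] at coeff_eq
  rwa [WittVector.iterate_verschiebung_coeff_eq_zero _ (Nat.lt_succ_self i), map_zero,
    Ideal.Quotient.eq_zero_iff_mem] at coeff_eq

theorem HasValue.acrisToC_eq [IsAddTorsionFree (Acris p C)] {x : M p C} {a : Acris p C}
    (ha : M.HasValue x a) {w : WFlat p C} (hw : M.IsRep x 0 0 w) :
    acrisToC p C a = theta p C w := by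
  obtain ⟨N, v, hv⟩ := exists_isRep x 1
  have sub_mem := hw.add_right N
  rw [zero_add, hv.zero.iff_sub_mem_wittKer, ← neg_mem_iff, neg_sub] at sub_mem
  obtain ⟨b, hb, hbv⟩ := exists_pow_mul_eq_of_mem_wittKer N sub_mem
  rw [iterate_map_sub, frobenius_iterate_verschiebung_iterate, map_sub, map_mul, map_pow,
    map_natCast, eq_sub_iff_add_eq] at hbv
  have happrox := ha 1 N v hv
  rw [IsApprox, ← hbv, ← mul_add, ← mul_sub] at happrox
  obtain ⟨y, hy⟩ := pow_dvd_of_pow_add_dvd happrox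
  have image_eq := congrArg (acrisToC p C) hy
  rwa [pow_one, map_mul, map_natCast, CharP.cast_eq_zero C p, zero_mul, map_sub, map_add,
    RingHom.mem_ker.1 hb, zero_add, sub_eq_zero, acrisToC_algebraMap] at image_eq

end M

section Canonical

variable {F' : Icris p C → Acris p C} {f : M p C →ₗ[WFlat p C] Acris p C}

namespace IsCanonicalMap

theorem acrisFrobenius_V (hf : IsCanonicalMap F' f) (x : M p C) :
    acrisFrobenius p C (f (M.V x)) = p * f x := by
  rw [← hf.map_F, M.F_V, map_smul, Algebra.smul_def, map_natCast]

variable [IsAddTorsionFree (Acris p C)] (hF : ∀ c, (p : Acris p C) * F' c = acrisFrobenius p C c)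

include hF

theorem isVSequence (hf : IsCanonicalMap F' f) (x : M p C) :
    IsVSequence fun n => f (M.V^[n] x) where
  acrisFrobenius_succ n := by rw [Function.iterate_succ_apply', hf.acrisFrobenius_V]
  eventually_pow_dvd k := by
    obtain ⟨N, w, h⟩ := M.exists_isRep x k
    filter_upwards [Filter.eventually_ge_atTop (N + k)] with n hn
    obtain ⟨d, rfl⟩ := Nat.exists_eq_add_of_le hn
    have happrox := hf.hasValue hF _ _ _ _ (h.V_iterate (k + d)).V_iterate_zero
    rw [IsApprox, zero_add, pow_zero, one_mul, Function.iterate_zero_apply,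
      ← Function.iterate_add_apply, ← add_assoc] at happrox
    exact (dvd_sub_left ((pow_dvd_pow _ (Nat.le_add_right k d)).trans
      (natCast_pow_dvd_algebraMap_verschiebung_iterate (k + d) w))).1 happrox

theorem mem_acrisDoublePrime (hf : IsCanonicalMap F' f) (x : M p C) :
    f x ∈ AcrisDoublePrime p C :=
  (hf.isVSequence hF x).mem_acrisDoublePrime

theorem exists_V_eq_of_apply_eq_zero (hf : IsCanonicalMap F' f) {x : M p C} (hx : f x = 0) :
    ∃ y, M.V y = x ∧ f y = 0 := by
  obtain ⟨w, hw⟩ := M.exists_isRep_zero_zero x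
  have hw₀ : w.coeff 0 ∈ kerNu p C 0 := by
    rw [RingHom.mem_ker, ← theta_apply, ← (hf.hasValue hF x).acrisToC_eq hw, hx, map_zero]
  have isRep_verschiebung : M.IsRep x 0 0 (WittVector.verschiebung (w.shift 1)) := by
    rw [hw.iff_sub_mem_wittKer, ← neg_mem_iff, neg_sub,
      sub_eq_of_eq_add (eq_teichmuller_add_verschiebung_shift w)]
    exact teichmuller_mem_wittKer hw₀
  obtain ⟨y, rfl⟩ := M.exists_V_eq isRep_verschiebung
  refine ⟨y, rfl, mul_left_cancel_prime (p := p) ?_⟩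
  rw [← hf.acrisFrobenius_V, hx, map_zero, mul_zero]

theorem apply_zero_eq_zero_of_apply_eq_zero (hf : IsCanonicalMap F' f) {x : M p C}
    (hx : f x = 0) : x.1 0 = 0 := by
  have exists_V_iterate_eq (n : ℕ) : ∃ y, M.V^[n] y = x ∧ f y = 0 := by
    induction n with
    | zero => exact ⟨x, rfl, hx⟩
    | succ n ih =>
      obtain ⟨y, hy, hfy⟩ := ih
      obtain ⟨z, rfl, hfz⟩ := hf.exists_V_eq_of_apply_eq_zero hF hfy
      exact ⟨z, hy, hfz⟩
  exact M.apply_zero_eq_zero_of_forall_exists_V_iterate_eq fun n =>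
    (exists_V_iterate_eq n).imp fun _ => And.left

-- As `f` commutes with `F`, also `f (F⁻¹ x) = 0` once `F⁻¹ x` is multiplied by a power of `V`, and
-- `F⁻¹ x` vanishes in degree `m` if and only if `x` vanishes in degree `m + 1`.
theorem apply_eq_zero_of_apply_eq_zero (hFI : Function.Injective (acrisFrobenius p C))
    (hf : IsCanonicalMap F' f) {x : M p C} (hx : f x = 0) (m : ℕ) : x.1 m = 0 := by
  induction m generalizing x with
  | zero => exact hf.apply_zero_eq_zero_of_apply_eq_zero hF hx
  | succ m ih =>
    obtain ⟨N, z, hz⟩ := M.exists_apply_eq_V_iterate_rootF x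
    have F_z : M.F z = M.V^[N] x := Subtype.ext <| funext fun i => by
      rw [M.V_iterate_apply, ← M.F_rootF x i, ← WittVInv.commute_F_V.iterate_right N, ← hz]
      rfl
    have f_z : f z = 0 := by
      refine hFI (hFI.iterate N ?_)
      rw [← hf.map_F, F_z, (hf.isVSequence hF x).acrisFrobenius_iterate, map_zero,
        iterate_map_zero]
      exact mul_eq_zero_of_right _ hx
    exact M.apply_succ_eq_zero_of_rootF_eq_zero
      (WittVInv.V_injective.iterate N ((hz m ▸ ih f_z).trans (iterate_map_zero _ _).symm))

theorem injective (hFI : Function.Injective (acrisFrobenius p C)) (hf : IsCanonicalMap F' f) :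
    Function.Injective f :=
  (injective_iff_map_eq_zero _).2 fun _ hx =>
    Subtype.ext (funext (hf.apply_eq_zero_of_apply_eq_zero hF hFI hx))

end IsCanonicalMap

end Canonical

theorem sub_mk_mem_acrisInfty {s : ℕ → Acris p C} {c : ℕ → Perfection C p}
    (hI : ∀ n, s n - algebraMap (WFlat p C) _ (WittVector.teichmuller p (c n)) ∈ Icris p C)
    (hF : ∀ n, (p : Acris p C) * s (n + 1) = acrisFrobenius p C
      (s n - algebraMap (WFlat p C) _ (WittVector.teichmuller p (c n)))) :
    s 0 - algebraMap (WFlat p C) _ (WittVector.mk p c) ∈ AcrisInfty p C := fun j => by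
  have mk_eq := eq_teichmuller_add_verschiebung_shift (WittVector.mk p c)
  induction j generalizing s c with
  | zero =>
    refine ⟨_, ?_, by rw [pow_zero, one_mul, Function.iterate_zero_apply]⟩
    rw [mk_eq, map_add, ← sub_sub]
    exact sub_mem (hI 0) (algebraMap_verschiebung_mem_Icris _)
  | succ j ih =>
    obtain ⟨b, hb, hbs⟩ := ih (s := fun n => s (1 + n)) (c := fun n => c (1 + n))
      (fun n => hI (1 + n)) (fun n => hF (1 + n)) (eq_teichmuller_add_verschiebung_shift _)
    refine ⟨b, hb, ?_⟩
    rw [Function.iterate_succ_apply, mk_eq, map_add, ← sub_sub, map_sub, WittVector.coeff_mk,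
      ← hF, acrisFrobenius_algebraMap, frobenius_verschiebung_eq_natCast_mul, map_mul,
      map_natCast, ← mul_sub, acrisFrobenius_iterate_natCast_mul, pow_succ', mul_assoc, hbs]
    rfl

variable [IsAddTorsionFree (Acris p C)]

namespace IsVSequence

theorem exists_teichmuller (hs : Function.Surjective (Perfection.coeff C p 0))
    {v : ℕ → Acris p C} (hv : IsVSequence v) :
    ∃ (c : Perfection C p) (v' : {v' : ℕ → Acris p C // IsVSequence v'}),
      v 0 - algebraMap (WFlat p C) _ (WittVector.teichmuller p c) ∈ Icris p C ∧
      (p : Acris p C) * v'.1 0 = acrisFrobenius p C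
        (v 0 - algebraMap (WFlat p C) _ (WittVector.teichmuller p c)) := by
  obtain ⟨c, hc⟩ := hs (acrisToC p C (v 0))
  have sub_mem : v 0 - algebraMap (WFlat p C) _ (WittVector.teichmuller p c) ∈ Icris p C := by
    rw [RingHom.mem_ker, map_sub, acrisToC_algebraMap, theta_teichmuller, hc, sub_self]
  obtain ⟨b, hb⟩ := natCast_dvd_acrisFrobenius sub_mem
  obtain ⟨v', hv', rfl⟩ :=
    (hv.sub (algebraMap_verschiebung_iterate (WittVector.teichmuller p c))).exists_of_natCast_mul_eq
      hb.symm
  exact ⟨c, ⟨v', hv'⟩, sub_mem, hb.symm⟩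

theorem exists_sub_mem_acrisInfty (hs : Function.Surjective (Perfection.coeff C p 0))
    {v : ℕ → Acris p C} (hv : IsVSequence v) :
    ∃ w : WFlat p C, v 0 - algebraMap (WFlat p C) (Acris p C) w ∈ AcrisInfty p C := by
  choose c next hI hF using
    fun v : {v : ℕ → Acris p C // IsVSequence v} => v.2.exists_teichmuller hs
  refine ⟨WittVector.mk p fun n => c (next^[n] ⟨v, hv⟩),
    sub_mk_mem_acrisInfty (s := fun n => (next^[n] ⟨v, hv⟩).1 0) (fun n => hI _) fun n => ?_⟩
  rw [Function.iterate_succ_apply']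
  exact hF _

theorem exists_pow_mul_eq {v : ℕ → Acris p C} (hv : IsVSequence v) {r N : ℕ}
    (h : ∀ n, N ≤ n → (p : Acris p C) ^ r ∣ v n) :
    ∃ y : ℕ → Acris p C, IsVSequence y ∧ ∀ n, (p : Acris p C) ^ r * y n = v (N + n) := by
  choose y hy using fun n => h (N + n) (Nat.le_add_right N n)
  refine ⟨y, ⟨fun n => pow_mul_left_cancel (p := p) r ?_, fun k => ?_⟩, fun n => (hy n).symm⟩
  · rw [mul_left_comm, ← hy, ← hv.acrisFrobenius_succ, add_assoc, hy, map_mul, map_pow,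
      map_natCast]
  · obtain ⟨L, hL⟩ := Filter.eventually_atTop.1 (hv.eventually_pow_dvd (r + k))
    filter_upwards [Filter.eventually_ge_atTop L] with n hn
    exact pow_dvd_of_pow_add_dvd (hy n ▸ hL (N + n) (by omega))

omit [IsAddTorsionFree (Acris p C)] in
theorem exists_pow_dvd_of_sum_le {v : ℕ → Acris p C} (hv : IsVSequence v) :
    ∃ d : ℕ → ℕ, ∀ r n, ∑ i ∈ Finset.range r, d i ≤ n → (p : Acris p C) ^ r ∣ v n := by
  choose ψ hψ using fun k => Filter.eventually_atTop.1 (hv.eventually_pow_dvd k)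
  refine ⟨fun i => ψ (i + 1), fun r n hn => ?_⟩
  cases r with
  | zero => rw [pow_zero]; exact one_dvd _
  | succ r =>
    rw [Finset.sum_range_succ] at hn
    exact hψ _ _ (by omega)

omit [IsAddTorsionFree (Acris p C)] in
theorem isApprox {v : ℕ → Acris p C} (hv : IsVSequence v) {r N : ℕ} {y : Acris p C}
    (hy : (p : Acris p C) ^ r * y = v N) {w : WFlat p C}
    (hw : y - algebraMap (WFlat p C) (Acris p C) w ∈ AcrisInfty p C) :
    IsApprox (v 0) r N ((p : WFlat p C) ^ r * w) := by
  obtain ⟨b, -, hb⟩ := hw N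
  refine ⟨b, ?_⟩
  rw [← hv.acrisFrobenius_iterate, ← hy, ← acrisFrobenius_iterate_algebraMap, ← iterate_map_sub,
    map_mul, map_pow, map_natCast, ← mul_sub, ← Nat.cast_pow,
    acrisFrobenius_iterate_natCast_mul, ← hb]
  push_cast
  ring

section

variable (hI : ∀ a : Acris p C, (p : Acris p C) ∣ acrisFrobenius p C a → a ∈ Icris p C)

include hI

omit [IsAddTorsionFree (Acris p C)] in
theorem mem_acrisInfty {v : ℕ → Acris p C} (hv : IsVSequence v) (h : v 0 ∈ AcrisInfty p C)
    (n : ℕ) : v n ∈ AcrisInfty p C := by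
  induction n with
  | zero => exact h
  | succ n ih =>
    exact mem_acrisInfty_of_acrisFrobenius_eq (hI _ ⟨_, hv.acrisFrobenius_succ n⟩)
      (hv.acrisFrobenius_succ n) ih

theorem natCast_mul_sub_mem_wittKer {y : ℕ → Acris p C} (hy : IsVSequence y) {d : ℕ}
    {b : Acris p C} (hb : (p : Acris p C) * b = y d) {w w' : WFlat p C}
    (hw : y 0 - algebraMap (WFlat p C) (Acris p C) w ∈ AcrisInfty p C)
    (hw' : b - algebraMap (WFlat p C) (Acris p C) w' ∈ AcrisInfty p C) :
    (p : WFlat p C) * w' - WittVector.verschiebung^[d] w ∈ wittKer p C 0 := by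
  have sub_mem_left := (hy.sub (algebraMap_verschiebung_iterate w)).mem_acrisInfty hI hw d
  have sub_mem_right := nsmul_mem hw' p
  rw [nsmul_eq_mul, mul_sub, hb] at sub_mem_right
  refine mem_wittKer_of_algebraMap_mem_acrisInfty ?_
  rw [map_sub, map_mul, map_natCast, ← sub_sub_sub_cancel_left _ _ (y d)]
  exact sub_mem sub_mem_left sub_mem_right

theorem exists_hasValue (hs : Function.Surjective (Perfection.coeff C p 0))
    {v : ℕ → Acris p C} (hv : IsVSequence v) : ∃ x, M.HasValue x (v 0) := by
  obtain ⟨d, hd⟩ := hv.exists_pow_dvd_of_sum_le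
  choose y hy hyv using fun r => hv.exists_pow_mul_eq (hd r)
  choose w hw using fun r => (hy r).exists_sub_mem_acrisInfty hs
  have hp (r : ℕ) : (p : Acris p C) * y (r + 1) 0 = y r (d r) :=
    pow_mul_left_cancel (p := p) r <| by
      rw [hyv, ← Finset.sum_range_succ, ← mul_assoc, ← pow_succ, hyv, add_zero]
  obtain ⟨x, hx⟩ := M.exists_forall_isRep (fun r => ∑ i ∈ Finset.range r, d i)
    (fun r => (p : WFlat p C) ^ r * w r) rfl fun r => by
      refine ⟨d r, Finset.sum_range_succ _ _, ?_⟩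
      have hmem := pow_mul_mem_wittKer (natCast_mul_sub_mem_wittKer hI (hy r) (hp r) (hw r)
        (hw (r + 1))) r
      have hcomm := verschiebung_iterate_natCast_mul (d r) (p ^ r) (w r)
      rw [Nat.cast_pow] at hcomm
      rwa [zero_add, mul_sub, ← hcomm, ← mul_assoc, ← pow_succ] at hmem
  exact ⟨x, M.hasValue_of_forall_exists fun r => ⟨_, _, hx r, hv.isApprox (hyv r 0) (hw r)⟩⟩

end

end IsVSequence

theorem IsCanonicalMap.range_eq {F' : Icris p C → Acris p C}
    {f : M p C →ₗ[WFlat p C] Acris p C}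
    (hF : ∀ c, (p : Acris p C) * F' c = acrisFrobenius p C c)
    (hFI : Function.Injective (acrisFrobenius p C))
    (hI : ∀ a : Acris p C, (p : Acris p C) ∣ acrisFrobenius p C a → a ∈ Icris p C)
    (hs : Function.Surjective (Perfection.coeff C p 0)) (hf : IsCanonicalMap F' f) :
    Set.range f = AcrisDoublePrime p C := by
  refine (Set.range_subset_iff.2 (hf.mem_acrisDoublePrime hF)).antisymm fun u hu => ?_
  obtain ⟨v, hv, rfl⟩ := exists_isVSequence hFI hu
  obtain ⟨x, hx⟩ := hv.exists_hasValue hI hs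
  exact ⟨x, (hf.hasValue hF x).unique hx⟩

end Image

/-! ### Exponents and factorial weights -/

section Exponents

variable {p : ℕ} [Fact p.Prime]

namespace Exponent

/-- The integral part of an element of `ℤ_+[1/p]`. -/
def floor (a : Exponent p) : ℕ := ⌊(a : ℚ)⌋₊

/-- The inclusion of `ℕ` into `ℤ_+[1/p]`. -/
def ofNat : ℕ →+ Exponent p where
  toFun k := ⟨k, k, 0, by rw [pow_zero, div_one]⟩
  map_zero' := Subtype.ext Nat.cast_zero
  map_add' k l := Subtype.ext (Nat.cast_add k l)

omit [Fact p.Prime] in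
theorem floor_div_pow (m k : ℕ) : ⌊(m : ℚ) / (p : ℚ) ^ k⌋₊ = m / p ^ k := by
  rw [← Nat.cast_pow, Nat.floor_div_eq_div]

/-- The fractional part of an element of `ℤ_+[1/p]`. -/
def frac (a : Exponent p) : Exponent p := ⟨a - floor a, by
  obtain ⟨_, m, k, rfl⟩ := a
  have hp : (p : ℚ) ^ k ≠ 0 := pow_ne_zero _ (by exact_mod_cast (Fact.out : p.Prime).ne_zero)
  refine ⟨m % p ^ k, k, ?_⟩
  rw [floor, floor_div_pow, eq_div_iff hp, sub_mul, div_mul_cancel₀ _ hp, sub_eq_iff_eq_add]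
  exact_mod_cast (Nat.mod_add_div' m (p ^ k)).symm⟩

theorem frac_add_floor (a : Exponent p) : frac a + ofNat (floor a) = a :=
  Subtype.ext (sub_add_cancel _ _)

theorem floor_add_ofNat (a : Exponent p) (k : ℕ) : floor (a + ofNat k) = floor a + k :=
  Nat.floor_add_natCast (Exponent.nonneg p a) k

theorem floor_ofNat (k : ℕ) : floor (ofNat k : Exponent p) = k := Nat.floor_natCast k

theorem floor_zero : floor (0 : Exponent p) = 0 := Nat.floor_zero

theorem frac_add_ofNat (a : Exponent p) (k : ℕ) : frac (a + ofNat k) = frac a := by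
  refine Subtype.ext ?_
  change ((a : ℚ) + k) - floor (a + ofNat k) = a - floor a
  rw [floor_add_ofNat, Nat.cast_add, add_sub_add_right_eq_sub]

theorem frac_ofNat (k : ℕ) : frac (ofNat k : Exponent p) = 0 := by
  have frac_eq := frac_add_floor (ofNat k : Exponent p)
  rwa [floor_ofNat, add_eq_right] at frac_eq

theorem ofNat_eq_nsmul (k : ℕ) : (ofNat k : Exponent p) = k • ofNat 1 := by
  rw [← map_nsmul, smul_eq_mul, mul_one]

theorem floor_add_floor_le (a b : Exponent p) : floor a + floor b ≤ floor (a + b) :=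
  Nat.le_floor (by
    rw [Nat.cast_add]
    exact add_le_add (Nat.floor_le (Exponent.nonneg p a)) (Nat.floor_le (Exponent.nonneg p b)))

theorem floor_nsmul_lt {a : Exponent p} (ha : floor a = 0) : floor (p • a) < p := by
  have p_pos : (0 : ℚ) < p := by exact_mod_cast (Fact.out : p.Prime).pos
  rw [floor, Nat.floor_lt (Exponent.nonneg p _), AddSubmonoidClass.coe_nsmul, nsmul_eq_mul]
  exact mul_lt_of_lt_one_right p_pos (Nat.floor_eq_zero.1 ha)

theorem nsmul_bijective : Function.Bijective (nsmulAddMonoidHom p : Exponent p →+ Exponent p) := by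
  have hp : (p : ℚ) ≠ 0 := by exact_mod_cast (Fact.out : p.Prime).ne_zero
  have coe_nsmul (a : Exponent p) : ((nsmulAddMonoidHom p a : Exponent p) : ℚ) = p * a := by
    rw [nsmulAddMonoidHom_apply, AddSubmonoidClass.coe_nsmul, nsmul_eq_mul]
  refine ⟨fun a b hab => Subtype.ext (mul_left_cancel₀ hp ?_), ?_⟩
  · rw [← coe_nsmul, ← coe_nsmul, hab]
  · rintro ⟨_, m, k, rfl⟩
    refine ⟨⟨m / p ^ (k + 1), m, k + 1, rfl⟩, Subtype.ext ((coe_nsmul _).trans ?_)⟩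
    change (p : ℚ) * (m / p ^ (k + 1)) = m / p ^ k
    rw [pow_succ', ← mul_div_assoc, mul_div_mul_left _ _ hp]

variable (p) in
/-- Multiplication by `p` on multi-exponents: the effect on monomials of the Frobenius of
`B[x_1 ^ (p ^ (-∞)), …, x_n ^ (p ^ (-∞))]`. -/
def piNsmulEquiv (n : ℕ) : (Fin n → Exponent p) ≃+ (Fin n → Exponent p) :=
  AddEquiv.piCongrRight fun _ =>
    AddEquiv.ofBijective (nsmulAddMonoidHom p) nsmul_bijective

variable {n : ℕ}

theorem piNsmulEquiv_apply (α : Fin n → Exponent p) : piNsmulEquiv p n α = p • α := rfl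

theorem nsmul_piNsmulEquiv_symm (α : Fin n → Exponent p) :
    p • (piNsmulEquiv p n).symm α = α :=
  (piNsmulEquiv p n).apply_symm_apply α

theorem nsmul_pi_injective : Function.Injective fun α : Fin n → Exponent p => p • α :=
  (piNsmulEquiv p n).injective

theorem nsmul_single_one (i : Fin n) (m : ℕ) :
    m • Pi.single i (ofNat 1 : Exponent p) = (Pi.single i (ofNat m) : Fin n → Exponent p) := by
  rw [← Pi.single_smul, ← ofNat_eq_nsmul]

end Exponent

variable {n : ℕ}

/-- The product of the factorials of the integral parts of the exponents: the denominator of the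
divided power of the monomial `x ^ α`. -/
def weight (α : Fin n → Exponent p) : ℕ := ∏ i, (Exponent.floor (α i)).factorial

theorem weight_ne_zero (α : Fin n → Exponent p) : weight α ≠ 0 :=
  Finset.prod_ne_zero_iff.2 fun _ _ => Nat.factorial_ne_zero _

theorem weight_mul_weight_dvd (α β : Fin n → Exponent p) :
    weight α * weight β ∣ weight (α + β) := by
  rw [weight, weight, ← Finset.prod_mul_distrib]
  exact Finset.prod_dvd_prod_of_dvd _ _ fun i _ =>
    (Nat.factorial_mul_factorial_dvd_factorial_add _ _).trans
      (Nat.factorial_dvd_factorial (Exponent.floor_add_floor_le _ _))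

theorem weight_single (i : Fin n) (a : Exponent p) :
    weight (Pi.single i a) = (Exponent.floor a).factorial := by
  refine (Finset.prod_eq_single i (fun j _ hj => ?_) fun h => absurd (Finset.mem_univ i) h).trans
    (by rw [Pi.single_eq_same])
  rw [Pi.single_eq_of_ne hj, Exponent.floor_zero, Nat.factorial_zero]

theorem weight_eq_one {α : Fin n → Exponent p} (h : ∀ i, Exponent.floor (α i) = 0) :
    weight α = 1 :=
  Finset.prod_eq_one fun i _ => by rw [h i, Nat.factorial_zero]

theorem weight_zero : weight (0 : Fin n → Exponent p) = 1 :=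
  weight_eq_one fun _ => Exponent.floor_zero

theorem not_dvd_weight_nsmul {α : Fin n → Exponent p} (h : ∀ i, Exponent.floor (α i) = 0) :
    ¬ p ∣ weight (p • α) := by
  rw [weight, (Fact.out : p.Prime).prime.dvd_finsetProd_iff]
  rintro ⟨i, -, hi⟩
  exact (Exponent.floor_nsmul_lt (h i)).not_ge ((Fact.out : p.Prime).dvd_factorial.1 hi)

/-- The integer `weight (p • α) / weight α`, by which Frobenius multiplies the divided power of
the monomial `x ^ α`. The division is exact. -/
def weightRatio (α : Fin n → Exponent p) : ℕ := weight (p • α) / weight α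

theorem weight_mul_weightRatio (α : Fin n → Exponent p) :
    weight α * weightRatio α = weight (p • α) := by
  refine Nat.mul_div_cancel' ?_
  have nsmul_eq : p • α = α + (p - 1) • α := by
    rw [← succ_nsmul', Nat.sub_add_cancel (Fact.out : p.Prime).one_le]
  rw [nsmul_eq]
  exact (dvd_mul_right _ _).trans (weight_mul_weight_dvd _ _)

theorem weightRatio_ne_zero (α : Fin n → Exponent p) : weightRatio α ≠ 0 := fun h =>
  weight_ne_zero (p • α) (by rw [← weight_mul_weightRatio, h, mul_zero])

theorem not_dvd_weightRatio {α : Fin n → Exponent p} (h : ∀ i, Exponent.floor (α i) = 0) :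
    ¬ p ∣ weightRatio α := by
  rw [← one_mul (weightRatio α), ← weight_eq_one h, weight_mul_weightRatio]
  exact not_dvd_weight_nsmul h

end Exponents

/-! ### The perfect ring `B[x_1 ^ (p ^ (-∞)), …, x_n ^ (p ^ (-∞))]` -/

namespace PerfectPolynomial

variable (p : ℕ) [Fact p.Prime] (B : Type u) [CommRing B] [CharP B p] (n : ℕ)

instance : CharP (PerfectPolynomial p B n) p :=
  charP_of_injective_algebraMap (FaithfulSMul.algebraMap_injective B (PerfectPolynomial p B n)) p

/-- The Frobenius automorphism, built from the Frobenius of `B` and multiplication of the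
exponents by `p`. -/
def frobeniusRingEquiv [PerfectRing B p] : PerfectPolynomial p B n ≃+* PerfectPolynomial p B n :=
  (AddMonoidAlgebra.mapRingEquiv _ (frobeniusEquiv B p)).trans
    (AddMonoidAlgebra.mapDomainRingEquiv B (Exponent.piNsmulEquiv p n))

variable {B n}

theorem frobenius_single (α : Fin n → Exponent p) (b : B) :
    frobenius (PerfectPolynomial p B n) p (AddMonoidAlgebra.single α b) =
      AddMonoidAlgebra.single (p • α) (frobenius B p b) := by
  rw [frobenius_def, frobenius_def, AddMonoidAlgebra.single_pow]

variable [PerfectRing B p]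

theorem frobeniusRingEquiv_single (α : Fin n → Exponent p) (b : B) :
    frobeniusRingEquiv p B n (AddMonoidAlgebra.single α b) =
      AddMonoidAlgebra.single (p • α) (frobenius B p b) := by
  rw [frobeniusRingEquiv, RingEquiv.trans_apply, AddMonoidAlgebra.mapRingEquiv_single,
    AddMonoidAlgebra.mapDomainRingEquiv_single, Exponent.piNsmulEquiv_apply, frobeniusEquiv_apply]

instance : PerfectRing (PerfectPolynomial p B n) p where
  bijective_frobenius := by
    have frobenius_eq : frobenius (PerfectPolynomial p B n) p = frobeniusRingEquiv p B n :=
      AddMonoidAlgebra.ringHom_ext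
        (fun b => (frobenius_single p 0 b).trans (frobeniusRingEquiv_single p 0 b).symm)
        (fun α => (frobenius_single p α 1).trans (frobeniusRingEquiv_single p α 1).symm)
    change Function.Bijective (frobenius (PerfectPolynomial p B n) p)
    rw [frobenius_eq]
    exact (frobeniusRingEquiv p B n).bijective

theorem frobeniusEquiv_symm_single (α : Fin n → Exponent p) (b : B) :
    (frobeniusEquiv (PerfectPolynomial p B n) p).symm (AddMonoidAlgebra.single α b) =
      AddMonoidAlgebra.single ((Exponent.piNsmulEquiv p n).symm α)
        ((frobeniusEquiv B p).symm b) := by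
  rw [RingEquiv.symm_apply_eq, frobeniusEquiv_apply, frobenius_single,
    Exponent.nsmul_piNsmulEquiv_symm, frobenius_apply_frobeniusEquiv_symm]

theorem frobeniusEquiv_symm_iterate_single (m : ℕ) (α : Fin n → Exponent p) (b : B) :
    (frobeniusEquiv (PerfectPolynomial p B n) p).symm^[m] (AddMonoidAlgebra.single α b) =
      AddMonoidAlgebra.single ((Exponent.piNsmulEquiv p n).symm^[m] α)
        ((frobeniusEquiv B p).symm^[m] b) := by
  induction m with
  | zero => rfl
  | succ m ih => simp only [Function.iterate_succ_apply', ih, frobeniusEquiv_symm_single]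

end PerfectPolynomial

/-! ### Divided power polynomials -/

section Combination

variable {ι R A A' : Type*} [CommRing R] [CommRing A] [CommRing A']

/-- The linear combination `∑ g (l i) * e i` of the elements `e i` with coefficients in `R`. Here
`R` acts on `A` through an arbitrary ring homomorphism `g`, so that `A` need not be registered as
an `R`-algebra. -/
def combination (g : R →+* A) (e : ι → A) : (ι →₀ R) →+ A :=
  Finsupp.liftAddHom fun i => (AddMonoidHom.mulRight (e i)).comp g.toAddMonoidHom

theorem combination_apply (g : R →+* A) (e : ι → A) (l : ι →₀ R) :
    combination g e l = l.sum fun i c => g c * e i := rfl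

theorem combination_single (g : R →+* A) (e : ι → A) (i : ι) (c : R) :
    combination g e (Finsupp.single i c) = g c * e i :=
  Finsupp.liftAddHom_apply_single _ _ _

theorem map_combination (φ : A →+* A') (g : R →+* A) (e : ι → A) (l : ι →₀ R) :
    φ (combination g e l) = combination (φ.comp g) (fun i => φ (e i)) l := by
  simp only [combination_apply, map_finsuppSum, map_mul, RingHom.comp_apply]

theorem combination_mem (g : R →+* A) (e : ι → A) (J : Ideal A) {l : ι →₀ R}
    (h : ∀ i, g (l i) * e i ∈ J) : combination g e l ∈ J :=
  sum_mem fun i _ => h i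

end Combination

section PDPoly

variable (p : ℕ) [Fact p.Prime] (R : Type u) [CommRing R] (n : ℕ)

/-- The ring of divided power polynomials over `R`: the subring of all `∑ c_α x ^ α` over the total
ring of fractions of `R` such that `weight α * c_α` is in `R` for all `α`. -/
def pdSubring : Subring (AddMonoidAlgebra (FractionRing R) (Fin n → Exponent p)) where
  carrier := {g | ∀ α, (weight α : FractionRing R) * g.coeff α ∈
    (algebraMap R (FractionRing R)).range}
  mul_mem' {f g} hf hg α := by
    classical
    rw [AddMonoidAlgebra.coeff_mul, Finsupp.sum, Finset.mul_sum]
    refine sum_mem fun β _ => ?_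
    rw [Finsupp.sum, Finset.mul_sum]
    refine sum_mem fun γ _ => ?_
    split_ifs with h
    · subst h
      obtain ⟨m, hm⟩ := weight_mul_weight_dvd β γ
      have weight_mul : (weight (β + γ) : FractionRing R) * (f.coeff β * g.coeff γ) =
          m * ((weight β * f.coeff β) * (weight γ * g.coeff γ)) := by
        rw [hm]
        push_cast
        ring
      rw [weight_mul]
      exact mul_mem (natCast_mem _ m) (mul_mem (hf β) (hg γ))
    · rw [mul_zero]
      exact zero_mem _
  one_mem' α := by
    classical
    rw [AddMonoidAlgebra.one_def, AddMonoidAlgebra.coeff_single, Finsupp.single_apply, mul_ite,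
      mul_one, mul_zero]
    split_ifs
    · exact natCast_mem _ _
    · exact zero_mem _
  add_mem' {f g} hf hg α := by
    rw [AddMonoidAlgebra.coeff_add, Finsupp.add_apply, mul_add]
    exact add_mem (hf α) (hg α)
  zero_mem' α := by
    rw [AddMonoidAlgebra.coeff_zero, Finsupp.zero_apply, mul_zero]
    exact zero_mem _
  neg_mem' {f} hf α := by
    rw [AddMonoidAlgebra.coeff_neg, Finsupp.neg_apply, mul_neg]
    exact neg_mem (hf α)

/-- The ring of divided power polynomials over `R`, as a type. -/
abbrev PDPoly : Type u := pdSubring p R n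

namespace PDPoly

variable {n}

theorem single_mem_pdSubring {α : Fin n → Exponent p} {c : FractionRing R}
    (h : (weight α : FractionRing R) * c ∈ (algebraMap R (FractionRing R)).range) :
    AddMonoidAlgebra.single α c ∈ pdSubring p R n := by
  classical
  intro β
  rw [AddMonoidAlgebra.coeff_single, Finsupp.single_apply, mul_ite, mul_zero]
  split_ifs with hβ
  · rwa [← hβ]
  · exact zero_mem _

/-- The homomorphism `α ↦ x ^ α`. -/
def monomial : Multiplicative (Fin n → Exponent p) →* PDPoly p R n where
  toFun α := ⟨AddMonoidAlgebra.single α.toAdd 1, single_mem_pdSubring p R (by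
    rw [mul_one]
    exact natCast_mem _ _)⟩
  map_one' := rfl
  map_mul' α β := Subtype.ext (by
    rw [toAdd_mul, Subring.coe_mul, AddMonoidAlgebra.single_mul_single, one_mul])

/-- The inclusion of `R` as the constant divided power polynomials. -/
def const : R →+* PDPoly p R n :=
  (AddMonoidAlgebra.singleZeroRingHom.comp (algebraMap R (FractionRing R))).codRestrict
    (pdSubring p R n) fun c => single_mem_pdSubring p R (by
      rw [weight_zero, Nat.cast_one, one_mul]
      exact ⟨c, rfl⟩)

variable {p R} in
theorem coeff_natCast_mul (m : ℕ) (g : PDPoly p R n) (α : Fin n → Exponent p) :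
    ((m : PDPoly p R n) * g).1.coeff α = m * g.1.coeff α := by
  rw [← nsmul_eq_mul, ← nsmul_eq_mul]
  rfl

variable [IsAddTorsionFree R]

omit [Fact p.Prime] in
theorem isUnit_natCast_fractionRing {m : ℕ} (hm : m ≠ 0) : IsUnit (m : FractionRing R) := by
  have mem_nonZeroDivisors : (m : R) ∈ nonZeroDivisors R :=
    mem_nonZeroDivisors_iff_right.2 fun a ha =>
      natCast_mul_left_cancel hm (by rw [mul_comm, ha, mul_zero])
  simpa only [map_natCast] using
    IsLocalization.map_units (FractionRing R) ⟨_, mem_nonZeroDivisors⟩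

instance : IsAddTorsionFree (PDPoly p R n) where
  nsmul_right_injective m hm f g hfg := by
    refine Subtype.ext (AddMonoidAlgebra.ext (Finsupp.ext fun α => ?_))
    refine (isUnit_natCast_fractionRing R hm).mul_left_cancel ?_
    rw [← coeff_natCast_mul, ← coeff_natCast_mul, ← nsmul_eq_mul, ← nsmul_eq_mul]
    exact congrArg (fun h : PDPoly p R n => h.1.coeff α) hfg

/-- The divided power `x ^ α / weight α` of a monomial. -/
def dpMonomial (α : Fin n → Exponent p) : PDPoly p R n :=
  ⟨AddMonoidAlgebra.single α (Ring.inverse (weight α : FractionRing R)),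
    single_mem_pdSubring p R (by
      rw [Ring.mul_inverse_cancel _ (isUnit_natCast_fractionRing R (weight_ne_zero α))]
      exact one_mem _)⟩

theorem weight_mul_dpMonomial (α : Fin n → Exponent p) :
    (weight α : PDPoly p R n) * dpMonomial p R α = monomial p R (.ofAdd α) := by
  refine Subtype.ext ?_
  change (weight α : AddMonoidAlgebra (FractionRing R) (Fin n → Exponent p)) *
    AddMonoidAlgebra.single α _ = AddMonoidAlgebra.single α 1
  rw [AddMonoidAlgebra.natCast_def, AddMonoidAlgebra.single_mul_single, zero_add,
    Ring.mul_inverse_cancel _ (isUnit_natCast_fractionRing R (weight_ne_zero α))]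

theorem monomial_single_pow (i : Fin n) (m : ℕ) :
    monomial p R (.ofAdd (Pi.single i (Exponent.ofNat 1))) ^ m =
      (m.factorial : PDPoly p R n) * dpMonomial p R (Pi.single i (Exponent.ofNat m)) := by
  have weight_mul := weight_mul_dpMonomial p R (n := n) (Pi.single i (Exponent.ofNat m))
  rw [weight_single, Exponent.floor_ofNat] at weight_mul
  rw [weight_mul, ← map_pow, ← ofAdd_nsmul, Exponent.nsmul_single_one]

variable {p R}

theorem weight_mul_coeff_combination (l : (Fin n → Exponent p) →₀ R) (α : Fin n → Exponent p) :
    (weight α : FractionRing R) * (combination (const p R) (dpMonomial p R) l).1.coeff α =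
      algebraMap _ _ (l α) := by
  classical
  induction l using Finsupp.induction_linear with
  | zero => rw [map_zero, Finsupp.zero_apply, map_zero]; exact mul_zero _
  | add l l' hl hl' =>
    rw [map_add, Finsupp.add_apply, map_add, ← hl, ← hl', ← mul_add]
    rfl
  | single β c =>
    have coeff_eq : (const p R c * dpMonomial p R β).1 = AddMonoidAlgebra.single β
        (algebraMap R (FractionRing R) c * Ring.inverse (weight β : FractionRing R)) :=
      (AddMonoidAlgebra.single_mul_single ..).trans (by rw [zero_add])
    rw [combination_single, coeff_eq, AddMonoidAlgebra.coeff_single, Finsupp.single_apply,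
      Finsupp.single_apply]
    split_ifs with h
    · rw [h, mul_left_comm, Ring.mul_inverse_cancel _
        (isUnit_natCast_fractionRing R (weight_ne_zero α)), mul_one]
    · rw [mul_zero, map_zero]

theorem natCast_dvd_of_dvd_combination {m : ℕ} {l : (Fin n → Exponent p) →₀ R}
    (h : (m : PDPoly p R n) ∣ combination (const p R) (dpMonomial p R) l)
    (α : Fin n → Exponent p) : (m : R) ∣ l α := by
  obtain ⟨g, hg⟩ := h
  obtain ⟨c, hc⟩ := g.2 α
  refine ⟨c, IsFractionRing.injective R (FractionRing R) ?_⟩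
  rw [map_mul, map_natCast, hc, ← weight_mul_coeff_combination, hg, coeff_natCast_mul,
    mul_left_comm]

end PDPoly

end PDPoly

/-! ### Homomorphisms out of the divided power hull -/

section WittVectorsOfPerfectRings

variable {p : ℕ} [Fact p.Prime] {R : Type*} [CommRing R] [CharP R p] [PerfectRing R p]

instance : IsAddTorsionFree (WittVector p R) :=
  isAddTorsionFree_of_isAdicComplete p fun w hw => by
    rw [natCast_mul_eq_verschiebung_frobenius] at hw
    refine (WittVector.frobenius_bijective p R).1 (WittVector.verschiebung_injective p R ?_)
    rw [hw, map_zero, map_zero]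

theorem exists_ringHom_coeff_zero_eq {T : Type*} [CommRing T] (g : WittVector p R →+* T)
    (hp : (p : T) = 0) : ∃ f : R →+* T, ∀ w : WittVector p R, f (w.coeff 0) = g w := by
  have ker_le : RingHom.ker (WittVector.constantCoeff : WittVector p R →+* R) ≤
      RingHom.ker g := by
    intro w hw
    obtain ⟨v, rfl⟩ := (natCast_dvd_iff_coeff_zero_eq_zero w).2 hw
    rw [RingHom.mem_ker, map_mul, map_natCast, hp, zero_mul]
  have rightInverse : Function.RightInverse (WittVector.teichmuller p)
      (WittVector.constantCoeff : WittVector p R →+* R) :=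
    WittVector.teichmuller_coeff_zero p
  exact ⟨RingHom.liftOfRightInverse _ _ rightInverse ⟨g, ker_le⟩, fun w =>
    RingHom.liftOfRightInverse_comp_apply _ _ rightInverse ⟨g, ker_le⟩ w⟩

theorem ringHom_eq_of_apply_teichmuller_eq {S : Type*} [CommRing S]
    [IsHausdorff (Ideal.span {(p : S)}) S] (f g : WittVector p R →+* S)
    (h : ∀ x, f (WittVector.teichmuller p x) = g (WittVector.teichmuller p x)) : f = g := by
  refine RingHom.ext fun w => sub_eq_zero.1 (eq_zero_of_forall_pow_dvd (a := (p : S)) fun k => ?_)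
  rw [← Ideal.mem_span_singleton, ← Ideal.Quotient.eq]
  refine DFunLike.congr_fun (WittVector.eq_of_apply_teichmuller_eq
    ((Ideal.Quotient.mk (Ideal.span {(p : S) ^ k})).comp f)
    ((Ideal.Quotient.mk _).comp g) ⟨k, ?_⟩ fun x => ?_) w
  · rw [← map_natCast (Ideal.Quotient.mk _), ← map_pow, Ideal.Quotient.eq_zero_iff_mem]
    exact Ideal.mem_span_singleton_self _
  · rw [RingHom.comp_apply, RingHom.comp_apply, h]

end WittVectorsOfPerfectRings

theorem untilt_eq {O : Type*} [CommRing O] {p : ℕ} [Fact p.Prime] [Fact ¬IsUnit (p : O)]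
    [IsAdicComplete (Ideal.span {(p : O)}) O] (t : PreTilt O p) (y : ℕ → O)
    (hy : ∀ m, y (m + 1) ^ p = y m)
    (h : ∀ m, PreTilt.coeff m t = Ideal.Quotient.mk (Ideal.span {(p : O)}) (y m)) :
    PreTilt.untilt t = y 0 := by
  have pow_eq (m : ℕ) : y m ^ p ^ m = y 0 := by
    induction m with
    | zero => rw [pow_zero, pow_one]
    | succ m ih => rw [pow_succ', pow_mul, hy, ih]
  refine sub_eq_zero.1 (eq_zero_of_forall_pow_dvd (a := (p : O)) fun m => ?_)
  refine (pow_dvd_pow _ m.le_succ).trans ?_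
  rw [← pow_eq m, ← PreTilt.untilt_iterate_frobeniusEquiv_symm_pow t m]
  refine dvd_sub_pow_of_dvd_sub ?_ m
  rw [← Ideal.mem_span_singleton, ← Ideal.Quotient.eq, PreTilt.mk_untilt_eq_coeff_zero,
    PreTilt.coeff_iterate_frobeniusEquiv_symm, zero_add, h]

theorem PDHull.exists_lift {p : ℕ} [Fact p.Prime] {R S : Type u} [CommRing R] [CommRing S]
    [IsAddTorsionFree S] {I : Ideal R} (g : R →+* S) (hg : ∀ x ∈ I, g x ∈ factorialIdeal ⊤) :
    ∃ φ : PDHull p I →+* S, ∀ r, φ (algebraMap R _ r) = g r := by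
  obtain ⟨γ⟩ := exists_dividedPowers_of_isAddTorsionFree (I := factorialIdeal (⊤ : Ideal S))
    fun x hx n hn => by
      obtain ⟨y, -, hy⟩ := mem_factorialIdeal.1 hx n
      exact ⟨y, mem_factorialIdeal_of_factorial_mul_eq_pow hn hx hy, hy⟩
  have hgI (x : I) : g x ∈ factorialIdeal (⊤ : Ideal S) := hg x x.2
  refine ⟨PDHull.lift g (fun m x => γ.dpow m (g x)) ?_ ?_ ?_ ?_ ?_ ?_,
    fun r => PDHull.lift_algebraMap ..⟩
  · exact fun x => γ.dpow_zero (hgI x)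
  · intro r m x
    rw [Submodule.coe_smul, smul_eq_mul, map_mul, γ.dpow_mul (hgI x)]
  · exact fun m k x => γ.mul_dpow (hgI x)
  · intro m x y
    rw [Submodule.coe_add, map_add, γ.dpow_add (hgI x) (hgI y)]
  · exact fun x => γ.dpow_one (hgI x)
  · intro x hx m
    have exponent_le : padicValNat p m.factorial ≤ m := by
      rcases eq_or_ne m 0 with rfl | hm
      · simp
      · exact (padicValNat_factorial_lt_of_ne_zero (p := p) hm).le
    refine pow_mul_left_cancel (p := p) (padicValNat p m.factorial) ?_
    rw [← mul_assoc, ← Nat.cast_pow, ← Nat.cast_mul, mul_comm (p ^ _),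
      ← factorial_eq_mul_pow_padicValNat, γ.factorial_mul_dpow_eq_pow (hgI x), hx, map_natCast,
      Nat.cast_pow, ← pow_add, Nat.add_sub_cancel' exponent_le]

section ToFlat

variable {p : ℕ} [Fact p.Prime] {B : Type u} [CommRing B] {n : ℕ}

theorem PerfectPolynomial.x_eq (i : Fin n) : PerfectPolynomial.x p B n i =
    AddMonoidAlgebra.single (Pi.single i (Exponent.ofNat 1)) 1 := by
  rw [PerfectPolynomial.x]
  congr 2

variable [CharP B p] [PerfectRing B p]

variable (p) in
/-- The canonical homomorphism `B[x_1 ^ (p ^ (-∞)), …, x_n ^ (p ^ (-∞))] → C^♭`, which exists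
because the source is perfect. -/
def toFlat : PerfectPolynomial p B n →+* Perfection (KeyRing p B n) p :=
  Perfection.lift p _ _ (Ideal.Quotient.mk _)

theorem coeff_toFlat (m : ℕ) (q : PerfectPolynomial p B n) :
    Perfection.coeff _ p m (toFlat p q) =
      Ideal.Quotient.mk _ ((frobeniusEquiv (PerfectPolynomial p B n) p).symm^[m] q) := rfl

variable (p B n) in
/-- The Teichmüller representative `[x ^ α]` in `W(C^♭)`. -/
def flatMonomial : Multiplicative (Fin n → Exponent p) →* WFlat p (KeyRing p B n) :=
  (WittVector.teichmuller p).comp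
    ((toFlat p : PerfectPolynomial p B n →+* _).toMonoidHom.comp (AddMonoidAlgebra.of B _))

variable (p B n) in
/-- The homomorphism `W(B) → W(C^♭)`. -/
def flatConst : WittVector p B →+* WFlat p (KeyRing p B n) :=
  WittVector.map ((toFlat p).comp AddMonoidAlgebra.singleZeroRingHom)

theorem flatMonomial_apply (α : Fin n → Exponent p) : flatMonomial p B n (.ofAdd α) =
    WittVector.teichmuller p (toFlat p (AddMonoidAlgebra.single α 1)) := rfl

theorem flatConst_teichmuller (b : B) : flatConst p B n (WittVector.teichmuller p b) =
    WittVector.teichmuller p (toFlat p (AddMonoidAlgebra.single 0 b)) := by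
  rw [flatConst, WittVector.map_teichmuller]
  rfl

theorem flatConst_mul_flatMonomial (α : Fin n → Exponent p) (b : B) :
    flatConst p B n (WittVector.teichmuller p b) * flatMonomial p B n (.ofAdd α) =
      WittVector.teichmuller p (toFlat p (AddMonoidAlgebra.single α b)) := by
  rw [flatConst_teichmuller, flatMonomial_apply, ← map_mul, ← map_mul,
    AddMonoidAlgebra.single_mul_single, zero_add, mul_one]

-- A map that kills every `x_i ^ p` descends, after Frobenius, to `C`; composing with `ν_1` undoes
-- the Frobenius.
theorem exists_ringHom_toFlat_eq {T : Type*} [CommRing T] [CharP T p]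
    (ρ : PerfectPolynomial p B n →+* T) (hρ : ∀ i, ρ (PerfectPolynomial.x p B n i) ^ p = 0) :
    ∃ χ : Perfection (KeyRing p B n) p →+* T, (∀ q, χ (toFlat p q) = ρ q) ∧
      ∀ z ∈ kerNu p (KeyRing p B n) 0,
        χ z ∈ Ideal.span (Set.range fun i => ρ (PerfectPolynomial.x p B n i)) := by
  have ker_le : Ideal.span (Set.range (PerfectPolynomial.x p B n)) ≤
      RingHom.ker ((frobenius T p).comp ρ) := by
    rw [Ideal.span_le]
    rintro _ ⟨i, rfl⟩
    exact hρ i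
  let χ₀ : KeyRing p B n →+* T := Ideal.Quotient.lift _ ((frobenius T p).comp ρ) ker_le
  have χ₀_mk (q : PerfectPolynomial p B n) : χ₀ (Ideal.Quotient.mk _ q) = ρ (q ^ p) :=
    (map_pow ρ q p).symm
  refine ⟨χ₀.comp (Perfection.coeff _ p 1), fun q => ?_, fun z hz => ?_⟩
  · rw [RingHom.comp_apply, coeff_toFlat, χ₀_mk, Function.iterate_one, frobeniusEquiv_symm_pow_p]
  · obtain ⟨q, hq⟩ := Ideal.Quotient.mk_surjective (Perfection.coeff _ p 1 z)
    have pow_mem : q ^ p ∈ Ideal.span (Set.range (PerfectPolynomial.x p B n)) := by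
      rw [← Ideal.Quotient.eq_zero_iff_mem, map_pow, hq, Perfection.coeff_pow_p']
      exact hz
    rw [RingHom.comp_apply, ← hq, χ₀_mk]
    have map_mem := Ideal.mem_map_of_mem ρ pow_mem
    rwa [Ideal.map_span, ← Set.range_comp] at map_mem

end ToFlat

section UniversalProperty

variable {p : ℕ} [Fact p.Prime] {B : Type u} [CommRing B] [CharP B p] [PerfectRing B p] {n : ℕ}
  {S : Type u} [CommRing S] [Fact ¬IsUnit (p : S)]

theorem exists_ringHom_modP_single_eq (c : WittVector p B →+* S)
    (e : Multiplicative (Fin n → Exponent p) →* S) :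
    ∃ ρ : PerfectPolynomial p B n →+* ModP S p, ∀ α b, ρ (AddMonoidAlgebra.single α b) =
      Ideal.Quotient.mk _ (c (WittVector.teichmuller p b) * e (.ofAdd α)) := by
  obtain ⟨f, hf⟩ := exists_ringHom_coeff_zero_eq
    ((Ideal.Quotient.mk (Ideal.span {(p : S)})).comp c) (CharP.cast_eq_zero (ModP S p) p)
  refine ⟨AddMonoidAlgebra.liftNCRingHom f ((Ideal.Quotient.mk _).toMonoidHom.comp e)
    fun _ _ => Commute.all _ _, fun α b => ?_⟩
  have hfb := hf (WittVector.teichmuller p b)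
  rw [WittVector.teichmuller_coeff_zero] at hfb
  rw [AddMonoidAlgebra.liftNCRingHom_single, hfb, map_mul]
  rfl

variable [IsAdicComplete (Ideal.span {(p : S)}) S]

-- Fontaine's map `W(S^♭) → S`, applied to the homomorphism `C^♭ → S^♭` that the reduction modulo
-- `p` induces.
theorem exists_ringHom_wFlat (c : WittVector p B →+* S)
    (e : Multiplicative (Fin n → Exponent p) →* S)
    (he : ∀ i, e (.ofAdd (Pi.single i (Exponent.ofNat 1))) ∈ factorialIdeal ⊤) :
    ∃ Φ : WFlat p (KeyRing p B n) →+* S,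
      (∀ α b, Φ (WittVector.teichmuller p (toFlat p (AddMonoidAlgebra.single α b))) =
        c (WittVector.teichmuller p b) * e (.ofAdd α)) ∧
      ∀ w ∈ kerTheta p (KeyRing p B n), Φ w ∈ factorialIdeal ⊤ := by
  obtain ⟨ρ, hρ⟩ := exists_ringHom_modP_single_eq c e
  have hρx (i : Fin n) : ρ (PerfectPolynomial.x p B n i) =
      Ideal.Quotient.mk _ (e (.ofAdd (Pi.single i (Exponent.ofNat 1)))) := by
    rw [PerfectPolynomial.x_eq, hρ, map_one (WittVector.teichmuller p), map_one, one_mul]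
  obtain ⟨χ, χ_toFlat, χ_kerNu⟩ := exists_ringHom_toFlat_eq ρ fun i => by
    obtain ⟨d, -, hd⟩ := mem_factorialIdeal.1 (he i) p
    rw [hρx, ← map_pow, Ideal.Quotient.eq_zero_iff_mem, Ideal.mem_span_singleton, ← hd]
    exact (Nat.cast_dvd_cast (Nat.dvd_factorial (Fact.out : p.Prime).pos le_rfl)).mul_right d
  let χ' : Perfection (KeyRing p B n) p →+* PreTilt S p := Perfection.lift p _ (ModP S p) χ
  have coeff_χ' (m : ℕ) (t : Perfection (KeyRing p B n) p) : PreTilt.coeff m (χ' t) =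
    χ ((frobeniusEquiv (Perfection (KeyRing p B n) p) p).symm^[m] t) := rfl
  refine ⟨(WittVector.fontaineTheta S p).comp (WittVector.map χ'), fun α b => ?_, fun w hw => ?_⟩
  · rw [RingHom.comp_apply, WittVector.map_teichmuller, WittVector.fontaineTheta_teichmuller]
    refine untilt_eq _ (fun m => c (WittVector.teichmuller p ((frobeniusEquiv B p).symm^[m] b)) *
      e (.ofAdd ((Exponent.piNsmulEquiv p n).symm^[m] α))) (fun m => ?_) fun m => ?_
    · rw [mul_pow, ← map_pow, ← map_pow, ← map_pow, Function.iterate_succ_apply',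
        frobeniusEquiv_symm_pow_p, Function.iterate_succ_apply', ← ofAdd_nsmul,
        Exponent.nsmul_piNsmulEquiv_symm]
    · rw [coeff_χ', ← RingHom.map_iterate_frobeniusEquiv_symm, χ_toFlat,
        PerfectPolynomial.frobeniusEquiv_symm_iterate_single, hρ]
  · have span_le : Ideal.span (Set.range fun i => ρ (PerfectPolynomial.x p B n i)) ≤
        Ideal.map (Ideal.Quotient.mk (Ideal.span {(p : S)})) (factorialIdeal ⊤) := by
      rw [Ideal.span_le]
      rintro _ ⟨i, rfl⟩
      exact Set.mem_of_eq_of_mem (hρx i) (Ideal.mem_map_of_mem _ (he i))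
    have p_le : Ideal.span {(p : S)} ≤ factorialIdeal ⊤ := by
      rw [Ideal.span_singleton_le_iff_mem]
      exact natCast_mem_factorialIdeal p trivial
    have mk_mem := span_le (χ_kerNu (w.coeff 0) hw)
    have mk_eq := WittVector.mk_fontaineTheta (WittVector.map χ' w)
    rw [WittVector.map_coeff, coeff_χ', Function.iterate_zero_apply] at mk_eq
    rwa [← mk_eq, Ideal.mem_quotient_iff_mem p_le] at mk_mem

theorem exists_ringHom_acrisHull [IsAddTorsionFree S] (c : WittVector p B →+* S)
    (e : Multiplicative (Fin n → Exponent p) →* S)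
    (he : ∀ i, e (.ofAdd (Pi.single i (Exponent.ofNat 1))) ∈ factorialIdeal ⊤) :
    ∃ φ : AcrisHull p (KeyRing p B n) →+* S,
      (∀ w, φ (algebraMap _ _ (flatConst p B n w)) = c w) ∧
      ∀ α, φ (algebraMap _ _ (flatMonomial p B n (.ofAdd α))) = e (.ofAdd α) := by
  obtain ⟨Φ, hΦ, hΦ_ker⟩ := exists_ringHom_wFlat c e he
  obtain ⟨φ, hφ⟩ := PDHull.exists_lift (p := p) Φ hΦ_ker
  refine ⟨φ, fun w => ?_, fun α => ?_⟩
  · have comp_eq : Φ.comp (flatConst p B n) = c :=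
      ringHom_eq_of_apply_teichmuller_eq _ _ fun b => by
        rw [RingHom.comp_apply, flatConst_teichmuller, hΦ, ofAdd_zero, map_one, mul_one]
    rw [hφ, ← comp_eq, RingHom.comp_apply]
  · rw [hφ, flatMonomial_apply, hΦ, map_one (WittVector.teichmuller p), map_one, one_mul]

end UniversalProperty

/-! ### Divided power monomials in the divided power hull -/

section HullMonomials

variable {p : ℕ} [Fact p.Prime] {B : Type u} [CommRing B] [CharP B p] [PerfectRing B p] {n : ℕ}

variable (p B n) in
/-- The homomorphism from `W(B)` to the divided power hull. -/
def hullConst : WittVector p B →+* AcrisHull p (KeyRing p B n) :=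
  (algebraMap (WFlat p (KeyRing p B n)) _).comp (flatConst p B n)

theorem flatMonomial_single_ofNat_one_mem_kerTheta (i : Fin n) :
    flatMonomial p B n (.ofAdd (Pi.single i (Exponent.ofNat 1))) ∈
      kerTheta p (KeyRing p B n) := by
  rw [RingHom.mem_ker, flatMonomial_apply, theta_teichmuller, coeff_toFlat,
    Function.iterate_zero_apply, ← PerfectPolynomial.x_eq, Ideal.Quotient.eq_zero_iff_mem]
  exact Ideal.subset_span ⟨i, rfl⟩

variable (p B) in
/-- The Teichmüller representative `[x_i]` as an element of the kernel of `W(C^♭) → C`. -/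
def teichmullerX (i : Fin n) : kerTheta p (KeyRing p B n) :=
  ⟨_, flatMonomial_single_ofNat_one_mem_kerTheta i⟩

variable (p B) in
/-- The divided power `x_i ^ a / ⌊a⌋!` of `[x_i]`, with exponent `a` in `ℤ_+[1/p]`. -/
def hullFactor (i : Fin n) (a : Exponent p) : AcrisHull p (KeyRing p B n) :=
  algebraMap _ _ (flatMonomial p B n (.ofAdd (Pi.single i (Exponent.frac a)))) *
    PDHull.dp p _ (Exponent.floor a) (teichmullerX p B i)

variable (p B) in
/-- The divided power `x ^ α / weight α` of a monomial, as an element of the divided power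
hull. -/
def hullMonomial (α : Fin n → Exponent p) : AcrisHull p (KeyRing p B n) :=
  ∏ i, hullFactor p B i (α i)

variable (p B n) in
/-- The linear combination of divided power monomials with a given family of coefficients. -/
abbrev hullSum : ((Fin n → Exponent p) →₀ WittVector p B) →+ AcrisHull p (KeyRing p B n) :=
  combination (hullConst p B n) (hullMonomial p B)

theorem flatMonomial_single_add (i : Fin n) (a b : Exponent p) :
    flatMonomial p B n (.ofAdd (Pi.single i (a + b))) =
      flatMonomial p B n (.ofAdd (Pi.single i a)) *
        flatMonomial p B n (.ofAdd (Pi.single i b)) := by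
  rw [← map_mul, ← ofAdd_add, ← Pi.single_add]

theorem flatMonomial_single_ofNat (i : Fin n) (k : ℕ) :
    flatMonomial p B n (.ofAdd (Pi.single i (Exponent.ofNat k))) =
      (teichmullerX p B i : WFlat p _) ^ k := by
  rw [teichmullerX, ← map_pow, ← ofAdd_nsmul, Exponent.nsmul_single_one]

theorem factorial_floor_mul_hullFactor (i : Fin n) (a : Exponent p) :
    ((Exponent.floor a).factorial : AcrisHull p (KeyRing p B n)) * hullFactor p B i a =
      algebraMap _ _ (flatMonomial p B n (.ofAdd (Pi.single i a))) := by
  rw [hullFactor, mul_left_comm, PDHull.factorial_mul_dp, ← map_pow, ← flatMonomial_single_ofNat,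
    ← map_mul, ← flatMonomial_single_add, Exponent.frac_add_floor]

theorem weight_mul_hullMonomial (α : Fin n → Exponent p) :
    (weight α : AcrisHull p (KeyRing p B n)) * hullMonomial p B α =
      algebraMap _ _ (flatMonomial p B n (.ofAdd α)) := by
  rw [weight, hullMonomial, Nat.cast_prod, ← Finset.prod_mul_distrib]
  simp only [factorial_floor_mul_hullFactor]
  rw [← map_prod, ← map_prod, ← ofAdd_sum, Finset.univ_sum_single]

theorem exists_flatMonomial_mul_dp_eq (i : Fin n) (c : Exponent p) (k : ℕ) :
    ∃ m : ℕ, algebraMap _ (AcrisHull p (KeyRing p B n))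
      (flatMonomial p B n (.ofAdd (Pi.single i c))) * PDHull.dp p _ k (teichmullerX p B i) =
        m * hullFactor p B i (c + Exponent.ofNat k) := by
  refine ⟨(Exponent.floor c).factorial * (Exponent.floor c + k).choose (Exponent.floor c), ?_⟩
  rw [hullFactor, Exponent.floor_add_ofNat, Exponent.frac_add_ofNat,
    ← factorial_floor_mul_hullFactor, hullFactor]
  have dp_mul := PDHull.dp_mul (p := p) (Exponent.floor c) k (teichmullerX p B i)
  push_cast
  linear_combination ((Exponent.floor c).factorial : AcrisHull p (KeyRing p B n)) *
    algebraMap _ _ (flatMonomial p B n (.ofAdd (Pi.single i (Exponent.frac c)))) * dp_mul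

theorem exists_hullFactor_mul_eq (i : Fin n) (a b : Exponent p) :
    ∃ m : ℕ, hullFactor p B i a * hullFactor p B i b = m * hullFactor p B i (a + b) := by
  obtain ⟨m, hm⟩ := exists_flatMonomial_mul_dp_eq (B := B) i (Exponent.frac a + Exponent.frac b)
    (Exponent.floor a + Exponent.floor b)
  have frac_add_frac : Exponent.frac a + Exponent.frac b +
      Exponent.ofNat (Exponent.floor a + Exponent.floor b) = a + b := by
    rw [map_add, add_add_add_comm, Exponent.frac_add_floor, Exponent.frac_add_floor]
  rw [frac_add_frac, flatMonomial_single_add, map_mul] at hm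
  refine ⟨(Exponent.floor a + Exponent.floor b).choose (Exponent.floor a) * m, ?_⟩
  have dp_mul :=
    PDHull.dp_mul (p := p) (Exponent.floor a) (Exponent.floor b) (teichmullerX p B i)
  push_cast
  rw [mul_assoc, ← hm, hullFactor, hullFactor]
  linear_combination algebraMap _ _ (flatMonomial p B n (.ofAdd (Pi.single i (Exponent.frac a)))) *
    algebraMap _ _ (flatMonomial p B n (.ofAdd (Pi.single i (Exponent.frac b)))) * dp_mul

theorem exists_hullMonomial_mul_eq (α β : Fin n → Exponent p) :
    ∃ m : ℕ, hullMonomial p B α * hullMonomial p B β = m * hullMonomial p B (α + β) := by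
  choose m hm using fun i => exists_hullFactor_mul_eq (B := B) i (α i) (β i)
  refine ⟨∏ i, m i, ?_⟩
  rw [hullMonomial, hullMonomial, hullMonomial, ← Finset.prod_mul_distrib, Nat.cast_prod,
    ← Finset.prod_mul_distrib]
  exact Finset.prod_congr rfl fun i _ => hm i

theorem hullFactor_ofNat (i : Fin n) (k : ℕ) :
    hullFactor p B i (Exponent.ofNat k) = PDHull.dp p _ k (teichmullerX p B i) := by
  rw [hullFactor, Exponent.frac_ofNat, Exponent.floor_ofNat, Pi.single_zero, ofAdd_zero, map_one,
    map_one, one_mul]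

theorem hullFactor_zero (i : Fin n) : hullFactor p B i 0 = 1 := by
  rw [← map_zero Exponent.ofNat, hullFactor_ofNat, PDHull.dp_zero]

theorem hullMonomial_zero : hullMonomial p B (0 : Fin n → Exponent p) = 1 :=
  Finset.prod_eq_one fun i _ => hullFactor_zero i

theorem hullMonomial_single_ofNat (i : Fin n) (k : ℕ) :
    hullMonomial p B (Pi.single i (Exponent.ofNat k)) = PDHull.dp p _ k (teichmullerX p B i) := by
  rw [hullMonomial, Finset.prod_eq_single i, Pi.single_eq_same, hullFactor_ofNat]
  · intro j _ hj
    rw [Pi.single_eq_of_ne hj, hullFactor_zero]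
  · exact fun hi => absurd (Finset.mem_univ i) hi

theorem exists_hullSum_mul_eq (l l' : (Fin n → Exponent p) →₀ WittVector p B) :
    ∃ l'', hullSum p B n l * hullSum p B n l' = hullSum p B n l'' := by
  suffices hrange : hullSum p B n l * hullSum p B n l' ∈ (hullSum p B n).range by
    obtain ⟨l'', hl''⟩ := hrange
    exact ⟨l'', hl''.symm⟩
  induction l using Finsupp.induction_linear with
  | zero => rw [map_zero, zero_mul]; exact zero_mem _
  | add l₁ l₂ ih₁ ih₂ => rw [map_add, add_mul]; exact add_mem ih₁ ih₂
  | single α c =>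
    induction l' using Finsupp.induction_linear with
    | zero => rw [map_zero, mul_zero]; exact zero_mem _
    | add l₁ l₂ ih₁ ih₂ => rw [map_add, mul_add]; exact add_mem ih₁ ih₂
    | single β d =>
      obtain ⟨m, hm⟩ := exists_hullMonomial_mul_eq (B := B) α β
      refine ⟨Finsupp.single (α + β) (c * d * m), ?_⟩
      rw [combination_single, combination_single, combination_single, map_mul, map_mul,
        map_natCast, mul_mul_mul_comm, hm, mul_assoc _ (m : AcrisHull p (KeyRing p B n))]

end HullMonomials

section PDSeries

variable (p : ℕ) [Fact p.Prime] (R : Type u) [CommRing R] (n : ℕ)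

/-- The `p`-adic completion of the ring of divided power polynomials over `R`. -/
abbrev PDSeries : Type u := AdicCompletion (Ideal.span {(p : PDPoly p R n)}) (PDPoly p R n)

variable [IsAddTorsionFree R]

instance : IsAddTorsionFree (PDSeries p R n) :=
  isAddTorsionFree_adicCompletion p fun a ha => mul_left_cancel_prime (by rw [ha, mul_zero])

variable {p R n}

theorem pow_dvd_of_pow_dvd_algebraMap_combination {k : ℕ} {l : (Fin n → Exponent p) →₀ R}
    (h : (p : PDSeries p R n) ^ k ∣ algebraMap (PDPoly p R n) (PDSeries p R n)
      (combination (PDPoly.const p R) (PDPoly.dpMonomial p R) l)) (α : Fin n → Exponent p) :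
    (p : R) ^ k ∣ l α := by
  rw [pow_dvd_algebraMap_adicCompletion_iff, ← Nat.cast_pow] at h
  rw [← Nat.cast_pow]
  exact PDPoly.natCast_dvd_of_dvd_combination h α

instance [Fact ¬IsUnit (p : R)] : Fact ¬IsUnit (p : PDSeries p R n) := ⟨fun hp => by
  have dvd_one := pow_dvd_of_pow_dvd_algebraMap_combination
    (l := Finsupp.single (0 : Fin n → Exponent p) (1 : R)) (hp.pow 1).dvd 0
  rw [pow_one, Finsupp.single_eq_same] at dvd_one
  exact (Fact.out : ¬IsUnit (p : R)) (isUnit_of_dvd_one dvd_one)⟩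

end PDSeries

section Independence

variable {p : ℕ} [Fact p.Prime] {B : Type u} [CommRing B] [CharP B p]

instance : Fact ¬IsUnit (p : WittVector p B) := ⟨fun hp => by
  have : Nontrivial B := CharP.nontrivial_of_char_ne_one (v := p) (Fact.out : p.Prime).ne_one
  have isUnit_zero := hp.map (WittVector.constantCoeff : WittVector p B →+* B)
  rw [map_natCast, CharP.cast_eq_zero] at isUnit_zero
  exact not_isUnit_zero isUnit_zero⟩

variable [PerfectRing B p] {n : ℕ}

-- The divided power hull maps to the completed divided power polynomials over `W(B)`, and there
-- the coefficients can be read off.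
theorem pow_dvd_of_pow_dvd_hullSum {k : ℕ} {l : (Fin n → Exponent p) →₀ WittVector p B}
    (h : (p : AcrisHull p (KeyRing p B n)) ^ k ∣ hullSum p B n l) (α : Fin n → Exponent p) :
    (p : WittVector p B) ^ k ∣ l α := by
  let ι := algebraMap (PDPoly p (WittVector p B) n) (PDSeries p (WittVector p B) n)
  obtain ⟨φ, φ_const, φ_monomial⟩ := exists_ringHom_acrisHull (ι.comp (PDPoly.const p _))
    (ι.toMonoidHom.comp (PDPoly.monomial p (WittVector p B) (n := n))) fun i => by
      refine mem_factorialIdeal.2 fun m =>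
        ⟨ι (PDPoly.dpMonomial p _ (Pi.single i (Exponent.ofNat m))), fun _ => trivial, ?_⟩
      change _ = ι _ ^ m
      rw [← map_pow, PDPoly.monomial_single_pow, map_mul, map_natCast]
  have φ_hullMonomial (β : Fin n → Exponent p) :
      φ (hullMonomial p B β) = ι (PDPoly.dpMonomial p _ β) := by
    refine natCast_mul_left_cancel (weight_ne_zero β) ?_
    have weight_mul := congrArg φ (weight_mul_hullMonomial (B := B) β)
    rw [map_mul, map_natCast, φ_monomial] at weight_mul
    rw [weight_mul, ← map_natCast ι (weight β), ← map_mul, PDPoly.weight_mul_dpMonomial]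
    rfl
  have φ_hullConst : φ.comp (hullConst p B n) = ι.comp (PDPoly.const p _) :=
    RingHom.ext φ_const
  refine pow_dvd_of_pow_dvd_algebraMap_combination ?_ α
  have dvd_φ := map_dvd φ h
  rw [map_pow, map_natCast, map_combination, φ_hullConst] at dvd_φ
  simp only [φ_hullMonomial] at dvd_φ
  rwa [map_combination]

end Independence

/-! ### Generation of the divided power hull by monomials -/

section PDHull

theorem dvd_factorial_mul_choose {k : ℕ} (hk : k ≠ 0) (m : ℕ) :
    m ∣ k.factorial * m.choose k := by
  obtain ⟨k, rfl⟩ := Nat.exists_eq_succ_of_ne_zero hk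
  rw [← Nat.descFactorial_eq_factorial_mul_choose]
  cases m with
  | zero => rw [Nat.zero_descFactorial_succ]
  | succ m => exact Dvd.intro _ (Nat.succ_descFactorial_succ m k).symm

variable {p : ℕ} [Fact p.Prime] {R : Type u} [CommRing R] {I : Ideal R}

theorem PDHull.natCast_dvd_dp_pow {x y : I} (hx : (x : R) = (y : R) ^ p) {n : ℕ} (hn : n ≠ 0) :
    (p : PDHull p I) ∣ PDHull.dp p I n x := by
  have hp : p.Prime := Fact.out
  have hx' : x = (y : R) ^ (p - 1) • y := Subtype.ext (by
    rw [hx, Submodule.coe_smul, smul_eq_mul, pow_sub_one_mul hp.ne_zero])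
  have natCast_dvd : (p : PDHull p I) ∣
      (((p - 1) * n).factorial * ((p - 1) * n + n).choose ((p - 1) * n) : ℕ) := by
    refine Nat.cast_dvd_cast (dvd_trans ?_
      (dvd_factorial_mul_choose (mul_ne_zero (Nat.sub_ne_zero_of_lt hp.one_lt) hn) _))
    rw [← Nat.succ_mul, Nat.succ_eq_add_one, Nat.sub_add_cancel hp.one_le]
    exact dvd_mul_right _ _
  rw [hx', PDHull.dp_smul, ← map_pow, ← pow_mul, map_pow, ← PDHull.factorial_mul_dp (p := p),
    mul_assoc, PDHull.dp_mul, ← mul_assoc, ← Nat.cast_mul]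
  exact dvd_mul_of_dvd_left natCast_dvd _

variable [IsAdicComplete (Ideal.span {(p : R)}) R]

theorem PDHull.natCast_dvd_dp_natCast {x : I} (hx : (x : R) = (p : R)) {n : ℕ} (hn : n ≠ 0) :
    (p : PDHull p I) ∣ PDHull.dp p I n x := by
  have compat := PDHull.mk_eq_of_rel (PDHullRel.compat (p := p) x hx n)
  rw [map_mul, map_natCast, map_pow, map_natCast] at compat
  have isUnit := (isUnit_natCast_of_not_dvd (R := R)
    (not_dvd_factorial_div_pow_padicValNat p n)).map (algebraMap R (PDHull p I))
  rw [map_natCast] at isUnit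
  refine isUnit.dvd_mul_left.1 (dvd_trans (dvd_pow_self _ ?_) compat.symm.dvd)
  exact Nat.sub_ne_zero_of_lt (padicValNat_factorial_lt_of_ne_zero (p := p) hn)

end PDHull

section KerTheta

variable {p : ℕ} [Fact p.Prime]

theorem mem_of_coeff_zero_mem_map {R : Type u} [CommRing R] [CharP R p] [PerfectRing R p]
    {A : AddSubgroup (WittVector p R)} (hA : ∀ w, (p : WittVector p R) * w ∈ A)
    {w : WittVector p R}
    (hw : w.coeff 0 ∈ A.map (WittVector.constantCoeff : WittVector p R →+* R).toAddMonoidHom) :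
    w ∈ A := by
  obtain ⟨a, ha, haw⟩ := hw
  obtain ⟨v, hv⟩ := (natCast_dvd_iff_coeff_zero_eq_zero (w - a)).2 (by
    change WittVector.constantCoeff (w - a) = 0
    rw [map_sub, sub_eq_zero]
    exact haw.symm)
  rw [← sub_add_cancel w a, hv]
  exact add_mem (hA v) ha

theorem teichmuller_mem_kerTheta {C : Type u} [CommRing C] [CharP C p] {z : Perfection C p}
    (hz : z ∈ kerNu p C 0) : WittVector.teichmuller p z ∈ kerTheta p C := by
  rw [RingHom.mem_ker, theta_teichmuller]
  exact hz

variable {B : Type u} [CommRing B] [CharP B p] [PerfectRing B p] {n : ℕ}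

theorem exists_eq_toFlat_add_pow (t : Perfection (KeyRing p B n) p) :
    ∃ q, ∃ z ∈ kerNu p (KeyRing p B n) 0, t = toFlat p q + z ^ p := by
  obtain ⟨q, hq⟩ := Ideal.Quotient.mk_surjective (Perfection.coeff _ p 1 t)
  have sub_mem : t - toFlat p (q ^ p) ∈ kerNu p (KeyRing p B n) 1 := by
    rw [RingHom.mem_ker, map_sub, coeff_toFlat, Function.iterate_one, frobeniusEquiv_symm_pow,
      hq, sub_self]
  obtain ⟨z, hz, hzt⟩ := exists_mem_kerNu_zero_pow_eq sub_mem
  rw [pow_one] at hzt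
  exact ⟨q ^ p, z, hz, sub_eq_iff_eq_add'.1 hzt.symm⟩

theorem mem_of_teichmuller_mem {A : AddSubgroup (WFlat p (KeyRing p B n))}
    (hp : ∀ w, (p : WFlat p (KeyRing p B n)) * w ∈ A)
    (hpow : ∀ z ∈ kerNu p (KeyRing p B n) 0, WittVector.teichmuller p z ^ p ∈ A)
    (hsingle : ∀ (α : Fin n → Exponent p) (b : B),
      WittVector.teichmuller p (toFlat p (AddMonoidAlgebra.single α b)) ∈ A)
    (w : WFlat p (KeyRing p B n)) : w ∈ A := by
  let A₀ := A.map (WittVector.constantCoeff (p := p)).toAddMonoidHom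
  have coeff_zero_mem {z : Perfection (KeyRing p B n) p}
      (hz : WittVector.teichmuller p z ∈ A) : z ∈ A₀ :=
    ⟨_, hz, WittVector.teichmuller_coeff_zero p z⟩
  obtain ⟨q, z, hz, hqz⟩ := exists_eq_toFlat_add_pow (w.coeff 0)
  have toFlat_mem : toFlat p q ∈ A₀ := by
    clear hqz
    induction q using AddMonoidAlgebra.induction_linear with
    | zero => rw [map_zero]; exact zero_mem _
    | add q q' hq hq' => rw [map_add]; exact add_mem hq hq'
    | single α b => exact coeff_zero_mem (hsingle α b)
  refine mem_of_coeff_zero_mem_map hp ?_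
  rw [hqz]
  exact add_mem toFlat_mem (coeff_zero_mem (map_pow (WittVector.teichmuller p) z p ▸ hpow z hz))

theorem kerTheta_le {J : Ideal (WFlat p (KeyRing p B n))}
    (hp : (p : WFlat p (KeyRing p B n)) ∈ J)
    (hpow : ∀ z ∈ kerNu p (KeyRing p B n) 0, WittVector.teichmuller p z ^ p ∈ J)
    (hx : ∀ i, WittVector.teichmuller p (toFlat p (PerfectPolynomial.x p B n i)) ∈ J) :
    kerTheta p (KeyRing p B n) ≤ J := by
  intro b hb
  let J₀ := J.map (WittVector.constantCoeff (p := p))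
  have coeff_zero_mem {w : WFlat p (KeyRing p B n)} (hw : w ∈ J) : w.coeff 0 ∈ J₀ :=
    Ideal.mem_map_of_mem (WittVector.constantCoeff (p := p)) hw
  suffices h : b.coeff 0 ∈ J₀ from
    mem_of_coeff_zero_mem_map (A := Submodule.toAddSubgroup J) (fun w => J.mul_mem_right w hp)
      ((Ideal.mem_map_iff_of_surjective _ (WittVector.constantCoeff_surjective (p := p))).1 h)
  obtain ⟨q, z, hz, hqz⟩ := exists_eq_toFlat_add_pow (b.coeff 0)
  have q_mem : q ∈ Ideal.span (Set.range (PerfectPolynomial.x p B n)) := by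
    have coeff_eq := congrArg (Perfection.coeff _ p 0) hqz
    rw [map_add, map_pow, RingHom.mem_ker.1 hz, zero_pow (Fact.out : p.Prime).ne_zero, add_zero,
      coeff_toFlat, Function.iterate_zero_apply, ← theta_apply, RingHom.mem_ker.1 hb] at coeff_eq
    exact Ideal.Quotient.eq_zero_iff_mem.1 coeff_eq.symm
  have span_le : Ideal.span (Set.range (PerfectPolynomial.x p B n)) ≤ J₀.comap (toFlat p) := by
    refine Ideal.span_le.2 ?_
    rintro _ ⟨i, rfl⟩
    have x_mem := coeff_zero_mem (hx i)
    rwa [WittVector.teichmuller_coeff_zero] at x_mem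
  have pow_mem := coeff_zero_mem (hpow z hz)
  rw [← map_pow (WittVector.teichmuller p), WittVector.teichmuller_coeff_zero] at pow_mem
  rw [hqz]
  exact add_mem (span_le q_mem) pow_mem

end KerTheta

section Generation

variable {p : ℕ} [Fact p.Prime] {B : Type u} [CommRing B] [CharP B p] [PerfectRing B p] {n : ℕ}

variable (p B n) in
/-- The subring of all elements of the divided power hull which are linear combinations of
divided power monomials up to a multiple of `p`. It turns out to be the whole hull. -/
def hullSubring : Subring (AcrisHull p (KeyRing p B n)) where
  carrier := {h | ∃ l h', h = hullSum p B n l + p * h'}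
  zero_mem' := ⟨0, 0, by rw [map_zero, mul_zero, add_zero]⟩
  one_mem' := ⟨Finsupp.single 0 1, 0, by
    rw [combination_single, hullMonomial_zero, map_one, mul_one, mul_zero, add_zero]⟩
  add_mem' := by
    rintro _ _ ⟨l, h, rfl⟩ ⟨l', h', rfl⟩
    exact ⟨l + l', h + h', by rw [map_add]; ring⟩
  neg_mem' := by
    rintro _ ⟨l, h, rfl⟩
    exact ⟨-l, -h, by rw [map_neg]; ring⟩
  mul_mem' := by
    rintro _ _ ⟨l, h, rfl⟩ ⟨l', h', rfl⟩
    obtain ⟨l'', hl''⟩ := exists_hullSum_mul_eq l l'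
    exact ⟨l'', hullSum p B n l * h' + h * hullSum p B n l' + p * h * h', by rw [← hl'']; ring⟩

theorem hullSum_mem_hullSubring (l : (Fin n → Exponent p) →₀ WittVector p B) :
    hullSum p B n l ∈ hullSubring p B n :=
  ⟨l, 0, by rw [mul_zero, add_zero]⟩

theorem mem_hullSubring_of_dvd {h : AcrisHull p (KeyRing p B n)}
    (hh : (p : AcrisHull p (KeyRing p B n)) ∣ h) : h ∈ hullSubring p B n := by
  obtain ⟨h', rfl⟩ := hh
  exact ⟨0, h', by rw [map_zero, zero_add]⟩

theorem dp_mem_hullSubring_of_dvd {b : kerTheta p (KeyRing p B n)}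
    (hb : ∀ m ≠ 0, (p : AcrisHull p (KeyRing p B n)) ∣ PDHull.dp p _ m b) (m : ℕ) :
    PDHull.dp p _ m b ∈ hullSubring p B n := by
  rcases eq_or_ne m 0 with rfl | hm
  · rw [PDHull.dp_zero]
    exact one_mem _
  · exact mem_hullSubring_of_dvd (hb m hm)

theorem dp_teichmullerX_mem_hullSubring (i : Fin n) (m : ℕ) :
    PDHull.dp p _ m (teichmullerX p B i) ∈ hullSubring p B n := by
  have mem := hullSum_mem_hullSubring (p := p) (B := B)
    (Finsupp.single (Pi.single i (Exponent.ofNat m)) 1)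
  rwa [combination_single, map_one, one_mul, hullMonomial_single_ofNat] at mem

theorem algebraMap_mem_hullSubring (w : WFlat p (KeyRing p B n)) :
    algebraMap _ _ w ∈ hullSubring p B n := by
  suffices h : w ∈ ((hullSubring p B n).comap
      (algebraMap (WFlat p (KeyRing p B n)) _)).toAddSubgroup from h
  refine mem_of_teichmuller_mem (fun v => ?_) (fun z hz => ?_) (fun α b => ?_) w
  · change algebraMap _ _ _ ∈ hullSubring p B n
    rw [map_mul, map_natCast]
    exact mem_hullSubring_of_dvd (dvd_mul_right _ _)
  · change algebraMap _ _ _ ∈ hullSubring p B n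
    have dvd_dp := PDHull.natCast_dvd_dp_pow (p := p) (n := 1)
      (x := ⟨_, Ideal.pow_mem_of_mem _ (teichmuller_mem_kerTheta hz) p (Fact.out : p.Prime).pos⟩)
      (y := ⟨_, teichmuller_mem_kerTheta hz⟩) rfl one_ne_zero
    rw [PDHull.dp_one] at dvd_dp
    exact mem_hullSubring_of_dvd dvd_dp
  · change algebraMap _ _ _ ∈ hullSubring p B n
    have mem := hullSum_mem_hullSubring (p := p) (B := B)
      (Finsupp.single α (weight α * WittVector.teichmuller p b))
    rw [combination_single, map_mul, map_natCast, mul_right_comm, weight_mul_hullMonomial,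
      mul_comm] at mem
    rwa [← flatConst_mul_flatMonomial, map_mul]

variable (p B n) in
/-- The ideal of all elements of `ker (W(C^♭) → C)` whose divided powers are in
`hullSubring p B n`. -/
def hullSubringIdeal : Ideal (WFlat p (KeyRing p B n)) where
  carrier := {b | ∃ hb : b ∈ kerTheta p (KeyRing p B n),
    ∀ m, PDHull.dp p _ m ⟨b, hb⟩ ∈ hullSubring p B n}
  zero_mem' := ⟨zero_mem _, dp_mem_hullSubring_of_dvd fun m hm => by
    have dp_smul := PDHull.dp_smul (p := p) 0 m (0 : kerTheta p (KeyRing p B n))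
    rw [map_zero, zero_pow hm, zero_mul, zero_smul] at dp_smul
    exact dp_smul ▸ dvd_zero _⟩
  add_mem' := by
    rintro a b ⟨ha, ha'⟩ ⟨hb, hb'⟩
    refine ⟨add_mem ha hb, fun m => ?_⟩
    have dp_add := PDHull.dp_add (p := p) m (⟨a, ha⟩ : kerTheta p (KeyRing p B n)) ⟨b, hb⟩
    exact dp_add ▸ sum_mem fun k _ => mul_mem (ha' _) (hb' _)
  smul_mem' := by
    rintro w b ⟨hb, hb'⟩
    refine ⟨Ideal.mul_mem_left _ _ hb, fun m => ?_⟩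
    have dp_smul := PDHull.dp_smul (p := p) w m (⟨b, hb⟩ : kerTheta p (KeyRing p B n))
    exact dp_smul ▸ mul_mem (pow_mem (algebraMap_mem_hullSubring w) m) (hb' m)

theorem kerTheta_le_hullSubringIdeal :
    kerTheta p (KeyRing p B n) ≤ hullSubringIdeal p B n := by
  refine kerTheta_le ⟨?_, ?_⟩ (fun z hz => ⟨?_, ?_⟩) fun i => ?_
  · rw [RingHom.mem_ker, map_natCast, CharP.cast_eq_zero]
  · exact dp_mem_hullSubring_of_dvd fun m hm => PDHull.natCast_dvd_dp_natCast rfl hm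
  · exact Ideal.pow_mem_of_mem _ (teichmuller_mem_kerTheta hz) p (Fact.out : p.Prime).pos
  · exact dp_mem_hullSubring_of_dvd fun m hm =>
      PDHull.natCast_dvd_dp_pow (y := ⟨_, teichmuller_mem_kerTheta hz⟩) rfl hm
  · rw [PerfectPolynomial.x_eq, ← flatMonomial_apply]
    exact ⟨flatMonomial_single_ofNat_one_mem_kerTheta i, dp_teichmullerX_mem_hullSubring i⟩

variable (p B n) in
theorem hullSubring_eq_top : hullSubring p B n = ⊤ :=
  (Subring.eq_top_iff' _).2 fun h => PDHull.induction_on h algebraMap_mem_hullSubring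
    (fun m x => (kerTheta_le_hullSubringIdeal x.2).2 m) (fun _ _ => add_mem) fun _ _ => mul_mem

theorem exists_eq_hullSum_add_pow_mul (k : ℕ) (h : AcrisHull p (KeyRing p B n)) :
    ∃ l h', h = hullSum p B n l + (p : AcrisHull p (KeyRing p B n)) ^ k * h' := by
  induction k generalizing h with
  | zero => exact ⟨0, h, by rw [map_zero, zero_add, pow_zero, one_mul]⟩
  | succ k ih =>
    obtain ⟨l, h', rfl⟩ := ih h
    obtain ⟨l', h'', rfl⟩ : h' ∈ hullSubring p B n := hullSubring_eq_top p B n ▸ Subring.mem_top h'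
    refine ⟨l + p ^ k • l', h'', ?_⟩
    rw [map_add, map_nsmul, nsmul_eq_mul, Nat.cast_pow]
    ring

end Generation

/-! ### The structure of `A_cris(C)` -/

section Structure

theorem exists_pow_dvd_of_pow_add_dvd_natCast_mul {p : ℕ} [Fact p.Prime] {R : Type*} [CommRing R]
    [IsAddTorsionFree R] [IsAdicComplete (Ideal.span {(p : R)}) R] {m : ℕ} (hm : m ≠ 0) :
    ∃ v, ∀ (k : ℕ) (c : R), (p : R) ^ (v + k) ∣ m * c → (p : R) ^ k ∣ c := by
  obtain ⟨v, m', hm', rfl⟩ := Nat.exists_eq_pow_mul_and_not_dvd hm p (Fact.out : p.Prime).ne_one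
  refine ⟨v, fun k c h => ?_⟩
  rw [Nat.cast_mul, Nat.cast_pow, mul_assoc] at h
  exact (isUnit_natCast_of_not_dvd hm').dvd_mul_left.1 (pow_dvd_of_pow_add_dvd h)

variable {p : ℕ} [Fact p.Prime] {B : Type u} [CommRing B] [CharP B p] [PerfectRing B p] {n : ℕ}

theorem pow_dvd_of_pow_dvd_frobenius {k : ℕ} {c : WittVector p B}
    (h : (p : WittVector p B) ^ k ∣ WittVector.frobenius c) : (p : WittVector p B) ^ k ∣ c := by
  have dvd_symm := map_dvd (WittVector.frobeniusEquiv p B).symm h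
  rw [map_pow, map_natCast] at dvd_symm
  rwa [← (WittVector.frobeniusEquiv p B).symm_apply_apply c]

variable (p B n) in
/-- The homomorphism from `W(B)` to `A_cris(C)`. -/
def acrisConst : WittVector p B →+* Acris p (KeyRing p B n) :=
  (toAcris p _).comp (hullConst p B n)

variable (p B) in
/-- The divided power `x ^ α / weight α` of a monomial, as an element of `A_cris(C)`. -/
def acrisMonomial (α : Fin n → Exponent p) : Acris p (KeyRing p B n) :=
  toAcris p _ (hullMonomial p B α)

variable (p B n) in
/-- The image of `hullSum` in `A_cris(C)`. -/
abbrev acrisSum : ((Fin n → Exponent p) →₀ WittVector p B) →+ Acris p (KeyRing p B n) :=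
  combination (acrisConst p B n) (acrisMonomial p B)

theorem toAcris_hullSum (l : (Fin n → Exponent p) →₀ WittVector p B) :
    toAcris p _ (hullSum p B n l) = acrisSum p B n l :=
  map_combination _ _ _ _

theorem exists_eq_acrisSum_add_pow_mul (k : ℕ) (u : Acris p (KeyRing p B n)) :
    ∃ l u', u = acrisSum p B n l + (p : Acris p (KeyRing p B n)) ^ k * u' := by
  obtain ⟨s, y, rfl⟩ := exists_eq_algebraMap_add_pow_mul p k u
  obtain ⟨l, h, rfl⟩ := exists_eq_hullSum_add_pow_mul k s
  refine ⟨l, toAcris p _ h + y, ?_⟩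
  change toAcris p _ (_ + _) + _ = _
  rw [map_add, map_mul, map_pow, map_natCast, toAcris_hullSum]
  ring

theorem pow_dvd_acrisSum_iff {k : ℕ} {l : (Fin n → Exponent p) →₀ WittVector p B} :
    (p : Acris p (KeyRing p B n)) ^ k ∣ acrisSum p B n l ↔
      ∀ α, (p : WittVector p B) ^ k ∣ l α := by
  refine ⟨fun h => ?_, fun h => ?_⟩
  · rw [← toAcris_hullSum] at h
    exact pow_dvd_of_pow_dvd_hullSum ((pow_dvd_algebraMap_adicCompletion_iff p k _).1 h)
  · rw [← Ideal.mem_span_singleton]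
    refine combination_mem _ _ _ fun α => Ideal.mul_mem_right _ _ ?_
    have dvd_map := map_dvd (acrisConst p B n) (h α)
    rwa [map_pow, map_natCast, ← Ideal.mem_span_singleton] at dvd_map

instance : IsAddTorsionFree (Acris p (KeyRing p B n)) :=
  isAddTorsionFree_of_isAdicComplete p fun u hu => by
    refine eq_zero_of_forall_pow_dvd (a := (p : Acris p (KeyRing p B n))) fun k => ?_
    obtain ⟨l, u', rfl⟩ := exists_eq_acrisSum_add_pow_mul k u
    have dvd_nsmul : (p : Acris p (KeyRing p B n)) ^ (1 + k) ∣ acrisSum p B n (p • l) :=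
      ⟨-u', by
        rw [map_nsmul, nsmul_eq_mul, pow_add, pow_one]
        linear_combination hu⟩
    refine dvd_add (pow_dvd_acrisSum_iff.2 fun α => ?_) (dvd_mul_right _ _)
    have dvd_coeff := pow_dvd_acrisSum_iff.1 dvd_nsmul α
    rw [Finsupp.smul_apply, nsmul_eq_mul] at dvd_coeff
    refine pow_dvd_of_pow_add_dvd (k := 1) ?_
    rwa [pow_one]

theorem weight_mul_acrisMonomial (α : Fin n → Exponent p) :
    (weight α : Acris p (KeyRing p B n)) * acrisMonomial p B α =
      algebraMap (WFlat p (KeyRing p B n)) _ (flatMonomial p B n (.ofAdd α)) := by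
  rw [algebraMap_acris_eq_toAcris, ← weight_mul_hullMonomial, map_mul, map_natCast, acrisMonomial]

theorem acrisFrobenius_acrisMonomial (α : Fin n → Exponent p) :
    acrisFrobenius p _ (acrisMonomial p B α) =
      (weightRatio α : Acris p (KeyRing p B n)) * acrisMonomial p B (p • α) := by
  refine natCast_mul_left_cancel (weight_ne_zero α) ?_
  rw [← mul_assoc, ← Nat.cast_mul, weight_mul_weightRatio, weight_mul_acrisMonomial,
    ← map_natCast (acrisFrobenius p _), ← map_mul, weight_mul_acrisMonomial,
    acrisFrobenius_algebraMap, flatMonomial_apply, frobenius_teichmuller, flatMonomial_apply,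
    ← map_pow, ← map_pow, AddMonoidAlgebra.single_pow, one_pow]

theorem acrisFrobenius_acrisConst (c : WittVector p B) :
    acrisFrobenius p _ (acrisConst p B n c) = acrisConst p B n (WittVector.frobenius c) := by
  change acrisFrobenius p _ (algebraMap (WFlat p (KeyRing p B n)) _ (flatConst p B n c)) = _
  rw [acrisFrobenius_algebraMap]
  exact congrArg _ ((WittVector.frobenius_isPoly p).map _ c).symm

variable (p B n) in
/-- The action of the Frobenius of `A_cris(C)` on the coefficients of `acrisSum p B n`. -/
def coeffFrobenius : ((Fin n → Exponent p) →₀ WittVector p B) →+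
    ((Fin n → Exponent p) →₀ WittVector p B) :=
  Finsupp.liftAddHom fun α => (Finsupp.singleAddHom (p • α)).comp
    ((AddMonoidHom.mulLeft (weightRatio α : WittVector p B)).comp
      (WittVector.frobenius (p := p) (R := B)).toAddMonoidHom)

omit [CharP B p] [PerfectRing B p] in
theorem coeffFrobenius_single (α : Fin n → Exponent p) (c : WittVector p B) :
    coeffFrobenius p B n (Finsupp.single α c) =
      Finsupp.single (p • α) (weightRatio α * WittVector.frobenius c) :=
  Finsupp.liftAddHom_apply_single _ _ _

omit [CharP B p] [PerfectRing B p] in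
theorem coeffFrobenius_apply_nsmul (l : (Fin n → Exponent p) →₀ WittVector p B)
    (α : Fin n → Exponent p) : coeffFrobenius p B n l (p • α) =
      weightRatio α * WittVector.frobenius (l α) := by
  classical
  induction l using Finsupp.induction_linear with
  | zero => rw [map_zero, Finsupp.zero_apply, Finsupp.zero_apply, map_zero, mul_zero]
  | add l l' h h' => rw [map_add, Finsupp.add_apply, h, h', Finsupp.add_apply, map_add, mul_add]
  | single β c =>
    rw [coeffFrobenius_single, Finsupp.single_apply, Finsupp.single_apply]
    by_cases h : β = α
    · subst h
      rw [if_pos rfl, if_pos rfl]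
    · rw [if_neg h, if_neg fun h' => h (Exponent.nsmul_pi_injective h'), map_zero, mul_zero]

theorem acrisFrobenius_acrisSum (l : (Fin n → Exponent p) →₀ WittVector p B) :
    acrisFrobenius p _ (acrisSum p B n l) = acrisSum p B n (coeffFrobenius p B n l) := by
  induction l using Finsupp.induction_linear with
  | zero => simp only [map_zero]
  | add l l' h h' => simp only [map_add, h, h']
  | single α c =>
    rw [coeffFrobenius_single, combination_single, combination_single, map_mul, map_mul,
      acrisFrobenius_acrisMonomial, acrisFrobenius_acrisConst, map_natCast]
    ring

theorem exists_pow_dvd_of_acrisFrobenius_eq_zero (α : Fin n → Exponent p) :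
    ∃ v, ∀ (k : ℕ) (l : (Fin n → Exponent p) →₀ WittVector p B) (u : Acris p (KeyRing p B n)),
      acrisFrobenius p _ (acrisSum p B n l + (p : Acris p (KeyRing p B n)) ^ (v + k) * u) = 0 →
        (p : WittVector p B) ^ k ∣ l α := by
  obtain ⟨v, hv⟩ := exists_pow_dvd_of_pow_add_dvd_natCast_mul (p := p) (R := WittVector p B)
    (weightRatio_ne_zero α)
  refine ⟨v, fun k l u h => pow_dvd_of_pow_dvd_frobenius (hv k _ ?_)⟩
  rw [← coeffFrobenius_apply_nsmul]
  refine pow_dvd_acrisSum_iff.1 ⟨-acrisFrobenius p _ u, ?_⟩ _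
  rw [map_add, map_mul, map_pow, map_natCast, acrisFrobenius_acrisSum] at h
  linear_combination h

variable (p B n) in
theorem acrisFrobenius_injective :
    Function.Injective (acrisFrobenius p (KeyRing p B n)) := by
  refine (injective_iff_map_eq_zero _).2 fun u hu =>
    eq_zero_of_forall_pow_dvd (a := (p : Acris p (KeyRing p B n))) fun k => ?_
  obtain ⟨l, u', hl⟩ := exists_eq_acrisSum_add_pow_mul k u
  suffices h : ∀ α, (p : WittVector p B) ^ k ∣ l α by
    rw [hl]
    exact dvd_add (pow_dvd_acrisSum_iff.2 h) (dvd_mul_right _ _)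
  intro α
  obtain ⟨v, hv⟩ := exists_pow_dvd_of_acrisFrobenius_eq_zero (B := B) α
  obtain ⟨l', u'', hl'⟩ := exists_eq_acrisSum_add_pow_mul (v + k) u
  have dvd_sub : (p : Acris p (KeyRing p B n)) ^ k ∣ acrisSum p B n (l - l') := by
    refine ⟨p ^ v * u'' - u', ?_⟩
    rw [map_sub]
    rw [pow_add] at hl'
    linear_combination hl' - hl
  have dvd_sub_apply := pow_dvd_acrisSum_iff.1 dvd_sub α
  rw [Finsupp.sub_apply] at dvd_sub_apply
  exact (dvd_iff_dvd_of_dvd_sub dvd_sub_apply).2 (hv k l' u'' (hl' ▸ hu))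

theorem acrisMonomial_mem_Icris {α : Fin n → Exponent p} {i : Fin n}
    (h : Exponent.floor (α i) ≠ 0) : acrisMonomial p B α ∈ Icris p (KeyRing p B n) := by
  rw [acrisMonomial, hullMonomial, ← Finset.mul_prod_erase _ _ (Finset.mem_univ i), map_mul,
    hullFactor, map_mul]
  exact Ideal.mul_mem_right _ _ (Ideal.mul_mem_left _ _ (toAcris_dp_mem_Icris h _))

-- If all exponents of `x ^ α` are less than `1`, Frobenius multiplies the divided power of `x ^ α`
-- by a `p`-adic unit, so the coefficient of `x ^ α` must be divisible by `p`.
theorem mem_Icris_of_natCast_dvd_acrisFrobenius (a : Acris p (KeyRing p B n))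
    (h : (p : Acris p (KeyRing p B n)) ∣ acrisFrobenius p (KeyRing p B n) a) :
    a ∈ Icris p (KeyRing p B n) := by
  obtain ⟨l, a', rfl⟩ := exists_eq_acrisSum_add_pow_mul 1 a
  rw [pow_one, map_add, map_mul, map_natCast, dvd_add_left (dvd_mul_right _ _),
    ← pow_one (p : Acris p (KeyRing p B n)), acrisFrobenius_acrisSum, pow_dvd_acrisSum_iff] at h
  rw [pow_one]
  refine add_mem (combination_mem _ _ _ fun α => ?_) (Ideal.mul_mem_right _ _ natCast_mem_Icris)
  by_cases hα : ∀ i, Exponent.floor (α i) = 0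
  · have dvd_coeff := h (p • α)
    rw [coeffFrobenius_apply_nsmul,
      (isUnit_natCast_of_not_dvd (not_dvd_weightRatio hα)).dvd_mul_left] at dvd_coeff
    have dvd_map := map_dvd (acrisConst p B n) (pow_dvd_of_pow_dvd_frobenius dvd_coeff)
    rw [pow_one, map_natCast] at dvd_map
    exact Ideal.mul_mem_right _ _ (Ideal.mem_of_dvd _ dvd_map natCast_mem_Icris)
  · obtain ⟨i, hi⟩ := not_forall.1 hα
    exact Ideal.mul_mem_left _ _ (acrisMonomial_mem_Icris hi)

variable (p B n) in
theorem coeff_zero_surjective : Function.Surjective (Perfection.coeff (KeyRing p B n) p 0) := by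
  intro c
  obtain ⟨q, rfl⟩ := Ideal.Quotient.mk_surjective c
  exact ⟨toFlat p q, coeff_toFlat 0 q⟩

end Structure

end Fontaine

universe u

theorem mainTheorem4_general (p : ℕ) [Fact p.Prime] (C : Type u) [CommRing C] [CharP C p]
    [IsAddTorsionFree (Fontaine.Acris p C)]
    (hF : Function.Injective (Fontaine.acrisFrobenius p C))
    (hI : ∀ a : Fontaine.Acris p C, (p : Fontaine.Acris p C) ∣ Fontaine.acrisFrobenius p C a →
      a ∈ Fontaine.Icris p C)
    (hC : Function.Surjective (Perfection.coeff C p 0)) :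
    (∃! γ : DividedPowers (Fontaine.Icris p C), Fontaine.IsCanonicalDividedPowers p C γ) ∧
    ∀ γ : DividedPowers (Fontaine.Icris p C), Fontaine.IsCanonicalDividedPowers p C γ →
      (∃! F' : Fontaine.Icris p C →ₛₗ[Fontaine.acrisFrobenius p C] Fontaine.Acris p C,
        Fontaine.IsFPrime p C γ F') ∧
      ∀ F' : Fontaine.Icris p C →ₛₗ[Fontaine.acrisFrobenius p C] Fontaine.Acris p C,
        Fontaine.IsFPrime p C γ F' →
        (∃! f : Fontaine.M p C →ₗ[Fontaine.WFlat p C] Fontaine.Acris p C,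
          Fontaine.IsCanonicalMap F' f) ∧
        ∀ f : Fontaine.M p C →ₗ[Fontaine.WFlat p C] Fontaine.Acris p C,
          Fontaine.IsCanonicalMap F' f →
            Function.Injective f ∧ Set.range f = Fontaine.AcrisDoublePrime p C :=
  ⟨Fontaine.existsUnique_isCanonicalDividedPowers, fun _ _ =>
    ⟨Fontaine.existsUnique_isFPrime, fun _ hF' =>
      ⟨Fontaine.existsUnique_isCanonicalMap hF'.natCast_mul, fun _ hf =>
        ⟨hf.injective hF'.natCast_mul hF, hf.range_eq hF'.natCast_mul hF hI hC⟩⟩⟩⟩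

theorem mainTheorem4 (p : ℕ) [Fact p.Prime] (B : Type*) [CommRing B] [CharP B p] [PerfectRing B p]
    (n : ℕ) :
    (∃! γ : DividedPowers (Fontaine.Icris p (Fontaine.KeyRing p B n)),
      Fontaine.IsCanonicalDividedPowers p (Fontaine.KeyRing p B n) γ) ∧
    ∀ γ : DividedPowers (Fontaine.Icris p (Fontaine.KeyRing p B n)),
      Fontaine.IsCanonicalDividedPowers p (Fontaine.KeyRing p B n) γ →
      (∃! F' : Fontaine.Icris p (Fontaine.KeyRing p B n)
            →ₛₗ[Fontaine.acrisFrobenius p (Fontaine.KeyRing p B n)]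
              Fontaine.Acris p (Fontaine.KeyRing p B n),
        Fontaine.IsFPrime p (Fontaine.KeyRing p B n) γ F') ∧
      ∀ F' : Fontaine.Icris p (Fontaine.KeyRing p B n)
            →ₛₗ[Fontaine.acrisFrobenius p (Fontaine.KeyRing p B n)]
              Fontaine.Acris p (Fontaine.KeyRing p B n),
        Fontaine.IsFPrime p (Fontaine.KeyRing p B n) γ F' →
        (∃! f : Fontaine.M p (Fontaine.KeyRing p B n)
              →ₗ[Fontaine.WFlat p (Fontaine.KeyRing p B n)]
                Fontaine.Acris p (Fontaine.KeyRing p B n),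
          Fontaine.IsCanonicalMap F' f) ∧
        ∀ f : Fontaine.M p (Fontaine.KeyRing p B n)
              →ₗ[Fontaine.WFlat p (Fontaine.KeyRing p B n)]
                Fontaine.Acris p (Fontaine.KeyRing p B n),
          Fontaine.IsCanonicalMap F' f →
            Function.Injective f ∧
              Set.range f = Fontaine.AcrisDoublePrime p (Fontaine.KeyRing p B n) :=
  mainTheorem4_general p _ (Fontaine.acrisFrobenius_injective p B n)
    Fontaine.mem_Icris_of_natCast_dvd_acrisFrobenius (Fontaine.coeff_zero_surjective p B n)
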